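/- Let $\lambda_{cu0},\lambda_{cu1},\lambda_u,\lambda_s,\lambda_{cs0},\lambda_{cs1}$ be real constants with $$1<\lambda_{cu1}<2<\lambda_{cu0}<\lambda_u,\qquad 0<\lambda_s<\lambda_{cs0}<\tfrac12<\lambda_{cs1}<1,$$ $$\lambda_{cu0}^{-1}+\lambda_{cu1}^{-1}>1,\quad \lambda_{cs0}+\lambda_{cs1}>1,\quad \lambda_{cs0}\lambda_{cs1}\lambda_u^2<1,\quad 1<\lambda_{cs0}\lambda_u^2<2,$$ and put $a_{cu}=\frac1{1-\lambda_{cu0}^{-1}}$, $a_u=\frac1{1-\lambda_u^{-1}}$, $a_s=\frac1{1-\lambda_s}$, $a_{cs}=\frac1{1-\lambda_{cs0}}$. On $\mathbb R^4$ with coordinates $(x_u,y_u,x_s,y_s)$ let $$\mathbb V_0=[-1-2\lambda_{cu0}^{-1},-1+2\lambda_{cu0}^{-1}]\times[-1-2\lambda_u^{-1},-1+2\lambda_u^{-1}]\times[-2,2]^2,$$ $$\mathbb V_1=[1-3\lambda_{cu1}^{-1},1+\lambda_{cu1}^{-1}]\times[1-2\lambda_u^{-1},1+2\lambda_u^{-1}]\times[-2,2]^2,\qquad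 \mathbb V_*=[-\delta,\delta]^2\times[-2,2]^2 .$$ There is a constant $L>0$, depending only on the six constants above, such that the following holds for all $\lambda_*,\mu_*\ge L$, all $0<\delta<1-2\lambda_u^{-1}$, all $a_1>\frac1{2(1-2\lambda_u^{-1})}$, all $0<a_2<\frac{2\lambda_s}{\delta}$ and every integer $r$ with $1\le r<\infty$. Let $F\colon\mathbb R^4\to\mathbb R^4$ be any $C^r$ diffeomorphism with $$F(x_u,y_u,x_s,y_s)=\begin{cases}(\lambda_{cu0}(x_u+1),\ \lambda_u(y_u+1),\ \lambda_sx_s-1,\ \lambda_{cs0}y_s-1)&\text{on }\mathbb V_0,\\ (\lambda_{cu1}(x_u-1)+1,\ \lambda_u(y_u-1),\ \lambda_sx_s+1,\ \lambda_{cs1}(y_s-1)+1)&\text{on }\mathbb V_1,\\ (-x_u^2+\lambda_*^{-1}(x_s-a_s)+1,\ -a_1y_u^2+\mu_*(y_s-1)+a_u,\ a_2x_u,\ y_u)&\text{on }\mathbb V_*.\end{cases}$$ (0) The maximal invariant set $\Lambda=\bigcap_{n\in\mathbb Z}F^n(\mathbb V_0\cup\mathbb V_1)$ is a hyperbolic set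 of $F$, $F|_\Lambda$ is topologically conjugate to the full two-sided shift on two symbols, and the projections of $\Lambda$ to the $x_u$- and $y_s$-axes are the whole intervals $[-a_{cu},1]$ and $[-a_{cs},1]$, respectively (the blender property). The point $q=(1,a_u,a_s,1)\in\Lambda$ is a saddle fixed point of $F$, and $y=(1,a_u,0,0)$ is a homoclinic tangency point of $q$ of codimension $4-\dim(T_yW^s(q)+T_yW^u(q))=2$, the largest possible in dimension four. Moreover, there are sequences $F_n$ and $G_n$ of $C^r$ diffeomorphisms of $\mathbb R^4$ converging to $F$ in the strong (Whitney) $C^r$ topology (that is, for each of the two sequences there is a compact set outside of which its members coincide with $F$ for all large $n$, and all derivatives of order at most $r$ converge uniformly) such that, for every $n$: (1) $F_n$ has a contracting wandering domain $D$ with bounded forward orbit $\bigcup_{i\ge0}F_n^i(D)$ such that every $x\in D$ has historic behavior, i.e. the empirical measures $\frac1{m+1}\sum_{i=0}^m\delta_{F_n^i(x)}$ do not converge weakly, as $m\to\infty$, to any Borel probability measure. (2) $G_n$ has a contracting wandering domain $D$ with bounded forward orbit $\bigcup_{i\ge0}G_n^i(D)$ and a saddle fixed point $p$ such that for every $x\in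 D$ the empirical measures $\frac1{m+1}\sum_{i=0}^m\delta_{G_n^i(x)}$ converge weakly to $\delta_p$ as $m\to\infty$. Here a contracting wandering domain of $f$ is a non-empty connected open set $D$ such that the sets $f^i(D)$, $i\ge0$, are pairwise disjoint, the union of the $\omega$-limit sets of all $x\in D$ is not a single periodic orbit, and $\operatorname{diam}f^n(D)\to0$. A saddle fixed point is one at which the derivative has no eigenvalue of modulus one, some eigenvalue of modulus less than one and some of modulus greater than one. -/

import Mathlib

open Set Filter Topology MeasureTheory
open scoped Manifold ContDiff ENNReal

noncomputable section

/-! ### General dynamical notions -/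

/-- The empirical measure `(1 / (n + 1)) ∑_{i = 0}^{n} δ_{f^i(x)}`. -/
def empiricalMeasure {M : Type*} [MeasurableSpace M] (f : M → M) (x : M) (n : ℕ) : Measure M :=
  ((n : ℝ≥0∞) + 1)⁻¹ • ∑ i ∈ Finset.range (n + 1), Measure.dirac (f^[i] x)

instance empiricalMeasure_isProbabilityMeasure {M : Type*} [MeasurableSpace M]
    (f : M → M) (x : M) (n : ℕ) : IsProbabilityMeasure (empiricalMeasure f x n) := by
  constructor
  have h0 : ((n : ℝ≥0∞) + 1) ≠ 0 := by simp
  have h1 : ((n : ℝ≥0∞) + 1) ≠ ⊤ := by finiteness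
  simp [empiricalMeasure, ENNReal.inv_mul_cancel h0 h1]

/-- The empirical measure as an element of the space of Borel probability measures, which
carries the topology of weak convergence. -/
def empirical {M : Type*} [MeasurableSpace M] (f : M → M) (x : M) (n : ℕ) :
    ProbabilityMeasure M :=
  ⟨empiricalMeasure f x n, empiricalMeasure_isProbabilityMeasure f x n⟩

/-- `x` has historic behavior: its empirical measures do not converge weakly. -/
def HasHistoricBehavior {M : Type*} [MetricSpace M] [MeasurableSpace M] [BorelSpace M]
    (f : M → M) (x : M) : Prop :=
  ¬ ∃ μ : ProbabilityMeasure M, Tendsto (empirical f x) atTop (𝓝 μ)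

/-- The `ω`-limit set of the point `x`. -/
def omegaSet {M : Type*} [TopologicalSpace M] (f : M → M) (x : M) : Set M :=
  omegaLimit atTop (fun (n : ℕ) (y : M) => f^[n] y) {x}

/-- Non-trivial wandering domains. -/
structure IsWanderingDomain {M : Type*} [MetricSpace M] (f : M → M) (D : Set M) : Prop where
  isOpen : IsOpen D
  isConnected : IsConnected D
  disjoint_images : ∀ i j : ℕ, i ≠ j → Disjoint (f^[i] '' D) (f^[j] '' D)
  not_single_periodic_orbit :
    ¬ ∃ p ∈ Function.periodicPts f, (⋃ x ∈ D, omegaSet f x) = range (fun i : ℕ => f^[i] p)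

/-- Contracting (non-trivial) wandering domains: the diameters of the images tend to zero. -/
structure IsContractingWanderingDomain {M : Type*} [MetricSpace M] (f : M → M) (D : Set M) :
    Prop extends IsWanderingDomain f D where
  contracting : Tendsto (fun n : ℕ => Metric.ediam (f^[n] '' D)) atTop (𝓝 0)

/-- The stable set of `x`; the unstable set is the stable set for the inverse map. -/
def stableSet {M : Type*} [MetricSpace M] (f : M → M) (x : M) : Set M :=
  {y | Tendsto (fun n : ℕ => dist (f^[n] x) (f^[n] y)) atTop (𝓝 0)}

/-! ### Diffeomorphisms of four-dimensional space -/

/-- `ℝ⁴`, with coordinates `(x_u, y_u, x_s, y_s)` numbered `0, 1, 2, 3`. -/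
abbrev E4 : Type := EuclideanSpace ℝ (Fin 4)

/-- `C^r` diffeomorphisms of `ℝ⁴` onto itself. -/
abbrev CrDiffeo (r : ℕ) : Type := Diffeomorph 𝓘(ℝ, E4) 𝓘(ℝ, E4) E4 E4 (r : WithTop ℕ∞)

/-- Convergence of a sequence in the strong (Whitney) `C^r` topology on maps `ℝ⁴ → ℝ⁴`: outside a
compact set the maps eventually coincide with the limit, and all derivatives of order at most `r`
converge uniformly. -/
def ConvergesCr (r : ℕ) (f : ℕ → E4 → E4) (F : E4 → E4) : Prop :=
  (∃ K : Set E4, IsCompact K ∧ ∀ᶠ n in atTop, EqOn (f n) F Kᶜ) ∧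
  ∀ k : ℕ, k ≤ r →
    TendstoUniformly (fun n x => iteratedFDeriv ℝ k (f n) x)
      (fun x => iteratedFDeriv ℝ k F x) atTop

/-- `Λ` is a hyperbolic set of `f`. The continuous splitting `T_x = E^s(x) ⊕ E^u(x)` is given by
the projection `P x` onto `E^s(x)` along `E^u(x)`; invariance of the splitting under `Df` says that
the projections are intertwined by `Df`. -/
structure IsHyperbolicSet {r : ℕ} (f : CrDiffeo r) (Λ : Set E4) : Prop where
  isCompact : IsCompact Λ
  invariant : f '' Λ = Λ
  splitting : ∃ P : E4 → E4 →L[ℝ] E4, ContinuousOn P Λ ∧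
    (∀ x ∈ Λ, P x ∘L P x = P x) ∧
    (∀ x ∈ Λ, P (f x) ∘L fderiv ℝ f x = fderiv ℝ f x ∘L P x) ∧
    ∃ C lam : ℝ, 0 < C ∧ 0 < lam ∧ lam < 1 ∧ ∀ x ∈ Λ, ∀ n : ℕ,
      (∀ v : E4, P x v = v → ‖fderiv ℝ (f^[n]) x v‖ ≤ C * lam ^ n * ‖v‖) ∧
      (∀ v : E4, P x v = 0 → ‖fderiv ℝ (f.symm^[n]) x v‖ ≤ C * lam ^ n * ‖v‖)

/-- `W` is an injectively immersed `C^r` copy of some `ℝ^d`, and `T` is its tangent space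
at `y ∈ W`. -/
def IsTangentSpaceAt (r : ℕ) (W : Set E4) (y : E4) (T : Submodule ℝ E4) : Prop :=
  ∃ (d : ℕ) (ι : EuclideanSpace ℝ (Fin d) → E4),
    ContDiff ℝ r ι ∧ Function.Injective ι ∧ (∀ u, Function.Injective (fderiv ℝ ι u)) ∧
    range ι = W ∧
    ∃ u, ι u = y ∧ T = LinearMap.range (fderiv ℝ ι u : EuclideanSpace ℝ (Fin d) →ₗ[ℝ] E4)

/-- `y` is a homoclinic point of `p`, and the tangent spaces at `y` of the stable and the unstable
manifold of `p` span a subspace of codimension `c`. For `c > 0` this is a homoclinic tangency of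
codimension `c`. -/
def IsHomoclinicOfCodim {r : ℕ} (f : CrDiffeo r) (p y : E4) (c : ℕ) : Prop :=
  y ∈ stableSet f p ∩ stableSet f.symm p ∧ y ≠ p ∧
  ∃ Ts Tu : Submodule ℝ E4,
    IsTangentSpaceAt r (stableSet f p) y Ts ∧
    IsTangentSpaceAt r (stableSet f.symm p) y Tu ∧
    Module.finrank ℝ (Ts ⊔ Tu : Submodule ℝ E4) + c = 4

/-- `f` restricted to `Λ` is topologically conjugate to the full two-sided shift on two symbols. -/
def IsConjugateToFullShift (f : E4 → E4) (Λ : Set E4) : Prop :=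
  ∃ h : (ℤ → Bool) ≃ₜ Λ, ∀ w : ℤ → Bool, (h (fun n => w (n + 1)) : E4) = f (h w)

/-- `p` is a saddle fixed point of `f`: the derivative at `p` has no (complex) eigenvalue of
modulus one, at least one inside and at least one outside the unit circle. -/
def IsSaddleFixedPoint (f : E4 → E4) (p : E4) : Prop :=
  f p = p ∧
  (∀ z ∈ (LinearMap.charpoly (fderiv ℝ f p : E4 →ₗ[ℝ] E4)).aroots ℂ, ‖z‖ ≠ 1) ∧
  (∃ z ∈ (LinearMap.charpoly (fderiv ℝ f p : E4 →ₗ[ℝ] E4)).aroots ℂ, ‖z‖ < 1) ∧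
  (∃ z ∈ (LinearMap.charpoly (fderiv ℝ f p : E4 →ₗ[ℝ] E4)).aroots ℂ, 1 < ‖z‖)

/-! ### The explicit map -/

/-- The constants `λ_{cu0}, λ_{cu1}, λ_u, λ_s, λ_{cs0}, λ_{cs1}`. -/
structure Rates where
  cu0 : ℝ
  cu1 : ℝ
  u : ℝ
  s : ℝ
  cs0 : ℝ
  cs1 : ℝ

namespace Rates

/-- The standing inequalities between the constants. -/
structure Admissible (c : Rates) : Prop where
  one_lt_cu1 : 1 < c.cu1
  cu1_lt_two : c.cu1 < 2
  two_lt_cu0 : 2 < c.cu0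
  cu0_lt_u : c.cu0 < c.u
  s_pos : 0 < c.s
  s_lt_cs0 : c.s < c.cs0
  cs0_lt_half : c.cs0 < 1 / 2
  half_lt_cs1 : 1 / 2 < c.cs1
  cs1_lt_one : c.cs1 < 1
  cover_u : 1 < c.cu0⁻¹ + c.cu1⁻¹
  cover_s : 1 < c.cs0 + c.cs1
  contraction : c.cs0 * c.cs1 * c.u ^ 2 < 1
  one_lt_cs0_mul : 1 < c.cs0 * c.u ^ 2
  cs0_mul_lt_two : c.cs0 * c.u ^ 2 < 2

/-- `a_{cu} = 1 / (1 - λ_{cu0}⁻¹)`. -/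
def a_cu (c : Rates) : ℝ := 1 / (1 - c.cu0⁻¹)

/-- `a_u = 1 / (1 - λ_u⁻¹)`. -/
def a_u (c : Rates) : ℝ := 1 / (1 - c.u⁻¹)

/-- `a_s = 1 / (1 - λ_s)`. -/
def a_s (c : Rates) : ℝ := 1 / (1 - c.s)

/-- `a_{cs} = 1 / (1 - λ_{cs0})`. -/
def a_cs (c : Rates) : ℝ := 1 / (1 - c.cs0)

/-- The fixed point `q = (1, a_u, a_s, 1)`. -/
def q (c : Rates) : E4 := !₂[1, c.a_u, c.a_s, 1]

/-- The box `V₀ × [-2, 2]²`. -/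
def box0 (c : Rates) : Set E4 :=
  {x | x 0 ∈ Icc (-1 - 2 * c.cu0⁻¹) (-1 + 2 * c.cu0⁻¹) ∧
    x 1 ∈ Icc (-1 - 2 * c.u⁻¹) (-1 + 2 * c.u⁻¹) ∧
    x 2 ∈ Icc (-2) 2 ∧ x 3 ∈ Icc (-2) 2}

/-- The box `V₁ × [-2, 2]²`. -/
def box1 (c : Rates) : Set E4 :=
  {x | x 0 ∈ Icc (1 - 3 * c.cu1⁻¹) (1 + c.cu1⁻¹) ∧
    x 1 ∈ Icc (1 - 2 * c.u⁻¹) (1 + 2 * c.u⁻¹) ∧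
    x 2 ∈ Icc (-2) 2 ∧ x 3 ∈ Icc (-2) 2}

end Rates

/-- The box `[-δ, δ]² × [-2, 2]²`. -/
def tangencyBox (δ : ℝ) : Set E4 :=
  {x | x 0 ∈ Icc (-δ) δ ∧ x 1 ∈ Icc (-δ) δ ∧ x 2 ∈ Icc (-2) 2 ∧ x 3 ∈ Icc (-2) 2}

/-- `F` is given by the explicit formulas on the two horseshoe boxes and on the tangency box;
`lst` and `mst` are the constants `λ_*` and `μ_*`. -/
structure IsModelMap (c : Rates) (lst mst δ a₁ a₂ : ℝ) (F : E4 → E4) : Prop where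
  on_box0 : ∀ x ∈ c.box0,
    F x = !₂[c.cu0 * (x 0 + 1), c.u * (x 1 + 1), c.s * x 2 - 1, c.cs0 * x 3 - 1]
  on_box1 : ∀ x ∈ c.box1,
    F x = !₂[c.cu1 * (x 0 - 1) + 1, c.u * (x 1 - 1), c.s * x 2 + 1, c.cs1 * (x 3 - 1) + 1]
  on_tangencyBox : ∀ x ∈ tangencyBox δ,
    F x = !₂[-(x 0) ^ 2 + lst⁻¹ * (x 2 - c.a_s) + 1,
      -a₁ * (x 1) ^ 2 + mst * (x 3 - 1) + c.a_u, a₂ * x 0, x 1]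

/-- The maximal invariant set `⋂_{n ∈ ℤ} F^n(𝕍₀ ∪ 𝕍₁)`. -/
def horseshoe {r : ℕ} (c : Rates) (F : CrDiffeo r) : Set E4 :=
  {x | ∀ n : ℕ, F^[n] x ∈ c.box0 ∪ c.box1 ∧ F.symm^[n] x ∈ c.box0 ∪ c.box1}

end

/-! On the two boxes the map is a shift in disguise: `x_u` and `y_u` are read from the future digits
and `x_s` and `y_s` from the past ones, through affine contractions. The coordinates `x_u` and `y_s`
use an overlapping pair (`pairMap`, `IsBlend`), so their values have many codes and fill an
interval; `y_u` and `x_s` use contractions with disjoint images (`signMap`). Coding yields the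
horseshoe, its hyperbolicity, the conjugacy and the two projections
(`Rates.IsAffineOn.range_point`). At the tangency the stable and the unstable manifold of `q` have
the same tangent plane, spanned by the last two coordinates (`Rates.isHomoclinicOfCodim_q`).

The wandering domains follow a prescribed orbit which alternates long words in the horseshoe with
passages near the tangency. A passage from a past word `e` to a future word `f` imposes two
relations: `x_u` after the passage is an affine function of `x_s` before it with the small slope
`lst⁻¹`, and `y_s` before the passage is an affine function of `y_u` after it with the small slope
`mst⁻¹`. In both, an overlapping coordinate has to follow a separated one. The overlap allows a word
on the overlapping side to be lengthened as soon as the interval on the other side is short. If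
neither word could be lengthened, the product of the two failing inequalities would contradict the
smallness of the two slopes (`Linked.exists_extend`). Hence both relations can be satisfied up to an
error that is exponentially small in the word lengths.

After a small shift of the target, `exists_junctions` gives infinitely many such pairs of words,
whose codes can be told apart after a prefix of length linear in the index. The passages are
therefore separated at a fixed geometric rate, whereas the errors can be made geometrically smaller
than the `r`-th power of the separation. A convergent sum of rescaled bumps then removes all errors
and is small in `C^r` (`exists_bump_sum`, `Rates.Admissible.exists_perturbed_route`).

The digits between two passages are free. A box of half-widths `ε` (unstable) and `η` (stable)
leaves a passage with unstable errors of order `ε ^ 2 + η`, which a word of length `n` expands at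
most by `u ^ n`. A run of `2a` digits, the second half of them zeros, contracts the stable
coordinates at least by `(cs0 * cs1) ^ a`. As `cs0 * cs1 * u ^ 2 < 1`, run lengths growing slowly at
a geometric rate are compatible with boxes mapped into boxes (`exists_growth`,
`Rates.Admissible.exists_sizes`, `Rates.IsRoute.iterate_mem`). The growing gaps between passages
make the first box a contracting wandering domain. Runs of ones followed by equally long runs of
zeros, comparable to the elapsed time, make the averages oscillate; runs of zeros alone make them
converge to the Dirac measure at the fixed point in the first box. -/

noncomputable section

/-! ### Words of affine maps of the line -/

/-- The composition of the affine maps `x ↦ r d * x + v d` along a word, the head of the word being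
applied last. -/
def wordMap (r v : Bool → ℝ) : List Bool → ℝ → ℝ
  | [], x => x
  | d :: w, x => r d * wordMap r v w x + v d

/-- The slope of `wordMap`. -/
def wordRate (r : Bool → ℝ) : List Bool → ℝ
  | [] => 1
  | d :: w => r d * wordRate r w

section Words

variable {r v : Bool → ℝ}

lemma wordMap_append (w₁ w₂ : List Bool) (x : ℝ) :
    wordMap r v (w₁ ++ w₂) x = wordMap r v w₁ (wordMap r v w₂ x) := by
  induction w₁ with
  | nil => rfl
  | cons d w ih => simp [wordMap, ih]

lemma wordRate_append (w₁ w₂ : List Bool) :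
    wordRate r (w₁ ++ w₂) = wordRate r w₁ * wordRate r w₂ := by
  induction w₁ with
  | nil => simp [wordRate]
  | cons d w ih => simp [wordRate, ih, mul_assoc]

lemma wordMap_sub (w : List Bool) (x y : ℝ) :
    wordMap r v w x - wordMap r v w y = wordRate r w * (x - y) := by
  induction w with
  | nil => simp [wordMap, wordRate]
  | cons d w ih =>
    simp only [wordMap, wordRate, add_sub_add_right_eq_sub, ← mul_sub, ih, mul_assoc]

lemma wordRate_pos (hr : ∀ d, 0 < r d) (w : List Bool) : 0 < wordRate r w := by
  induction w with
  | nil => simp [wordRate]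
  | cons d w ih => exact mul_pos (hr d) ih

lemma wordRate_le {b : ℝ} (hr : ∀ d, 0 < r d) (hb : ∀ d, r d ≤ b) (w : List Bool) :
    wordRate r w ≤ b ^ w.length := by
  induction w with
  | nil => simp [wordRate]
  | cons d w ih =>
    rw [List.length_cons, pow_succ, mul_comm]
    exact mul_le_mul (hb d) ih (wordRate_pos hr w).le ((hr d).le.trans (hb d))

lemma le_wordRate {b : ℝ} (h0 : 0 ≤ b) (hb : ∀ d, b ≤ r d) (w : List Bool) :
    b ^ w.length ≤ wordRate r w := by
  induction w with
  | nil => simp [wordRate]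
  | cons d w ih =>
    rw [List.length_cons, pow_succ, mul_comm]
    exact mul_le_mul (hb d) ih (pow_nonneg h0 _) (h0.trans (hb d))

lemma wordRate_const (t : ℝ) (w : List Bool) : wordRate (fun _ => t) w = t ^ w.length := by
  induction w with
  | nil => simp [wordRate]
  | cons d w ih => rw [wordRate, ih, List.length_cons, pow_succ, mul_comm]

lemma wordMap_mono (hr : ∀ d, 0 < r d) (w : List Bool) : Monotone (wordMap r v w) := by
  intro x y h
  have h1 := wordMap_sub (r := r) (v := v) w y x
  have h2 : 0 ≤ wordRate r w * (y - x) := mul_nonneg (wordRate_pos hr w).le (sub_nonneg.2 h)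
  linarith

lemma wordMap_mem_Icc {a b : ℝ} (h : ∀ d, ∀ x ∈ Icc a b, r d * x + v d ∈ Icc a b)
    (w : List Bool) {x : ℝ} (hx : x ∈ Icc a b) : wordMap r v w x ∈ Icc a b := by
  induction w with
  | nil => exact hx
  | cons d w ih => exact h d _ ih

lemma abs_wordMap_sub (hr : ∀ d, 0 < r d) (w : List Bool) (x y : ℝ) :
    |wordMap r v w x - wordMap r v w y| = wordRate r w * |x - y| := by
  rw [wordMap_sub, abs_mul, abs_of_pos (wordRate_pos hr w)]

/-- Iterating a word with a fixed point. -/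
lemma wordMap_flatten_replicate {g : List Bool} {x : ℝ} (hx : wordMap r v g x = x) (k : ℕ) :
    wordMap r v (List.replicate k g).flatten x = x := by
  induction k with
  | zero => rfl
  | succ k ih => rw [List.replicate_succ, List.flatten_cons, wordMap_append, ih, hx]

/-- A word of slope different from one has a fixed point. -/
lemma exists_wordMap_fixed {a b : ℝ} (hr : ∀ d, 0 < r d) (hr1 : ∀ d, r d < 1) (hab : a ≤ b)
    (h : ∀ d, ∀ x ∈ Icc a b, r d * x + v d ∈ Icc a b) {w : List Bool} (hw : w ≠ []) :
    ∃ x ∈ Icc a b, wordMap r v w x = x := by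
  have hlt : wordRate r w < 1 := by
    obtain ⟨d, w, rfl⟩ := List.exists_cons_of_ne_nil hw
    have := wordRate_le hr (fun d => (hr1 d).le) w
    rw [one_pow] at this
    calc r d * wordRate r w ≤ r d * 1 := mul_le_mul_of_nonneg_left this (hr d).le
      _ < 1 := by rw [mul_one]; exact hr1 d
  have hne : 1 - wordRate r w ≠ 0 := by linarith
  have key : ∀ y, wordMap r v w y - wordMap r v w 0 = wordRate r w * y := fun y => by
    rw [wordMap_sub, sub_zero]
  -- A word acts as the affine map with slope `wordRate r w` and value `wordMap r v w 0` at the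
  -- origin; this is the solution of its fixed point equation. It lies between `a` and `b` because
  -- the word moves `a` up and `b` down.
  refine ⟨wordMap r v w 0 / (1 - wordRate r w), ?_, ?_⟩
  · have ha := (wordMap_mem_Icc h w (left_mem_Icc.2 hab)).1
    have hb := (wordMap_mem_Icc h w (right_mem_Icc.2 hab)).2
    have h1 := key a
    have h2 := key b
    constructor
    · rw [le_div_iff₀ (by linarith)]; nlinarith
    · rw [div_le_iff₀ (by linarith)]; nlinarith
  · have := key (wordMap r v w 0 / (1 - wordRate r w))
    have h3 : wordMap r v w 0 = wordMap r v w 0 / (1 - wordRate r w) * (1 - wordRate r w) := by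
      field_simp
    linarith

end Words

/-! ### Overlapping pairs of contractions -/

/-- Slopes of a pair of contractions. -/
def pairRate (b₀ b₁ : ℝ) : Bool → ℝ := fun d => cond d b₁ b₀

/-- Shifts of the pair of contractions with fixed points `-1 / (1 - b₀)` and `1`. -/
def pairShift (b₁ : ℝ) : Bool → ℝ := fun d => cond d (1 - b₁) (-1)

/-- Shifts of the pair of contractions `x ↦ t * x ± 1`. -/
def signShift : Bool → ℝ := fun d => cond d 1 (-1)

/-- The composition of the overlapping contractions with slopes `b₀` and `b₁` along a word. -/
abbrev pairMap (b₀ b₁ : ℝ) : List Bool → ℝ → ℝ := wordMap (pairRate b₀ b₁) (pairShift b₁)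

/-- The composition of the contractions `x ↦ t * x ± 1` along a word. -/
abbrev signMap (t : ℝ) : List Bool → ℝ → ℝ := wordMap (fun _ => t) signShift

/-- The slopes `b₀`, `b₁` give an overlapping pair, and `t` is smaller than both of them. -/
structure IsBlend (b₀ b₁ t : ℝ) : Prop where
  t_pos : 0 < t
  t_lt : t < b₀
  lt_half : b₀ < 1 / 2
  half_lt : 1 / 2 < b₁
  lt_one : b₁ < 1
  overlap : 1 < b₀ + b₁

namespace IsBlend

variable {b₀ b₁ t : ℝ}

lemma pos (h : IsBlend b₀ b₁ t) : 0 < b₀ := h.t_pos.trans h.t_lt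

lemma pairRate_pos (h : IsBlend b₀ b₁ t) (d : Bool) : 0 < pairRate b₀ b₁ d := by
  have := h.pos; have := h.half_lt
  cases d <;> simp [pairRate] <;> linarith

lemma pairRate_le (h : IsBlend b₀ b₁ t) (d : Bool) : pairRate b₀ b₁ d ≤ b₁ := by
  have := h.lt_half; have := h.half_lt
  cases d <;> simp [pairRate]; linarith

lemma le_pairRate (h : IsBlend b₀ b₁ t) (d : Bool) : b₀ ≤ pairRate b₀ b₁ d := by
  have := h.lt_half; have := h.half_lt
  cases d <;> simp [pairRate]; linarith

lemma pairRate_lt_one (h : IsBlend b₀ b₁ t) (d : Bool) : pairRate b₀ b₁ d < 1 :=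
  (h.pairRate_le d).trans_lt h.lt_one

lemma one_lt_end (h : IsBlend b₀ b₁ t) : 1 < 1 / (1 - b₀) := by
  have := h.pos; have := h.lt_half
  rw [lt_div_iff₀] <;> linarith

lemma end_lt_two (h : IsBlend b₀ b₁ t) : 1 / (1 - b₀) < 2 := by
  have := h.pos; have := h.lt_half
  rw [div_lt_iff₀] <;> linarith

/-- The fixed point equation of the branch `x ↦ b₀ * x - 1` at `-(1 / (1 - b₀))`, in a form usable
by linear arithmetic. -/
lemma end_mul (h : IsBlend b₀ b₁ t) : b₀ * (1 / (1 - b₀)) = 1 / (1 - b₀) - 1 := by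
  have : 1 - b₀ ≠ 0 := by linarith [h.lt_half]
  field_simp; ring

lemma one_lt_sign_end (h : IsBlend b₀ b₁ t) : 1 < 1 / (1 - t) := by
  have := h.t_pos; have := h.t_lt; have := h.lt_half
  rw [lt_div_iff₀] <;> linarith

lemma sign_end_lt_two (h : IsBlend b₀ b₁ t) : 1 / (1 - t) < 2 := by
  have := h.t_pos; have := h.t_lt; have := h.lt_half
  rw [div_lt_iff₀] <;> linarith

lemma sign_end_mul (h : IsBlend b₀ b₁ t) : t * (1 / (1 - t)) = 1 / (1 - t) - 1 := by
  have : 1 - t ≠ 0 := by linarith [h.lt_half, h.t_lt]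
  field_simp; ring

lemma pair_mem (h : IsBlend b₀ b₁ t) (d : Bool) (x : ℝ) (hx : x ∈ Icc (-(1 / (1 - b₀))) 1) :
    pairRate b₀ b₁ d * x + pairShift b₁ d ∈ Icc (-(1 / (1 - b₀))) 1 := by
  obtain ⟨h1, h2⟩ := hx
  have := h.pos; have := h.lt_half; have := h.half_lt; have := h.lt_one; have := h.one_lt_end
  have := h.end_mul
  cases d <;> simp only [pairRate, pairShift, cond_true, cond_false, mem_Icc] <;>
    constructor <;> nlinarith

lemma sign_mem (h : IsBlend b₀ b₁ t) (d : Bool) (x : ℝ)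
    (hx : x ∈ Icc (-(1 / (1 - t))) (1 / (1 - t))) :
    t * x + signShift d ∈ Icc (-(1 / (1 - t))) (1 / (1 - t)) := by
  obtain ⟨h1, h2⟩ := hx
  have := h.t_pos; have := h.t_lt; have := h.lt_half; have := h.one_lt_sign_end
  have := h.sign_end_mul
  cases d <;> simp only [signShift, cond_true, cond_false, mem_Icc] <;>
    constructor <;> nlinarith

/-- The interval `[-2, 2]` is the stable side of the boxes. Words are also applied to points off the
horseshoe, and their orbits must not leave the region where the affine formulas hold. -/
lemma pair_mem_two (h : IsBlend b₀ b₁ t) (d : Bool) (x : ℝ) (hx : x ∈ Icc (-2 : ℝ) 2) :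
    pairRate b₀ b₁ d * x + pairShift b₁ d ∈ Icc (-2 : ℝ) 2 := by
  obtain ⟨h1, h2⟩ := hx
  have := h.pos; have := h.lt_half; have := h.half_lt; have := h.lt_one
  cases d <;> simp only [pairRate, pairShift, cond_true, cond_false, mem_Icc] <;>
    constructor <;> nlinarith

lemma sign_mem_two (h : IsBlend b₀ b₁ t) (d : Bool) (x : ℝ) (hx : x ∈ Icc (-2 : ℝ) 2) :
    t * x + signShift d ∈ Icc (-2 : ℝ) 2 := by
  obtain ⟨h1, h2⟩ := hx
  have := h.t_pos; have := h.t_lt; have := h.lt_half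
  cases d <;> simp only [signShift, cond_true, cond_false, mem_Icc] <;>
    constructor <;> nlinarith

/-- The length of the overlap of the two images. -/
def overlapLength (b₀ b₁ : ℝ) : ℝ := b₀ - 1 - (b₁ * (-(1 / (1 - b₀))) + (1 - b₁))

lemma overlapLength_pos (h : IsBlend b₀ b₁ t) : 0 < overlapLength b₀ b₁ := by
  have := h.pos; have := h.lt_half; have := h.half_lt; have := h.overlap; have := h.end_mul
  have h1 := h.one_lt_end
  -- This product is the overlap length itself, factored so that the sign is decided by `1 < b₀ +
  -- b₁`.
  have : 0 < (2 - b₀) * (1 / (1 - b₀)) * (b₁ - (1 - b₀)) := by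
    apply mul_pos (mul_pos _ _) <;> linarith
  unfold overlapLength
  have h3 : (1 / (1 - b₀)) * (1 - b₀) = 1 := by
    have : 1 - b₀ ≠ 0 := by linarith
    field_simp
  set a := 1 / (1 - b₀)
  nlinarith

/-- A short interval in the image of a word lies in the image of an extension of the word. -/
lemma exists_extend (h : IsBlend b₀ b₁ t) (w : List Bool) {lo hi : ℝ}
    (hlo : pairMap b₀ b₁ w (-(1 / (1 - b₀))) ≤ lo) (hhi : hi ≤ pairMap b₀ b₁ w 1)
    (hlen : hi - lo ≤ overlapLength b₀ b₁ * wordRate (pairRate b₀ b₁) w) :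
    ∃ d, pairMap b₀ b₁ (w ++ [d]) (-(1 / (1 - b₀))) ≤ lo ∧ hi ≤ pairMap b₀ b₁ (w ++ [d]) 1 := by
  -- The point `b₀ - 1` is the right end of the image of the branch `false`. An interval reaching
  -- beyond its copy starts at most one scaled overlap length to its left, hence to the right of the
  -- left end of the image of `true`.
  by_cases hc : hi ≤ pairMap b₀ b₁ w (b₀ - 1)
  · refine ⟨false, ?_, ?_⟩
    · rw [pairMap, wordMap_append]
      convert hlo using 2
      simp only [wordMap, pairRate, pairShift, cond_false]
      linarith [h.end_mul]
    · rw [pairMap, wordMap_append]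
      convert hc using 2
      simp only [wordMap, pairRate, pairShift, cond_false]
      ring
  · refine ⟨true, ?_, ?_⟩
    · rw [pairMap, wordMap_append]
      have := wordMap_sub (r := pairRate b₀ b₁) (v := pairShift b₁) w (b₀ - 1)
        (wordMap (pairRate b₀ b₁) (pairShift b₁) [true] (-(1 / (1 - b₀))))
      have h2 : b₀ - 1 - wordMap (pairRate b₀ b₁) (pairShift b₁) [true] (-(1 / (1 - b₀)))
          = overlapLength b₀ b₁ := by
        simp only [wordMap, pairRate, pairShift, cond_true, overlapLength]
      rw [h2] at this
      push Not at hc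
      simp only [pairMap] at hc
      linarith
    · rw [pairMap, wordMap_append]
      convert hhi using 2
      simp only [wordMap, pairRate, pairShift, cond_true]
      ring

/-- There is a word `0 1^m` whose fixed point lies in the interior of the overlap. -/
lemma exists_recurrent (h : IsBlend b₀ b₁ t) :
    ∃ (m : ℕ) (X θ : ℝ), 0 < θ ∧ pairMap b₀ b₁ (false :: List.replicate m true) X = X ∧
      b₁ * (-(1 / (1 - b₀))) + (1 - b₁) + θ ≤ X ∧ X + θ ≤ b₀ - 1 := by
  have hb := h.pos; have hb2 := h.lt_half; have hb3 := h.half_lt; have hb4 := h.lt_one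
  have hθ := h.overlapLength_pos
  -- Since `1^m` pushes everything to `1`, the fixed point of `0 1^m` tends to `b₀ - 1`, the right
  -- end of the overlap, from the left. With the slope `q = b₀ * b₁ ^ m` of the word, its distance
  -- to `b₀ - 1` lies between `q / 2` and `4 * q`, and `m` makes `4 * q` at most half the overlap.
  obtain ⟨m, hm⟩ := exists_pow_lt_of_lt_one (show 0 < overlapLength b₀ b₁ / 4 by linarith) hb4
  have hp : 0 < b₁ ^ m := by positivity
  have hp1 : b₁ ^ m ≤ 1 := pow_le_one₀ (by linarith) hb4.le
  have hq : b₀ * b₁ ^ m ≤ 1 / 2 := by nlinarith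
  have hq0 : 0 < b₀ * b₁ ^ m := by positivity
  set q := b₀ * b₁ ^ m with hqdef
  have hrep : ∀ y, pairMap b₀ b₁ (List.replicate m true) y = 1 - b₁ ^ m * (1 - y) := by
    intro y
    have h1 : pairMap b₀ b₁ (List.replicate m true) 1 = 1 := by
      clear * -
      induction m with
      | zero => rfl
      | succ m ih =>
        rw [List.replicate_succ, pairMap, wordMap]
        rw [pairMap] at ih
        rw [ih]; simp [pairRate, pairShift]
    have h2 : wordRate (pairRate b₀ b₁) (List.replicate m true) = b₁ ^ m := by
      clear * -
      induction m with
      | zero => rfl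
      | succ m ih => rw [List.replicate_succ, wordRate, ih, pow_succ, mul_comm]; simp [pairRate]
    have := wordMap_sub (r := pairRate b₀ b₁) (v := pairShift b₁) (List.replicate m true) 1 y
    rw [h2] at this
    rw [pairMap] at h1 ⊢
    linarith
  refine ⟨m, (b₀ - 1 - q) / (1 - q), min (overlapLength b₀ b₁ / 4) (q / 2), by positivity, ?_, ?_, ?_⟩
  · have := hrep ((b₀ - 1 - q) / (1 - q))
    rw [pairMap] at this
    rw [pairMap, wordMap, this]
    simp only [pairRate, pairShift, cond_false]
    have : 1 - q ≠ 0 := by linarith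
    field_simp
    rw [hqdef]; ring
  · have h1 := min_le_left (overlapLength b₀ b₁ / 4) (q / 2)
    have h2 : b₀ - 1 - 4 * q ≤ (b₀ - 1 - q) / (1 - q) := by
      rw [le_div_iff₀ (by linarith)]
      nlinarith
    have h3 : q ≤ overlapLength b₀ b₁ / 8 := by nlinarith
    have h4 : overlapLength b₀ b₁ = b₀ - 1 - (b₁ * (-(1 / (1 - b₀))) + (1 - b₁)) := rfl
    linarith
  · have h1 := min_le_right (overlapLength b₀ b₁ / 4) (q / 2)
    have h2 : (b₀ - 1 - q) / (1 - q) ≤ b₀ - 1 - q / 2 := by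
      rw [div_le_iff₀ (by linarith)]
      nlinarith
    linarith

end IsBlend

/-! ### Linking words across the tangency -/

/-- The affine image `x ↦ k * x + c` of the cylinder of the word `e` under the contractions of
slope `t` lies in the cylinder of `w` under the pair of contractions with slopes `b₀`, `b₁`. -/
def Fits (b₀ b₁ t k c : ℝ) (w e : List Bool) : Prop :=
  pairMap b₀ b₁ w (-(1 / (1 - b₀))) ≤ k * signMap t e (-(1 / (1 - t))) + c ∧
    k * signMap t e (1 / (1 - t)) + c ≤ pairMap b₀ b₁ w 1

section Fits

variable {b₀ b₁ t p₀ p₁ s k c : ℝ} {w e : List Bool}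

lemma signMap_sub (w : List Bool) (x y : ℝ) :
    signMap s w x - signMap s w y = s ^ w.length * (x - y) := by
  rw [signMap, wordMap_sub, wordRate_const]

/-- Lengthening `e` shrinks its cylinder, so the inclusion survives. -/
lemma Fits.append_right (hP : IsBlend p₀ p₁ s) (hk : 0 ≤ k) (h : Fits b₀ b₁ s k c w e)
    (d : Bool) : Fits b₀ b₁ s k c w (e ++ [d]) := by
  have h1 := hP.one_lt_sign_end
  have hm : Monotone (signMap s e) := wordMap_mono (fun _ => hP.t_pos) e
  have ha := (hP.sign_mem d _ (left_mem_Icc.2 (by linarith))).1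
  have hb := (hP.sign_mem d _ (right_mem_Icc.2 (by linarith))).2
  constructor
  · refine h.1.trans (add_le_add_left (mul_le_mul_of_nonneg_left ?_ hk) _)
    rw [signMap, wordMap_append]
    exact hm ha
  · refine le_trans (add_le_add_left (mul_le_mul_of_nonneg_left ?_ hk) _) h.2
    rw [signMap, wordMap_append]
    exact hm hb

/-- An interval no longer than the overlap inside the cylinder of `w` fits into one of the two
subcylinders. The factor `4` bounds the length of the base interval of the separated contractions.
-/
lemma Fits.exists_append_left (hF : IsBlend b₀ b₁ t) (hP : IsBlend p₀ p₁ s) (hk : 0 ≤ k)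
    (h : Fits b₀ b₁ s k c w e)
    (hlen : 4 * k * s ^ e.length ≤ IsBlend.overlapLength b₀ b₁ * wordRate (pairRate b₀ b₁) w) :
    ∃ d, Fits b₀ b₁ s k c (w ++ [d]) e := by
  refine hF.exists_extend w h.1 h.2 (le_trans ?_ hlen)
  have h1 := signMap_sub (s := s) e (1 / (1 - s)) (-(1 / (1 - s)))
  have h2 := hP.sign_end_lt_two
  have h3 : 0 ≤ k * s ^ e.length := mul_nonneg hk (pow_nonneg hP.t_pos.le _)
  have h4 : k * s ^ e.length * (1 / (1 - s) - -(1 / (1 - s))) ≤ k * s ^ e.length * 4 :=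
    mul_le_mul_of_nonneg_left (by linarith) h3
  have h5 := congrArg (fun y => k * y) h1
  linarith

/-- Compare the lengths of the nested intervals: the base interval of the separated contractions has
length at least `2`, that of the overlapping pair at most `3`. This is what makes the lengths of
linked words comparable. -/
lemma Fits.width (hF : IsBlend b₀ b₁ t) (hP : IsBlend p₀ p₁ s) (hk : 0 ≤ k)
    (h : Fits b₀ b₁ s k c w e) : 2 * k * s ^ e.length ≤ 3 * b₁ ^ w.length := by
  have h1 := signMap_sub (s := s) e (1 / (1 - s)) (-(1 / (1 - s)))
  have h2 := hP.one_lt_sign_end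
  have h3 : 0 ≤ k * s ^ e.length := mul_nonneg hk (pow_nonneg hP.t_pos.le _)
  have h4 : k * s ^ e.length * 2 ≤ k * s ^ e.length * (1 / (1 - s) - -(1 / (1 - s))) :=
    mul_le_mul_of_nonneg_left (by linarith) h3
  have h5 := congrArg (fun y => k * y) h1
  have h6 := wordMap_sub (r := pairRate b₀ b₁) (v := pairShift b₁) w 1 (-(1 / (1 - b₀)))
  have h7 := wordRate_le hF.pairRate_pos hF.pairRate_le w
  have h8 := hF.end_lt_two
  have h9 : wordRate (pairRate b₀ b₁) w * (1 - -(1 / (1 - b₀))) ≤ b₁ ^ w.length * 3 := by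
    apply mul_le_mul h7 (by linarith) (by linarith [hF.one_lt_end])
    exact pow_nonneg (by linarith [hF.half_lt]) _
  have h10 := h.1
  have h11 := h.2
  simp only [pairMap] at h10 h11
  linarith

/-- The error made by replacing the affine image of a point of the cylinder of `e` by a point of
the cylinder of `w`. -/
lemma Fits.error (hF : IsBlend b₀ b₁ t) (hP : IsBlend p₀ p₁ s) (hk : 0 ≤ k)
    (h : Fits b₀ b₁ s k c w e) {x z : ℝ} (hx : x ∈ Icc (-(1 / (1 - s))) (1 / (1 - s)))
    (hz : z ∈ Icc (-(1 / (1 - b₀))) 1) :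
    |pairMap b₀ b₁ w z - (k * signMap s e x + c)| ≤ 3 * b₁ ^ w.length := by
  have hm : Monotone (signMap s e) := wordMap_mono (fun _ => hP.t_pos) e
  have hm' : Monotone (pairMap b₀ b₁ w) := wordMap_mono hF.pairRate_pos w
  have h1 := mul_le_mul_of_nonneg_left (hm hx.1) hk
  have h2 := mul_le_mul_of_nonneg_left (hm hx.2) hk
  have h3 := hm' hz.1
  have h4 := hm' hz.2
  have h6 := wordMap_sub (r := pairRate b₀ b₁) (v := pairShift b₁) w 1 (-(1 / (1 - b₀)))
  have h7 := wordRate_le hF.pairRate_pos hF.pairRate_le w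
  have h8 := hF.end_lt_two
  have h9 : wordRate (pairRate b₀ b₁) w * (1 - -(1 / (1 - b₀))) ≤ b₁ ^ w.length * 3 := by
    apply mul_le_mul h7 (by linarith) (by linarith [hF.one_lt_end])
    exact pow_nonneg (by linarith [hF.half_lt]) _
  have h10 := h.1
  have h11 := h.2
  simp only [pairMap] at h10 h11 h3 h4 ⊢
  rw [abs_le]
  constructor <;> linarith

/-- It suffices to know one point `x` of the affine image and to have a margin `D` around it that
exceeds the length of the whole image. -/
lemma fits_of_center (hP : IsBlend p₀ p₁ s) (hk : 0 ≤ k) {x z D : ℝ}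
    (hz : z ∈ Icc (-(1 / (1 - s))) (1 / (1 - s))) (hx : x = k * signMap s e z + c)
    (hD : 4 * k * s ^ e.length ≤ D) (h1 : pairMap b₀ b₁ w (-(1 / (1 - b₀))) ≤ x - D)
    (h2 : x + D ≤ pairMap b₀ b₁ w 1) : Fits b₀ b₁ s k c w e := by
  have ha := hP.sign_end_lt_two
  have h3 : 0 ≤ k * s ^ e.length := mul_nonneg hk (pow_nonneg hP.t_pos.le _)
  have key : ∀ y ∈ Icc (-(1 / (1 - s))) (1 / (1 - s)),
      |k * signMap s e y - k * signMap s e z| ≤ D := by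
    intro y hy
    rw [← mul_sub, signMap_sub, ← mul_assoc, abs_mul, abs_of_nonneg h3]
    refine le_trans ?_ hD
    have : |y - z| ≤ 4 := by
      rw [abs_le]; constructor <;> linarith [hy.1, hy.2, hz.1, hz.2]
    nlinarith
  have h4 := abs_le.1 (key _ (left_mem_Icc.2 (hz.1.trans hz.2)))
  have h5 := abs_le.1 (key _ (right_mem_Icc.2 (hz.1.trans hz.2)))
  constructor <;> linarith

end Fits

/-- The past word `e` (read backwards) and the future word `f` are linked: the constraints on both
unstable coordinates are compatible. -/
structure Linked (b₀ b₁ t p₀ p₁ s k l c d : ℝ) (e f : List Bool) : Prop where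
  future : Fits b₀ b₁ s k c f e
  past : Fits p₀ p₁ t l d e f

section Linked

variable {b₀ b₁ t p₀ p₁ s k l c d : ℝ} {e f : List Bool}

/-- The two overlaps cooperate here. The future word can be lengthened if `k * s ^ e.length` is
small against the slope of `f`, the past word if `l * t ^ f.length` is small against the slope of
`e`. As `t < b₀` and `s < p₀`, these slopes are at least `t ^ f.length` and `s ^ e.length`. If both
conditions failed, these powers would cancel from the product of the two inequalities and leave a
contradiction with `hkl`. -/
lemma Linked.exists_extend (hF : IsBlend b₀ b₁ t) (hP : IsBlend p₀ p₁ s) (hk : 0 < k) (hl : 0 < l)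
    (hkl : 16 * k * l ≤ IsBlend.overlapLength b₀ b₁ * IsBlend.overlapLength p₀ p₁)
    (h : Linked b₀ b₁ t p₀ p₁ s k l c d e f) :
    ∃ e' f', Linked b₀ b₁ t p₀ p₁ s k l c d e' f' ∧ e <+: e' ∧ f <+: f' ∧
      e'.length + f'.length = e.length + f.length + 1 := by
  by_cases h1 : 4 * k * s ^ e.length ≤
      IsBlend.overlapLength b₀ b₁ * wordRate (pairRate b₀ b₁) f
  · obtain ⟨x, hx⟩ := h.future.exists_append_left hF hP hk.le h1
    exact ⟨e, f ++ [x], ⟨hx, h.past.append_right hF hl.le x⟩, List.prefix_rfl,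
      List.prefix_append _ _, by simp; ring⟩
  by_cases h2 : 4 * l * t ^ f.length ≤
      IsBlend.overlapLength p₀ p₁ * wordRate (pairRate p₀ p₁) e
  · obtain ⟨x, hx⟩ := h.past.exists_append_left hP hF hl.le h2
    exact ⟨e ++ [x], f, ⟨h.future.append_right hP hk.le x, hx⟩, List.prefix_append _ _,
      List.prefix_rfl, by simp; ring⟩
  exfalso
  push Not at h1 h2
  have hF0 := hF.overlapLength_pos
  have hP0 := hP.overlapLength_pos
  have h3 : t ^ f.length ≤ wordRate (pairRate b₀ b₁) f :=
    (pow_le_pow_left₀ hF.t_pos.le hF.t_lt.le _).trans (le_wordRate hF.pos.le hF.le_pairRate f)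
  have h4 : s ^ e.length ≤ wordRate (pairRate p₀ p₁) e :=
    (pow_le_pow_left₀ hP.t_pos.le hP.t_lt.le _).trans (le_wordRate hP.pos.le hP.le_pairRate e)
  have h5 : 0 < t ^ f.length := pow_pos hF.t_pos _
  have h6 : 0 < s ^ e.length := pow_pos hP.t_pos _
  have h7 : IsBlend.overlapLength b₀ b₁ * t ^ f.length < 4 * k * s ^ e.length :=
    (mul_le_mul_of_nonneg_left h3 hF0.le).trans_lt h1
  have h8 : IsBlend.overlapLength p₀ p₁ * s ^ e.length < 4 * l * t ^ f.length :=
    (mul_le_mul_of_nonneg_left h4 hP0.le).trans_lt h2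
  have h9 := mul_lt_mul'' h7 h8 (by positivity) (by positivity)
  have h10 : 0 < t ^ f.length * s ^ e.length := by positivity
  nlinarith [mul_le_mul_of_nonneg_right hkl h10.le]

lemma Linked.exists_extend_add (hF : IsBlend b₀ b₁ t) (hP : IsBlend p₀ p₁ s) (hk : 0 < k)
    (hl : 0 < l)
    (hkl : 16 * k * l ≤ IsBlend.overlapLength b₀ b₁ * IsBlend.overlapLength p₀ p₁)
    (h : Linked b₀ b₁ t p₀ p₁ s k l c d e f) (n : ℕ) :
    ∃ e' f', Linked b₀ b₁ t p₀ p₁ s k l c d e' f' ∧ e <+: e' ∧ f <+: f' ∧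
      e'.length + f'.length = e.length + f.length + n := by
  induction n with
  | zero => exact ⟨e, f, h, List.prefix_rfl, List.prefix_rfl, rfl⟩
  | succ n ih =>
    obtain ⟨e₁, f₁, h₁, he₁, hf₁, hn₁⟩ := ih
    obtain ⟨e₂, f₂, h₂, he₂, hf₂, hn₂⟩ := h₁.exists_extend hF hP hk hl hkl
    exact ⟨e₂, f₂, h₂, he₁.trans he₂, hf₁.trans hf₂, by omega⟩

/-- Choose `K` with `b ^ K` below both `t` and `k / 2`: if `n` exceeded `K * (m + 1)`, one factor `b
^ K` would beat `k / 2` and the other `m` would beat `t ^ m`. -/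
lemma exists_length_bound {b t k : ℝ} (hb : 0 < b) (hb1 : b < 1) (ht : 0 < t)
    (hk : 0 < k) : ∃ K : ℕ, ∀ m n : ℕ, 2 * k * t ^ m ≤ 3 * b ^ n → n ≤ K * (m + 1) := by
  obtain ⟨K, hK⟩ := exists_pow_lt_of_lt_one (show 0 < min t (k / 2) by positivity) hb1
  refine ⟨K, fun m n h => ?_⟩
  by_contra! hn
  have h1 : b ^ n ≤ (b ^ K) ^ (m + 1) := by
    rw [← pow_mul]; exact pow_le_pow_of_le_one hb.le hb1.le hn.le
  have h2 : (b ^ K) ^ (m + 1) ≤ k / 2 * t ^ m := by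
    rw [pow_succ, mul_comm]
    have h3 := hK.le.trans (min_le_left _ _)
    have h4 := hK.le.trans (min_le_right _ _)
    exact mul_le_mul h4 (pow_le_pow_left₀ (by positivity) h3 _) (by positivity) (by positivity)
  have : 0 < k * t ^ m := by positivity
  linarith

/-- The lengths of linked words are comparable. -/
lemma exists_linked_length_bound (hF : IsBlend b₀ b₁ t) (hP : IsBlend p₀ p₁ s) (hk : 0 < k)
    (hl : 0 < l) : ∃ K : ℕ, ∀ c d : ℝ, ∀ e f, Linked b₀ b₁ t p₀ p₁ s k l c d e f →
      f.length ≤ K * (e.length + 1) ∧ e.length ≤ K * (f.length + 1) := by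
  have hF1 := hF.t_lt; have hF2 := hF.lt_half; have hF3 := hF.half_lt
  have hP1 := hP.t_lt; have hP2 := hP.lt_half; have hP3 := hP.half_lt
  obtain ⟨K₁, h₁⟩ := exists_length_bound (b := b₁) (by linarith) hF.lt_one hP.t_pos hk
  obtain ⟨K₂, h₂⟩ := exists_length_bound (b := p₁) (by linarith) hP.lt_one hF.t_pos hl
  refine ⟨max K₁ K₂, fun c d e f h => ⟨?_, ?_⟩⟩
  · exact (h₁ _ _ (h.future.width hF hP hk.le)).trans
      (Nat.mul_le_mul_right _ (le_max_left _ _))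
  · exact (h₂ _ _ (h.past.width hP hF hl.le)).trans
      (Nat.mul_le_mul_right _ (le_max_right _ _))

/-- Padding the past word by blocks of length `M` improves the first inequality and spoils the
second. The first `j` for which the first one holds works: it failed one block earlier, and as `k *
l` is small even against `s ^ M`, this failure forces the second inequality at `j`. -/
lemma exists_balanced (hF : IsBlend b₀ b₁ t) (hP : IsBlend p₀ p₁ s) (hk : 0 < k) (hl : 0 < l)
    {θ θ' : ℝ} (hθ : 0 < θ) {M : ℕ} (hM : 0 < M)
    (hkl : 16 * k * l ≤ θ * θ' * s ^ M) (A B : ℕ) (h : 4 * l * t ^ B ≤ θ' * p₀ ^ A) :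
    ∃ j, 4 * k * s ^ (A + j * M) ≤ θ * b₀ ^ B ∧ 4 * l * t ^ B ≤ θ' * p₀ ^ (A + j * M) := by
  classical
  have hs := hP.t_pos
  have hs1 : s < 1 := by linarith [hP.t_lt, hP.lt_half]
  have hb := hF.pos
  have hex : ∃ j, 4 * k * s ^ (A + j * M) ≤ θ * b₀ ^ B := by
    have h0 : 0 < θ * b₀ ^ B / (4 * k) := by positivity
    obtain ⟨n, hn⟩ := exists_pow_lt_of_lt_one h0 hs1
    refine ⟨n, ?_⟩
    have h1 : s ^ (A + n * M) ≤ s ^ n :=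
      pow_le_pow_of_le_one hs.le hs1.le (by nlinarith)
    have h2 := h1.trans hn.le
    rw [le_div_iff₀ (by positivity)] at h2
    linarith
  refine ⟨Nat.find hex, Nat.find_spec hex, ?_⟩
  rcases Nat.eq_zero_or_pos (Nat.find hex) with h0 | h0
  · rw [h0]; simpa using h
  · obtain ⟨i, hi⟩ := Nat.exists_eq_succ_of_ne_zero h0.ne'
    have h1 : ¬ 4 * k * s ^ (A + i * M) ≤ θ * b₀ ^ B := Nat.find_min hex (by omega)
    push Not at h1
    rw [hi]
    have h2 : t ^ B ≤ b₀ ^ B := pow_le_pow_left₀ hF.t_pos.le hF.t_lt.le _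
    have h3 : s ^ (A + (i + 1) * M) ≤ p₀ ^ (A + (i + 1) * M) :=
      pow_le_pow_left₀ hs.le hP.t_lt.le _
    have h4 : s ^ (A + (i + 1) * M) = s ^ (A + i * M) * s ^ M := by rw [← pow_add]; ring_nf
    have h5 : 0 < s ^ (A + i * M) := pow_pos hs _
    have hθ' : 0 < θ' := by
      have h6 : 0 < 16 * k * l := by positivity
      have h7 : 0 < θ * s ^ M := by positivity
      by_contra! h8
      nlinarith
    have h6 : θ * (4 * l * t ^ B) ≤ θ * (θ' * s ^ (A + (i + 1) * M)) := by
      rw [h4]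
      have e1 : θ * (4 * l * t ^ B) ≤ 4 * l * (θ * b₀ ^ B) := by
        have := mul_le_mul_of_nonneg_left h2 (by positivity : 0 ≤ 4 * l * θ)
        linarith
      have e2 : 4 * l * (θ * b₀ ^ B) ≤ 4 * l * (4 * k * s ^ (A + i * M)) :=
        mul_le_mul_of_nonneg_left h1.le (by positivity)
      have e3 := mul_le_mul_of_nonneg_right hkl h5.le
      linarith
    exact (le_of_mul_le_mul_left h6 hθ).trans (mul_le_mul_of_nonneg_left h3 hθ'.le)

lemma pairMap_replicate_true (n : ℕ) : pairMap b₀ b₁ (List.replicate n true) 1 = 1 := by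
  induction n with
  | zero => rfl
  | succ n ih =>
    rw [List.replicate_succ, pairMap, wordMap]
    rw [pairMap] at ih
    rw [ih]; simp [pairRate, pairShift]

lemma signMap_replicate_true (h : t ≠ 1) (n : ℕ) :
    signMap t (List.replicate n true) (1 / (1 - t)) = 1 / (1 - t) := by
  have : 1 - t ≠ 0 := fun h' => h (by linarith)
  induction n with
  | zero => rfl
  | succ n ih =>
    rw [List.replicate_succ, signMap, wordMap]
    rw [signMap] at ih
    rw [ih]; simp only [signShift, cond_true]; field_simp; ring

/-- Points whose codes first differ after the common prefix `w` are apart. -/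
lemma signMap_separated (hF : IsBlend b₀ b₁ t) {w f g : List Bool} (hf : w ++ [true] <+: f)
    (hg : w ++ [false] <+: g) {y z : ℝ} (hy : y ∈ Icc (-(1 / (1 - t))) (1 / (1 - t)))
    (hz : z ∈ Icc (-(1 / (1 - t))) (1 / (1 - t))) :
    t ^ w.length * (2 * (2 - 1 / (1 - t))) ≤ signMap t f y - signMap t g z := by
  obtain ⟨f', rfl⟩ := hf
  obtain ⟨g', rfl⟩ := hg
  have h1 := wordMap_mem_Icc (r := fun _ => t) (v := signShift) hF.sign_mem f' hy
  have h2 := wordMap_mem_Icc (r := fun _ => t) (v := signShift) hF.sign_mem g' hz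
  simp only [signMap, wordMap_append]
  rw [wordMap_sub, wordRate_const]
  refine mul_le_mul_of_nonneg_left ?_ (pow_nonneg hF.t_pos.le _)
  simp only [wordMap, signShift, cond_true, cond_false]
  have := hF.sign_end_mul
  have h3 := mul_le_mul_of_nonneg_left h1.1 hF.t_pos.le
  have h4 := mul_le_mul_of_nonneg_left h2.2 hF.t_pos.le
  linarith

set_option maxHeartbeats 2000000 in
/-- Existence of linked words for infinitely many well separated junctions, after an arbitrarily
small shift of the target. -/
theorem exists_junctions (hF : IsBlend b₀ b₁ t) (hP : IsBlend p₀ p₁ s) :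
    ∃ L : ℝ, 1 ≤ L ∧ ∀ k l : ℝ, 0 < k → 0 < l → k ≤ L⁻¹ → l ≤ L⁻¹ → ∀ ξ : ℝ, 0 < ξ →
      ∃ c d : ℝ, |c| ≤ ξ ∧ |d| ≤ ξ ∧ ∃ (stem : ℕ → List Bool) (C : ℕ),
        (∀ i j, i < j → stem i ++ [false] <+: stem j) ∧
        (∀ i, (stem i).length ≤ C * (i + 1)) ∧
        ∀ n i : ℕ, ∃ e f : List Bool,
          Linked b₀ b₁ t p₀ p₁ s k l (1 + c - k * (1 / (1 - s))) (1 + d - l * (1 / (1 - t))) e f ∧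
          n ≤ e.length ∧ n ≤ f.length ∧ e.length + f.length ≤ C * (i + n + 1) ∧
          stem i ++ [true] <+: f ∧
          (∀ x ∈ Icc (-(1 / (1 - s))) (1 / (1 - s)), |signMap s e x - 1 / (1 - s)| ≤ ξ) ∧
          (∀ x ∈ Icc (-(1 / (1 - p₀))) 1, |pairMap p₀ p₁ e x - 1| ≤ ξ) := by
  obtain ⟨m, X, θ, hθ, hX, hX1, hX2⟩ := hF.exists_recurrent
  obtain ⟨m', Y, θ', hθ', hY, hY1, hY2⟩ := hP.exists_recurrent
  have ht := hF.t_pos; have hs := hP.t_pos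
  have ht1 : t < 1 := by linarith [hF.t_lt, hF.lt_half]
  have hs1 : s < 1 := by linarith [hP.t_lt, hP.lt_half]
  have hb1 : 0 < b₁ := by linarith [hF.half_lt]
  have hp1 : 0 < p₁ := by linarith [hP.half_lt]
  have hoF := hF.overlapLength_pos
  have hoP := hP.overlapLength_pos
  -- Repeating `g` fixes `X` in the overlapping coordinate and `yg` in the separated one, and
  -- likewise `g'` fixes `Y` and `xg`. All junctions can therefore be built through the same four
  -- numbers, however often the blocks are repeated.
  set g := false :: List.replicate m true with hg
  set g' := false :: List.replicate m' true with hg'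
  have hglen : g.length = m + 1 := by simp [hg]
  have hglen' : g'.length = m' + 1 := by simp [hg']
  obtain ⟨yg, hyg, hygf⟩ := exists_wordMap_fixed (r := fun _ => t) (v := signShift) (w := g)
    (fun _ => ht) (fun _ => ht1) (by linarith [hF.one_lt_sign_end]) hF.sign_mem (by simp [hg])
  obtain ⟨xg, hxg, hxgf⟩ := exists_wordMap_fixed (r := fun _ => s) (v := signShift) (w := g')
    (fun _ => hs) (fun _ => hs1) (by linarith [hP.one_lt_sign_end]) hP.sign_mem (by simp [hg'])
  -- The first entry is what `Linked.exists_extend` needs, the second is what `exists_balanced`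
  -- needs for padding by copies of `g'`.
  set κ := min (IsBlend.overlapLength b₀ b₁ * IsBlend.overlapLength p₀ p₁)
    (θ * θ' * s ^ (m' + 1)) with hκ
  have hκ0 : 0 < κ := by positivity
  refine ⟨max 1 (16 / κ), le_max_left _ _, fun k l hk hl hkL hlL ξ hξ => ?_⟩
  have hL1 : (max 1 (16 / κ))⁻¹ ≤ 1 := inv_le_one_of_one_le₀ (le_max_left _ _)
  have hL2 : (max 1 (16 / κ))⁻¹ ≤ κ / 16 := by
    rw [inv_le_comm₀ (by positivity) (by positivity), inv_div]
    exact le_max_right _ _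
  have hk1 := hkL.trans hL1
  have hl1 := hlL.trans hL1
  have hkl : 16 * k * l ≤ κ := by
    linarith only [mul_le_mul (hkL.trans hL2) hl1 hl.le (by positivity)]
  have hkl1 := hkl.trans (min_le_left _ _)
  have hkl2 := hkl.trans (min_le_right _ _)
  have hkl3 : 16 * k * l ≤ θ * θ' * s ^ 1 := by
    refine hkl2.trans (mul_le_mul_of_nonneg_left ?_ (by positivity))
    exact pow_le_pow_of_le_one hs.le hs1.le (by omega)
  set β := max b₁ p₁ with hβ
  have hβ1 : β < 1 := max_lt hF.lt_one hP.lt_one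
  have hβ0 : 0 < β := lt_max_of_lt_left hb1
  obtain ⟨N, hN⟩ := exists_pow_lt_of_lt_one (show 0 < ξ / 7 by positivity) hβ1
  have hsmall : ∀ r : ℝ, 0 ≤ r → r ≤ β → ∀ n, N ≤ n → r ^ n ≤ ξ / 7 := fun r h0 h1 n hn =>
    ((pow_le_pow_left₀ h0 h1 n).trans (pow_le_pow_of_le_one hβ0.le hβ1.le hn)).trans hN.le
  have hb1β : b₁ ≤ β := le_max_left _ _
  have hp1β : p₁ ≤ β := le_max_right _ _
  have hsβ : s ≤ β := by linarith [hP.t_lt, hP.lt_half, hP.half_lt]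
  have htβ : t ≤ β := by linarith [hF.t_lt, hF.lt_half, hF.half_lt]
  -- Words will begin with `1^a` or `1^b`. Both exponents are at least `N`, which puts the junction
  -- near the tangency; `b` is moreover so large that the past relation has its margin before any
  -- padding.
  obtain ⟨b', hb'⟩ := exists_pow_lt_of_lt_one
    (show 0 < θ' * p₀ ^ N / (4 * l) by have := hP.pos; positivity) ht1
  set b := max b' N with hb
  have hc2 : 4 * l * t ^ b ≤ θ' * p₀ ^ N := by
    have h1 := (pow_le_pow_of_le_one ht.le ht1.le (le_max_left b' N)).trans hb'.le
    rw [le_div_iff₀ (by positivity)] at h1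
    linarith
  obtain ⟨j₀, hj₀, hj₀'⟩ := exists_balanced hF hP hk hl hθ one_pos hkl3 N b hc2
  set a := N + j₀ * 1 with ha
  have haN : N ≤ a := by omega
  have hbN : N ≤ b := le_max_right _ _
  have hXI : X ∈ Icc (-(1 / (1 - b₀))) 1 := by
    have h1 := (hF.pair_mem true _ (left_mem_Icc.2 (by linarith [hF.one_lt_end]))).1
    simp only [pairRate, pairShift, cond_true] at h1
    constructor
    · linarith
    · linarith [hF.lt_half]
  have hYI : -(1 / (1 - p₀)) + θ' ≤ Y ∧ Y + θ' ≤ 1 := by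
    have h1 := (hP.pair_mem true _ (left_mem_Icc.2 (by linarith [hP.one_lt_end]))).1
    simp only [pairRate, pairShift, cond_true] at h1
    constructor
    · linarith
    · linarith [hP.lt_half]
  -- closeness of points with long prefixes `1^n` to the right end points
  have near_pair : ∀ {q₀ q₁ r : ℝ}, IsBlend q₀ q₁ r → q₁ ≤ β → ∀ n, N ≤ n →
      ∀ x ∈ Icc (-(1 / (1 - q₀))) 1,
        |pairMap q₀ q₁ (List.replicate n true) x - 1| ≤ 3 * (ξ / 7) := by
    intro q₀ q₁ r hq hqβ n hn x hx
    have h1 : |pairMap q₀ q₁ (List.replicate n true) x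
        - pairMap q₀ q₁ (List.replicate n true) 1| = _ := abs_wordMap_sub hq.pairRate_pos _ x 1
    rw [pairMap_replicate_true] at h1
    rw [h1]
    have h2 := wordRate_le hq.pairRate_pos hq.pairRate_le (List.replicate n true)
    rw [List.length_replicate] at h2
    have h3 := h2.trans (hsmall q₁ (by linarith [hq.half_lt]) hqβ n hn)
    have h4 : |x - 1| ≤ 3 := by
      rw [abs_le]; constructor <;> linarith [hx.1, hx.2, hq.end_lt_two]
    rw [mul_comm]
    exact mul_le_mul h4 h3 (wordRate_pos hq.pairRate_pos _).le (by norm_num)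
  have near_sign : ∀ {q₀ q₁ r : ℝ}, IsBlend q₀ q₁ r → r ≤ β → ∀ n, N ≤ n →
      ∀ x ∈ Icc (-(1 / (1 - r))) (1 / (1 - r)),
        |signMap r (List.replicate n true) x - 1 / (1 - r)| ≤ 4 * (ξ / 7) := by
    intro q₀ q₁ r hq hqβ n hn x hx
    have hr1 : r ≠ 1 := by linarith [hq.t_lt, hq.lt_half]
    have h1 : |signMap r (List.replicate n true) x
        - signMap r (List.replicate n true) (1 / (1 - r))| = _ :=
      abs_wordMap_sub (fun _ => hq.t_pos) _ x _
    rw [signMap_replicate_true hr1, wordRate_const, List.length_replicate] at h1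
    rw [h1]
    have h3 := hsmall r hq.t_pos.le hqβ n hn
    have h4 : |x - 1 / (1 - r)| ≤ 4 := by
      rw [abs_le]; constructor <;> linarith [hx.1, hx.2, hq.sign_end_lt_two]
    rw [mul_comm]
    exact mul_le_mul h4 h3 (pow_nonneg hq.t_pos.le _) (by norm_num)
  set Xs := pairMap b₀ b₁ (List.replicate b true) X with hXs
  set Ys := pairMap p₀ p₁ (List.replicate a true) Y with hYs
  set xs := signMap s (List.replicate a true) xg with hxs
  set ys := signMap t (List.replicate b true) yg with hys
  have hYI' : Y ∈ Icc (-(1 / (1 - p₀))) 1 := ⟨by linarith, by linarith⟩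
  have n1 := near_pair hF hb1β b hbN X hXI
  have n2 := near_pair hP hp1β a haN Y hYI'
  have n3 := near_sign hP hsβ a haN xg hxg
  have n4 := near_sign hF htβ b hbN yg hyg
  -- After `stem i` every longer stem continues with `false`, the head of `g`, while the `i`-th
  -- future word will continue with `true`. This tells the junctions apart at a depth linear in `i`.
  set stem : ℕ → List Bool := fun i => List.replicate b true ++ (List.replicate i g).flatten
    with hstem
  have hstemlen : ∀ i, (stem i).length = b + i * (m + 1) := fun i => by
    simp [hstem, hglen]
  obtain ⟨K, hK⟩ := exists_linked_length_bound hF hP hk hl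
  have small : ∀ k x y : ℝ, 0 < k → k ≤ 1 → |x| ≤ 3 * (ξ / 7) → |y| ≤ 4 * (ξ / 7) →
      |x - k * y| ≤ ξ := by
    intro k x y hk hk1 hx hy
    have h1 : |k * y| ≤ 4 * (ξ / 7) := by
      rw [abs_mul, abs_of_pos hk]
      exact (mul_le_of_le_one_left (abs_nonneg y) hk1).trans hy
    have h2 := abs_sub x (k * y)
    linarith only [h1, h2, hx]
  -- The shifts are solved for so that the two affine relations send `xs` to `Xs` and `ys` to `Ys`
  -- exactly; they are small because all four numbers are close to the right end points.
  refine ⟨Xs - 1 - k * (xs - 1 / (1 - s)), Ys - 1 - l * (ys - 1 / (1 - t)),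
    small k _ _ hk hk1 n1 n3, small l _ _ hl hl1 n2 n4, stem,
    (K + 1) * (b + (m + 1) + 2), ?_, ?_, ?_⟩
  · intro i j hij
    obtain ⟨n, rfl⟩ := Nat.exists_eq_add_of_lt hij
    refine ⟨List.replicate m true ++ (List.replicate n g).flatten, ?_⟩
    simp only [hstem, add_assoc]
    rw [add_comm n 1, List.replicate_add i, List.replicate_add 1 n]
    simp [hg]
  · intro i
    rw [hstemlen]
    linarith only [Nat.zero_le (K * (b + (m + 1) + 2) * (i + 1)), Nat.zero_le (b * i),
      Nat.zero_le i, Nat.zero_le m]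
  intro n i
  have hmono : 4 * l * t ^ (b + i * (m + 1)) ≤ θ' * p₀ ^ a := by
    refine le_trans (mul_le_mul_of_nonneg_left ?_ (by positivity)) hj₀'
    exact pow_le_pow_of_le_one ht.le ht1.le (by omega)
  obtain ⟨j, hj, hj'⟩ := exists_balanced hF hP hk hl hθ (Nat.succ_pos m') hkl2 a
    (b + i * (m + 1)) hmono
  set e := List.replicate a true ++ (List.replicate j g').flatten with he
  have helen : e.length = a + j * (m' + 1) := by simp [he, hglen']
  have hstemX : pairMap b₀ b₁ (stem i) X = Xs := by
    simp only [hstem, pairMap, wordMap_append]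
    rw [wordMap_flatten_replicate hX]
  have heY : pairMap p₀ p₁ e Y = Ys := by
    simp only [he, pairMap, wordMap_append]
    rw [wordMap_flatten_replicate hY]
  have hex : signMap s e xg = xs := by
    simp only [he, signMap, wordMap_append]
    rw [wordMap_flatten_replicate hxgf]
  have hrate : b₀ ^ (b + i * (m + 1)) ≤ wordRate (pairRate b₀ b₁) (stem i) := by
    rw [← hstemlen]; exact le_wordRate hF.pos.le hF.le_pairRate _
  have hrate' : p₀ ^ (a + j * (m' + 1)) ≤ wordRate (pairRate p₀ p₁) e := by
    rw [← helen]; exact le_wordRate hP.pos.le hP.le_pairRate _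
  -- The code of `X` by copies of `g` would continue with `false`, but `X` lies inside the overlap,
  -- with margin `θ`, so `true` is possible as well. In the past relation the extra digit only
  -- shrinks a cylinder.
  have hlink : Linked b₀ b₁ t p₀ p₁ s k l
      (1 + (Xs - 1 - k * (xs - 1 / (1 - s))) - k * (1 / (1 - s)))
      (1 + (Ys - 1 - l * (ys - 1 / (1 - t))) - l * (1 / (1 - t))) e (stem i ++ [true]) := by
    constructor
    · refine fits_of_center hP hk.le hxg (x := Xs) (D := θ * b₀ ^ (b + i * (m + 1)))
        (by rw [hex]; ring) (by rw [helen]; exact hj) ?_ ?_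
      · have h1 := wordMap_sub (r := pairRate b₀ b₁) (v := pairShift b₁) (stem i) X
          (wordMap (pairRate b₀ b₁) (pairShift b₁) [true] (-(1 / (1 - b₀))))
        rw [pairMap, wordMap_append]
        have h2 : θ ≤ X - wordMap (pairRate b₀ b₁) (pairShift b₁) [true] (-(1 / (1 - b₀))) := by
          simp only [wordMap, pairRate, pairShift, cond_true]; linarith
        have h3 := mul_le_mul hrate h2 hθ.le (wordRate_pos hF.pairRate_pos _).le
        rw [pairMap] at hstemX
        linarith
      · have h1 := wordMap_sub (r := pairRate b₀ b₁) (v := pairShift b₁) (stem i) 1 X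
        rw [pairMap, wordMap_append]
        have h4 : wordMap (pairRate b₀ b₁) (pairShift b₁) [true] 1 = 1 :=
          pairMap_replicate_true 1
        have h2 : θ ≤ 1 - X := by linarith [hF.lt_half]
        have h3 := mul_le_mul hrate h2 hθ.le (wordRate_pos hF.pairRate_pos _).le
        rw [pairMap] at hstemX
        rw [h4]
        linarith
    · have hz : signMap t [true] ((yg - 1) / t) = yg := by
        simp only [signMap, wordMap, signShift, cond_true]; field_simp; ring
      have hstemy : signMap t (stem i) yg = ys := by
        simp only [hstem, signMap, wordMap_append]
        rw [wordMap_flatten_replicate hygf]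
      have base : Fits p₀ p₁ t l (1 + (Ys - 1 - l * (ys - 1 / (1 - t))) - l * (1 / (1 - t)))
          e (stem i) := by
        refine fits_of_center hF hl.le hyg (x := Ys) (D := θ' * p₀ ^ (a + j * (m' + 1)))
          (by rw [hstemy]; ring) (by rw [hstemlen]; exact hj') ?_ ?_
        · have h1 := wordMap_sub (r := pairRate p₀ p₁) (v := pairShift p₁) e Y (-(1 / (1 - p₀)))
          have h3 := mul_le_mul hrate' (show θ' ≤ Y - -(1 / (1 - p₀)) by linarith) hθ'.le
            (wordRate_pos hP.pairRate_pos _).le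
          rw [pairMap] at heY ⊢
          linarith
        · have h1 := wordMap_sub (r := pairRate p₀ p₁) (v := pairShift p₁) e 1 Y
          have h3 := mul_le_mul hrate' (show θ' ≤ 1 - Y by linarith) hθ'.le
            (wordRate_pos hP.pairRate_pos _).le
          rw [pairMap] at heY ⊢
          linarith
      exact base.append_right hF hl.le true
  -- It is not known which of the two words grows. Since their lengths are comparable with constant
  -- `K`, adding `(K + 1) * (n + 1)` digits in total makes both of length at least `n`.
  obtain ⟨e', f', hlink', hee', hff', hlen'⟩ :=
    hlink.exists_extend_add hF hP hk hl hkl1 ((K + 1) * (n + 1))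
  have hb0 := (hK _ _ _ _ hlink).2
  have hb1' := (hK _ _ _ _ hlink').1
  have hb2' := (hK _ _ _ _ hlink').2
  have hsl : (stem i ++ [true]).length = b + i * (m + 1) + 1 := by
    rw [List.length_append, hstemlen]; rfl
  rw [hsl] at hb0 hlen'
  refine ⟨e', f', hlink', ?_, ?_, ?_, hff', ?_, ?_⟩
  · by_contra! hcon
    have h1 : K * (e'.length + 1) ≤ K * n := Nat.mul_le_mul_left _ hcon
    have h2 : (K + 1) * (n + 1) = K * n + K + n + 1 := by ring
    omega
  · by_contra! hcon
    have h1 : K * (f'.length + 1) ≤ K * n := Nat.mul_le_mul_left _ hcon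
    have h2 : (K + 1) * (n + 1) = K * n + K + n + 1 := by ring
    omega
  · rw [hlen']
    calc e.length + (b + i * (m + 1) + 1) + (K + 1) * (n + 1)
        ≤ (K + 1) * (b + i * (m + 1) + 2) + (K + 1) * (n + 1) := by nlinarith
      _ = (K + 1) * (b + i * (m + 1) + 2 + (n + 1)) := by ring
      _ ≤ (K + 1) * ((b + (m + 1) + 2) * (i + n + 1)) := by
          apply Nat.mul_le_mul_left
          linarith only [Nat.zero_le (b * i), Nat.zero_le (b * n), Nat.zero_le (m * n),
            Nat.zero_le i, Nat.zero_le n, Nat.zero_le m]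
      _ = _ := by ring
  · intro x hx
    obtain ⟨e'', rfl⟩ := hee'
    simp only [he, signMap, wordMap_append]
    have h1 := wordMap_mem_Icc (r := fun _ => s) (v := signShift) hP.sign_mem e'' hx
    have h2 := wordMap_mem_Icc (r := fun _ => s) (v := signShift) hP.sign_mem
      (List.replicate j g').flatten h1
    have := near_sign hP hsβ a haN _ h2
    linarith
  · intro x hx
    obtain ⟨e'', rfl⟩ := hee'
    simp only [he, pairMap, wordMap_append]
    have h1 := wordMap_mem_Icc (r := pairRate p₀ p₁) (v := pairShift p₁) hP.pair_mem e'' hx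
    have h2 := wordMap_mem_Icc (r := pairRate p₀ p₁) (v := pairShift p₁) hP.pair_mem
      (List.replicate j g').flatten h1
    have := near_pair hP hp1β a haN _ h2
    linarith

end Linked

/-! ### Small perturbations of diffeomorphisms -/

section Bumps

variable {E : Type*} [NormedAddCommGroup E] [NormedSpace ℝ E]

lemma exists_iteratedFDeriv_bound {F : Type*} [NormedAddCommGroup F] [NormedSpace ℝ F] {r : ℕ}
    {φ : E → F} (hφ : ContDiff ℝ r φ) (hc : HasCompactSupport φ) :
    ∃ C : ℝ, 0 < C ∧ ∀ i ≤ r, ∀ x, ‖iteratedFDeriv ℝ i φ x‖ ≤ C := by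
  have h1 : ∀ i, ∃ C : ℝ, i ≤ r → ∀ x, ‖iteratedFDeriv ℝ i φ x‖ ≤ C := by
    intro i
    by_cases hi : i ≤ r
    · obtain ⟨C, hC⟩ := (hφ.continuous_iteratedFDeriv (m := i)
        (by exact_mod_cast hi)).bounded_above_of_compact_support (hc.iteratedFDeriv i)
      exact ⟨C, fun _ => hC⟩
    · exact ⟨0, fun h => absurd h hi⟩
  choose C hC using h1
  refine ⟨1 + ∑ i ∈ Finset.range (r + 1), |C i|, by positivity, fun i hi x => ?_⟩
  have h2 : |C i| ≤ ∑ i ∈ Finset.range (r + 1), |C i| :=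
    Finset.single_le_sum (f := fun i => |C i|) (fun _ _ => abs_nonneg _)
      (Finset.mem_range.2 (by omega))
  linarith [hC i hi x, le_abs_self (C i)]

lemma norm_iteratedFDeriv_smul_const_le {r : ℕ} {φ : E → ℝ} (hφ : ContDiff ℝ r φ) (t : E) {i : ℕ}
    (hi : i ≤ r) (x : E) :
    ‖iteratedFDeriv ℝ i (fun y => φ y • t) x‖ ≤ ‖t‖ * ‖iteratedFDeriv ℝ i φ x‖ := by
  have h := (ContinuousLinearMap.toSpanSingleton ℝ t).norm_iteratedFDeriv_comp_left
    (hφ.contDiffAt (x := x)) (n := i) (by exact_mod_cast hi)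
  rwa [ContinuousLinearMap.norm_toSpanSingleton] at h

/-- Each derivative costs a factor `d⁻¹`, and as `d ≤ 1` the order `r` is the worst. Amplitudes of
order `d ^ r` pay for this. -/
lemma norm_iteratedFDeriv_rescale_le {r : ℕ} {φ : E → ℝ} (hφ : ContDiff ℝ r φ) {C : ℝ}
    (hC : ∀ i ≤ r, ∀ x, ‖iteratedFDeriv ℝ i φ x‖ ≤ C) (p : E) {d : ℝ} (hd : 0 < d) (hd1 : d ≤ 1)
    {i : ℕ} (hi : i ≤ r) (x : E) :
    ‖iteratedFDeriv ℝ i (fun y => φ (d⁻¹ • (y - p))) x‖ ≤ C * (d⁻¹) ^ r := by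
  have h1 : iteratedFDeriv ℝ i (fun y => φ (d⁻¹ • (y - p))) x
      = iteratedFDeriv ℝ i (φ ∘ (d⁻¹ • ContinuousLinearMap.id ℝ E)) (x - p) := by
    rw [← iteratedFDeriv_comp_sub]; rfl
  rw [h1, ContinuousLinearMap.iteratedFDeriv_comp_right _ hφ _ (by exact_mod_cast hi)]
  refine (ContinuousMultilinearMap.norm_compContinuousLinearMap_le _ _).trans ?_
  have h2 : ‖d⁻¹ • ContinuousLinearMap.id ℝ E‖ ≤ d⁻¹ := by
    rw [norm_smul, Real.norm_of_nonneg (inv_nonneg.2 hd.le)]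
    exact mul_le_of_le_one_right (inv_nonneg.2 hd.le) ContinuousLinearMap.norm_id_le
  have h3 : 1 ≤ d⁻¹ := (one_le_inv₀ hd).2 hd1
  refine mul_le_mul (hC i hi _) ?_ (by positivity) ((norm_nonneg _).trans (hC i hi 0))
  rw [Finset.prod_const, Finset.card_univ, Fintype.card_fin]
  exact (pow_le_pow_left₀ (norm_nonneg _) h2 _).trans (pow_le_pow_right₀ h3 hi)

/-- A sum of rescaled bumps with prescribed values at separated points. -/
lemma exists_bump_sum [FiniteDimensional ℝ E] (r : ℕ) :
    ∃ C : ℝ, 0 < C ∧ ∀ ξ : ℝ, 0 < ξ → ∀ (p : ℕ → E) (d : ℕ → ℝ) (t : ℕ → E),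
      (∀ k, 0 < d k) → (∀ k, d k ≤ 1) → (∀ k, ‖t k‖ ≤ ξ * (1 / 2) ^ k * d k ^ r) →
      (∀ j k, j ≠ k → 2 * d j + d k ≤ dist (p j) (p k)) →
      ∃ h : E → E, ContDiff ℝ r h ∧ (∀ i ≤ r, ∀ x, ‖iteratedFDeriv ℝ i h x‖ ≤ C * ξ) ∧
        (∀ k x, dist x (p k) ≤ d k → h x = t k) ∧
        ∀ x, h x ≠ 0 → ∃ k, dist x (p k) < 2 * d k := by
  obtain ⟨φ, hin, hout⟩ : ∃ φ : ContDiffBump (0 : E), φ.rIn = 1 ∧ φ.rOut = 2 :=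
    ⟨⟨1, 2, one_pos, one_lt_two⟩, rfl, rfl⟩
  have hφ : ContDiff ℝ r φ := φ.contDiff
  obtain ⟨C, hC, hCb⟩ := exists_iteratedFDeriv_bound hφ φ.hasCompactSupport
  refine ⟨2 * C, by positivity, fun ξ hξ p d t hd hd1 ht hsep => ?_⟩
  set f : ℕ → E → E := fun k x => φ ((d k)⁻¹ • (x - p k)) • t k with hf
  have hzero : ∀ k x, 2 * d k ≤ dist x (p k) → f k x = 0 := by
    intro k x hx
    have : φ ((d k)⁻¹ • (x - p k)) = 0 := by
      apply φ.zero_of_le_dist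
      rw [hout, dist_zero_right, norm_smul, Real.norm_of_nonneg (inv_nonneg.2 (hd k).le),
        ← dist_eq_norm, inv_mul_eq_div, le_div_iff₀ (hd k)]
      exact hx
    simp [hf, this]
  have hone : ∀ k x, dist x (p k) ≤ d k → f k x = t k := by
    intro k x hx
    have : φ ((d k)⁻¹ • (x - p k)) = 1 := by
      apply φ.one_of_mem_closedBall
      rw [mem_closedBall_zero_iff, hin, norm_smul,
        Real.norm_of_nonneg (inv_nonneg.2 (hd k).le), ← dist_eq_norm, inv_mul_eq_div,
        div_le_iff₀ (hd k), one_mul]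
      exact hx
    simp [hf, this]
  have hcd : ∀ k, ContDiff ℝ ((r : ℕ∞) : WithTop ℕ∞) (f k) := by
    intro k
    exact (hφ.comp (contDiff_const.smul (contDiff_id.sub contDiff_const))).smul_const (t k)
  have hbound : ∀ (i : ℕ) (k : ℕ) (x : E), (i : ℕ∞) ≤ (r : ℕ∞) →
      ‖iteratedFDeriv ℝ i (f k) x‖ ≤ C * ξ * (1 / 2) ^ k := by
    intro i k x hi
    have hi' : i ≤ r := by exact_mod_cast hi
    have h1 := norm_iteratedFDeriv_smul_const_le (φ := fun y => φ ((d k)⁻¹ • (y - p k)))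
      (hφ.comp (contDiff_const.smul (contDiff_id.sub contDiff_const))) (t k) hi' x
    have h2 := norm_iteratedFDeriv_rescale_le hφ hCb (p k) (hd k) (hd1 k) hi' x
    refine h1.trans ((mul_le_mul (ht k) h2 (norm_nonneg _) (by have := hd k; positivity)).trans ?_)
    -- The amplitude cancels the cost of rescaling and leaves the summable factor `(1 / 2) ^ k`,
    -- uniformly in all orders up to `r`.
    have h3 : d k ^ r * (d k)⁻¹ ^ r = 1 := by
      rw [← mul_pow, mul_inv_cancel₀ (hd k).ne', one_pow]
    apply le_of_eq
    calc ξ * (1 / 2) ^ k * d k ^ r * (C * (d k)⁻¹ ^ r)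
        = C * ξ * (1 / 2) ^ k * (d k ^ r * (d k)⁻¹ ^ r) := by ring
      _ = _ := by rw [h3, mul_one]
  have hsum : Summable fun k : ℕ => C * ξ * (1 / 2 : ℝ) ^ k := summable_geometric_two.mul_left _
  refine ⟨fun x => ∑' k, f k x, ?_, ?_, ?_, ?_⟩
  · exact contDiff_tsum (v := fun _ k => C * ξ * (1 / 2) ^ k) hcd (fun _ _ => hsum) hbound
  · intro i hi x
    have hi' : (i : ℕ∞) ≤ (r : ℕ∞) := by exact_mod_cast hi
    rw [iteratedFDeriv_tsum_apply (v := fun _ k => C * ξ * (1 / 2) ^ k) hcd (fun _ _ => hsum)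
      hbound hi']
    refine (tsum_of_norm_bounded hsum.hasSum fun k => hbound i k x hi').trans (le_of_eq ?_)
    rw [tsum_mul_left, tsum_geometric_two]; ring
  · intro k x hx
    beta_reduce
    rw [tsum_eq_single k, hone k x hx]
    intro j hj
    apply hzero
    have h1 := hsep j k hj
    have h2 := dist_triangle (p j) x (p k)
    rw [dist_comm (p j) x] at h2
    linarith
  · intro x hx
    by_contra! hcon
    exact hx (by simp [hzero _ x (hcon _)])

end Bumps

/-- A `C^1`-small compactly supported perturbation of a diffeomorphism is a diffeomorphism. -/
lemma CrDiffeo.exists_add {r : ℕ} (hr : 1 ≤ r) (F : CrDiffeo r) {K : Set E4} (hK : IsCompact K) :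
    ∃ ε : ℝ, 0 < ε ∧ ∀ h : E4 → E4, ContDiff ℝ r h → (∀ x ∉ K, h x = 0) →
      (∀ x, ‖fderiv ℝ h x‖ ≤ ε) → ∃ G : CrDiffeo r, ∀ x, G x = F x + h x := by
  have hr0 : (r : WithTop ℕ∞) ≠ 0 := by
    have : r ≠ 0 := by omega
    exact_mod_cast this
  have hF : ContDiff ℝ r F := contMDiff_iff_contDiff.1 F.contMDiff
  have hFs : ContDiff ℝ r F.symm := contMDiff_iff_contDiff.1 F.symm.contMDiff
  obtain ⟨B, hB⟩ := (hK.image F.continuous).exists_bound_of_continuousOn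
    (f := fderiv ℝ F.symm) (hFs.continuous_fderiv hr0).continuousOn
  refine ⟨1 / (2 * (|B| + 1)), by positivity, fun h hh hhK hsmall => ?_⟩
  -- Write `F + h` as `(id + g) ∘ F`. The derivative of `F.symm` is needed only on the compact set
  -- `F '' K`, so a bound on that of `h` makes `g` Lipschitz with constant `1 / 2`; then `id + g` is
  -- a homeomorphism with invertible derivatives.
  set g : E4 → E4 := h ∘ F.symm with hg
  have hgc : ContDiff ℝ r g := hh.comp hFs
  have hdiff : Differentiable ℝ g := hgc.differentiable hr0
  have hgd : ∀ y, ‖fderiv ℝ g y‖ ≤ 1 / 2 := by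
    intro y
    have h1 : fderiv ℝ g y = (fderiv ℝ h (F.symm y)).comp (fderiv ℝ F.symm y) :=
      fderiv_comp y (hh.differentiable hr0 _) (hFs.differentiable hr0 _)
    by_cases hy : F.symm y ∈ K
    · have h2 := hB y ⟨F.symm y, hy, by simp⟩
      rw [h1]
      refine (ContinuousLinearMap.opNorm_comp_le _ _).trans ?_
      refine (mul_le_mul (hsmall _) (h2.trans (le_abs_self B)) (norm_nonneg _)
        (by positivity)).trans ?_
      rw [div_mul_eq_mul_div, div_le_div_iff₀ (by positivity) (by norm_num)]
      linarith [abs_nonneg B]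
    · have h2 : h =ᶠ[𝓝 (F.symm y)] fun _ => 0 := by
        filter_upwards [hK.isClosed.isOpen_compl.mem_nhds hy] with x hx using hhK x hx
      rw [h1, h2.fderiv_eq]
      simp
  have hlip : LipschitzWith (1 / 2) g := by
    refine lipschitzWith_of_nnnorm_fderiv_le hdiff fun x => ?_
    rw [← NNReal.coe_le_coe]
    simpa using hgd x
  have happ : ApproximatesLinearOn (fun x => x + g x)
      ((ContinuousLinearEquiv.refl ℝ E4 : E4 ≃L[ℝ] E4) : E4 →L[ℝ] E4) univ (1 / 2) := by
    intro x _ y _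
    have := hlip.dist_le_mul x y
    rw [dist_eq_norm, dist_eq_norm] at this
    refine le_trans (le_of_eq (congrArg _ ?_)) this
    change x + g x - (y + g y) - (x - y) = _
    abel
  have hc : Subsingleton E4 ∨ (1 / 2 : NNReal) <
      ‖(((ContinuousLinearEquiv.refl ℝ E4 : E4 ≃L[ℝ] E4).symm : E4 ≃L[ℝ] E4) : E4 →L[ℝ] E4)‖₊⁻¹ := by
    right
    have h1 : ‖(((ContinuousLinearEquiv.refl ℝ E4 : E4 ≃L[ℝ] E4).symm : E4 ≃L[ℝ] E4) :
        E4 →L[ℝ] E4)‖₊ = 1 := by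
      have : ‖ContinuousLinearMap.id ℝ E4‖ = 1 := ContinuousLinearMap.norm_id
      exact NNReal.eq this
    rw [h1, inv_one]
    exact NNReal.half_lt_self one_ne_zero
  set Φ := happ.toHomeomorph _ hc with hΦ
  have hΦa : ∀ x, Φ x = x + g x := fun x => rfl
  have hΦc : ContDiff ℝ r Φ := contDiff_id.add hgc
  have hunit : ∀ a, ‖-fderiv ℝ g a‖ < 1 := fun a => by
    rw [norm_neg]; exact (hgd a).trans_lt (by norm_num)
  have hder : ∀ a, HasFDerivAt Φ
      ((ContinuousLinearEquiv.ofUnit (Units.oneSub _ (hunit a)) : E4 ≃L[ℝ] E4) : E4 →L[ℝ] E4) a := by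
    intro a
    have h1 := (hasFDerivAt_id a).add (hdiff a).hasFDerivAt
    have h2 : ((ContinuousLinearEquiv.ofUnit (Units.oneSub _ (hunit a)) : E4 ≃L[ℝ] E4) :
        E4 →L[ℝ] E4) = ContinuousLinearMap.id ℝ E4 + fderiv ℝ g a := by
      ext v
      change ((Units.oneSub _ (hunit a) : (E4 →L[ℝ] E4)ˣ) : E4 →L[ℝ] E4) v _ = _
      rw [Units.val_oneSub]
      simp
    rw [h2]
    exact h1
  have hΦs : ContDiff ℝ r Φ.symm := Φ.contDiff_symm hder hΦc
  refine ⟨⟨F.toEquiv.trans Φ.toEquiv, ?_, ?_⟩, fun x => ?_⟩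
  · exact contMDiff_iff_contDiff.2 (hΦc.comp hF)
  · exact contMDiff_iff_contDiff.2 (hFs.comp hΦs)
  · change Φ (F x) = _
    rw [hΦa, hg]
    simp

/-- Diffeomorphisms obtained by adding perturbations tending to zero converge. -/
lemma convergesCr_of_add {r : ℕ} {F : CrDiffeo r} {K : Set E4} (hK : IsCompact K)
    (G : ℕ → CrDiffeo r) (h : ℕ → E4 → E4) (hh : ∀ n, ContDiff ℝ r (h n))
    (hG : ∀ n x, G n x = F x + h n x) (hhK : ∀ n, ∀ x ∉ K, h n x = 0)
    (hsmall : ∀ n : ℕ, ∀ i ≤ r, ∀ x, ‖iteratedFDeriv ℝ i (h n) x‖ ≤ 1 / ((n : ℝ) + 1)) :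
    ConvergesCr r (fun n => G n) F := by
  have hF : ContDiff ℝ r F := contMDiff_iff_contDiff.1 F.contMDiff
  refine ⟨⟨K, hK, .of_forall fun n x hx => ?_⟩, fun i hi => ?_⟩
  · exact (hG n x).trans (by rw [hhK n x hx, add_zero])
  · rw [Metric.tendstoUniformly_iff]
    intro ε hε
    filter_upwards [(tendsto_one_div_add_atTop_nhds_zero_nat (𝕜 := ℝ)).eventually_lt_const hε]
      with n hn x
    have h1 : (G n : E4 → E4) = (F : E4 → E4) + h n := funext (hG n)
    have hi' : (i : WithTop ℕ∞) ≤ r := by exact_mod_cast hi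
    rw [h1, iteratedFDeriv_add_apply (hF.of_le hi').contDiffAt ((hh n).of_le hi').contDiffAt,
      dist_comm, dist_eq_norm, add_sub_cancel_left]
    exact (hsmall n i hi x).trans_lt hn

/-! ### Wandering domains from itineraries with growing gaps -/

lemma mem_omegaSet_of_mapClusterPt {M : Type*} [TopologicalSpace M] {f : M → M} {x z : M}
    {T : ℕ → ℕ} (hT : Tendsto T atTop atTop) (h : MapClusterPt z atTop fun k => f^[T k] x) :
    z ∈ omegaSet f x := by
  rw [omegaSet, mem_omegaLimit_singleton_iff_mapClusterPt]
  exact MapClusterPt.of_comp hT h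

lemma exists_return_interval {T : ℕ → ℕ} (h0 : T 0 = 0) (hT : StrictMono T) (i : ℕ) :
    ∃ k, T k ≤ i ∧ i < T (k + 1) := by
  induction i with
  | zero => exact ⟨0, h0.le, by rw [← h0]; exact hT (by omega)⟩
  | succ i ih =>
    obtain ⟨k, hk1, hk2⟩ := ih
    rcases (Nat.succ_le_of_lt hk2).lt_or_eq with h | h
    · exact ⟨k, by omega, h⟩
    · exact ⟨k + 1, h.ge, by rw [← Nat.succ_eq_add_one i, h]; exact hT (by omega)⟩

/-- A connected open set whose points visit a compact region simultaneously, after gaps tending to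
infinity, and whose images shrink, is a contracting wandering domain. -/
theorem isContractingWanderingDomain_of_gaps {M : Type*} [MetricSpace M] {f : M → M}
    (hf : Continuous f) (hinj : Function.Injective f) {D R B : Set M} (hD : IsOpen D)
    (hDc : IsConnected D) (hR : IsCompact R) (hB : IsClosed B) (hRB : Disjoint R B)
    {T : ℕ → ℕ} (h0 : T 0 = 0) (hT : StrictMono T)
    (hgap : Tendsto (fun k => T (k + 1) - T k) atTop atTop)
    (hmemR : ∀ k, ∀ x ∈ D, f^[T k] x ∈ R)
    (hmemB : ∀ k i, T k < i → i < T (k + 1) → ∀ x ∈ D, f^[i] x ∈ B)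
    {η : ℕ → ℝ} (hη : Tendsto η atTop (𝓝 0))
    (hdist : ∀ k i, T k ≤ i → i < T (k + 1) → ∀ x ∈ D, ∀ y ∈ D,
      dist (f^[i] x) (f^[i] y) ≤ η k) :
    IsContractingWanderingDomain f D := by
  -- Once the gap exceeds `p`, the time `T k + p` lies strictly between two visits to `R`.
  have hshift : ∀ p : ℕ, 0 < p → ∀ᶠ k in atTop, ∀ y ∈ D, f^[T k + p] y ∈ B := by
    intro p hp
    filter_upwards [hgap.eventually_gt_atTop p] with k hk y hy
    exact hmemB k _ (by omega) (by omega) y hy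
  -- If two images met, injectivity would give `x = f^[p] y` with `x`, `y` in `D` and `p > 0`. For
  -- large `k` the same point would then be in `R` as `f^[T k] x` and in `B` as `f^[T k + p] y`.
  have hdisj : ∀ i j : ℕ, i < j → Disjoint (f^[i] '' D) (f^[j] '' D) := by
    intro i j hij
    rw [Set.disjoint_left]
    rintro z ⟨x, hx, rfl⟩ ⟨y, hy, hyx⟩
    obtain ⟨p, rfl⟩ := Nat.exists_eq_add_of_lt hij
    have h1 : f^[p + 1] y = x := by
      apply (hinj.iterate i)
      rw [← Function.iterate_add_apply, ← hyx, add_assoc]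
    obtain ⟨k, hk⟩ := (hshift (p + 1) (by omega)).exists
    have h2 := hk y hy
    rw [Function.iterate_add_apply, h1] at h2
    exact Set.disjoint_left.1 hRB (hmemR k x hx) h2
  refine ⟨⟨hD, hDc, ?_, ?_⟩, ?_⟩
  · intro i j hij
    rcases lt_or_gt_of_ne hij with h | h
    · exact hdisj i j h
    · exact (hdisj j i h).symm
  · rintro ⟨p, hp, heq⟩
    obtain ⟨x, hx⟩ := hDc.nonempty
    -- A limit point of the visits to `R` cannot be periodic: its image after `n > 0` steps is a
    -- limit of points of the closed set `B`.
    obtain ⟨z, hzR, hz⟩ := hR.exists_mapClusterPt (f := atTop) (u := fun k => f^[T k] x)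
      (tendsto_principal.2 (.of_forall fun k => hmemR k x hx))
    have h1 : z ∈ ⋃ x ∈ D, omegaSet f x :=
      mem_iUnion₂.2 ⟨x, hx, mem_omegaSet_of_mapClusterPt hT.tendsto_atTop hz⟩
    rw [heq] at h1
    obtain ⟨i, rfl⟩ := h1
    obtain ⟨n, hn, hper⟩ := hp
    have h2 : f^[n] (f^[i] p) = f^[i] p := hper.apply_iterate i
    have h3 := hz.continuousAt_comp (hf.iterate n).continuousAt
    have h4 : f^[n] (f^[i] p) ∈ B := by
      have h5 : ∀ᶠ k in atTop, (f^[n] ∘ fun k => f^[T k] x) k ∈ B := by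
        filter_upwards [hshift n hn] with k hk
        have := hk x hx
        rw [add_comm, Function.iterate_add_apply] at this
        exact this
      exact hB.mem_of_mapClusterPt h3 h5
    rw [h2] at h4
    exact Set.disjoint_left.1 hRB hzR h4
  · rw [ENNReal.tendsto_nhds_zero]
    intro ε hε
    have h1 : ∀ᶠ k in atTop, ENNReal.ofReal (η k) ≤ ε := by
      have h2 : Tendsto (fun k => ENNReal.ofReal (η k)) atTop (𝓝 0) := by
        simpa using ENNReal.tendsto_ofReal hη
      filter_upwards [h2.eventually_lt_const hε] with k hk using hk.le
    obtain ⟨k₀, hk₀⟩ := eventually_atTop.1 h1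
    filter_upwards [eventually_ge_atTop (T k₀)] with i hi
    obtain ⟨k, hk1, hk2⟩ := exists_return_interval h0 hT i
    have hkk : k₀ ≤ k := by
      by_contra! hlt
      have := hT.monotone (Nat.succ_le_of_lt hlt)
      simp only [Nat.succ_eq_add_one] at this
      omega
    refine le_trans (Metric.ediam_le ?_) (hk₀ k hkk)
    rintro _ ⟨x, hx, rfl⟩ _ ⟨y, hy, rfl⟩
    rw [edist_dist]
    exact ENNReal.ofReal_le_ofReal (hdist k i hk1 hk2 x hx y hy)

/-! ### The affine horseshoe dynamics -/

lemma E4.norm_le (x : E4) : ‖x‖ ≤ |x 0| + |x 1| + |x 2| + |x 3| := by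
  rw [EuclideanSpace.norm_eq, Real.sqrt_le_left (by positivity), Fin.sum_univ_four]
  simp only [Real.norm_eq_abs]
  have h0 := abs_nonneg (x 0); have h1 := abs_nonneg (x 1)
  have h2 := abs_nonneg (x 2); have h3 := abs_nonneg (x 3)
  nlinarith [mul_nonneg h0 h1, mul_nonneg h0 h2, mul_nonneg h0 h3, mul_nonneg h1 h2,
    mul_nonneg h1 h3, mul_nonneg h2 h3]

lemma E4.abs_apply_le (x : E4) (i : Fin 4) : |x i| ≤ ‖x‖ := PiLp.norm_apply_le x i

lemma E4.dist_le (x y : E4) :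
    dist x y ≤ |x 0 - y 0| + |x 1 - y 1| + |x 2 - y 2| + |x 3 - y 3| := by
  rw [dist_eq_norm]; exact E4.norm_le (x - y)

lemma E4.abs_sub_apply_le (x y : E4) (i : Fin 4) : |x i - y i| ≤ dist x y := by
  rw [dist_eq_norm]; exact E4.abs_apply_le (x - y) i

lemma E4.isCompact_box (a b : Fin 4 → ℝ) : IsCompact {x : E4 | ∀ i, x i ∈ Icc (a i) (b i)} := by
  have h := (EuclideanSpace.equiv (Fin 4) ℝ).toHomeomorph.isCompact_preimage.2
    (isCompact_univ_pi fun i => isCompact_Icc (a := a i) (b := b i))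
  convert h using 1
  ext x
  rw [mem_preimage, mem_univ_pi]
  rfl

namespace Rates

variable {c : Rates}

lemma Admissible.cu0_pos (hc : c.Admissible) : 0 < c.cu0 := by linarith [hc.two_lt_cu0]
lemma Admissible.cu1_pos (hc : c.Admissible) : 0 < c.cu1 := by linarith [hc.one_lt_cu1]
lemma Admissible.u_gt (hc : c.Admissible) : 2 < c.u := hc.two_lt_cu0.trans hc.cu0_lt_u
lemma Admissible.u_pos (hc : c.Admissible) : 0 < c.u := by linarith [hc.u_gt]

lemma Admissible.future (hc : c.Admissible) : IsBlend c.cu0⁻¹ c.cu1⁻¹ c.u⁻¹ where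
  t_pos := inv_pos.2 hc.u_pos
  t_lt := (inv_lt_inv₀ hc.u_pos hc.cu0_pos).2 hc.cu0_lt_u
  lt_half := by rw [one_div]; exact (inv_lt_inv₀ hc.cu0_pos two_pos).2 hc.two_lt_cu0
  half_lt := by rw [one_div]; exact (inv_lt_inv₀ two_pos hc.cu1_pos).2 hc.cu1_lt_two
  lt_one := inv_lt_one_of_one_lt₀ hc.one_lt_cu1
  overlap := hc.cover_u

lemma Admissible.past (hc : c.Admissible) : IsBlend c.cs0 c.cs1 c.s where
  t_pos := hc.s_pos
  t_lt := hc.s_lt_cs0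
  lt_half := hc.cs0_lt_half
  half_lt := hc.half_lt_cs1
  lt_one := hc.cs1_lt_one
  overlap := hc.cover_s

/-- The two boxes, indexed by the digits. -/
def box (c : Rates) (d : Bool) : Set E4 := cond d c.box1 c.box0

/-- The map is given by the affine formulas on the two boxes. -/
structure IsAffineOn (c : Rates) (f : E4 → E4) : Prop where
  on_box0 : ∀ x ∈ c.box0,
    f x = !₂[c.cu0 * (x 0 + 1), c.u * (x 1 + 1), c.s * x 2 - 1, c.cs0 * x 3 - 1]
  on_box1 : ∀ x ∈ c.box1,
    f x = !₂[c.cu1 * (x 0 - 1) + 1, c.u * (x 1 - 1), c.s * x 2 + 1, c.cs1 * (x 3 - 1) + 1]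

/-- The point at the beginning of a word which ends at `(z₀, z₁)` in the unstable coordinates. -/
def start (c : Rates) (w : List Bool) (z₀ z₁ x₂ x₃ : ℝ) : E4 :=
  !₂[pairMap c.cu0⁻¹ c.cu1⁻¹ w z₀, signMap c.u⁻¹ w z₁, x₂, x₃]

/-- In the unstable coordinates the box of `d` is exactly the image of `[-2, 2]²` under the inverse
branches of `d`. -/
lemma Admissible.start_cons_mem_box (hc : c.Admissible) (d : Bool) (w : List Bool)
    {z₀ z₁ x₂ x₃ : ℝ} (h₀ : z₀ ∈ Icc (-2 : ℝ) 2) (h₁ : z₁ ∈ Icc (-2 : ℝ) 2)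
    (h₂ : x₂ ∈ Icc (-2 : ℝ) 2) (h₃ : x₃ ∈ Icc (-2 : ℝ) 2) :
    c.start (d :: w) z₀ z₁ x₂ x₃ ∈ c.box d := by
  obtain ⟨ha, hb⟩ := wordMap_mem_Icc hc.future.pair_mem_two w h₀
  obtain ⟨ha', hb'⟩ := wordMap_mem_Icc hc.future.sign_mem_two w h₁
  have e0 : 0 < c.cu0⁻¹ := inv_pos.2 hc.cu0_pos
  have e1 : 0 < c.cu1⁻¹ := inv_pos.2 hc.cu1_pos
  have e2 : 0 < c.u⁻¹ := inv_pos.2 hc.u_pos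
  cases d
  · refine ⟨?_, ?_, h₂, h₃⟩
    · change c.cu0⁻¹ * _ + -1 ∈ _
      constructor <;> nlinarith
    · change c.u⁻¹ * _ + -1 ∈ _
      constructor <;> nlinarith
  · refine ⟨?_, ?_, h₂, h₃⟩
    · change c.cu1⁻¹ * _ + (1 - c.cu1⁻¹) ∈ _
      constructor <;> nlinarith
    · change c.u⁻¹ * _ + 1 ∈ _
      constructor <;> nlinarith

/-- The shift in coordinates: the head digit is cancelled in the unstable coordinates and its
contraction is applied to the stable ones. -/
lemma IsAffineOn.apply_start_cons {f : E4 → E4} (hf : c.IsAffineOn f) (hc : c.Admissible)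
    (d : Bool) (w : List Bool) {z₀ z₁ x₂ x₃ : ℝ} (h₀ : z₀ ∈ Icc (-2 : ℝ) 2)
    (h₁ : z₁ ∈ Icc (-2 : ℝ) 2) (h₂ : x₂ ∈ Icc (-2 : ℝ) 2) (h₃ : x₃ ∈ Icc (-2 : ℝ) 2) :
    f (c.start (d :: w) z₀ z₁ x₂ x₃) = c.start w z₀ z₁ (c.s * x₂ + signShift d)
      (pairRate c.cs0 c.cs1 d * x₃ + pairShift c.cs1 d) := by
  have hm := hc.start_cons_mem_box d w h₀ h₁ h₂ h₃
  have e0 := hc.cu0_pos.ne'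
  have e1 := hc.cu1_pos.ne'
  have e2 := hc.u_pos.ne'
  cases d
  · rw [hf.on_box0 _ hm]
    ext i
    fin_cases i <;> simp [start, wordMap, pairRate, pairShift, signShift] <;> field_simp <;> ring
  · rw [hf.on_box1 _ hm]
    ext i
    fin_cases i <;> simp [start, wordMap, pairRate, pairShift, signShift] <;> field_simp <;> ring

/-- The word is reversed in the stable coordinates because the digit read last is the contraction
applied last. -/
lemma IsAffineOn.iterate_start {f : E4 → E4} (hf : c.IsAffineOn f) (hc : c.Admissible)
    (w w' : List Bool) {z₀ z₁ x₂ x₃ : ℝ} (h₀ : z₀ ∈ Icc (-2 : ℝ) 2) (h₁ : z₁ ∈ Icc (-2 : ℝ) 2)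
    (h₂ : x₂ ∈ Icc (-2 : ℝ) 2) (h₃ : x₃ ∈ Icc (-2 : ℝ) 2) :
    f^[w.length] (c.start (w ++ w') z₀ z₁ x₂ x₃) =
      c.start w' z₀ z₁ (signMap c.s w.reverse x₂) (pairMap c.cs0 c.cs1 w.reverse x₃) := by
  induction w generalizing x₂ x₃ with
  | nil => rfl
  | cons d w ih =>
    rw [List.length_cons, Function.iterate_succ_apply, List.cons_append,
      hf.apply_start_cons hc d _ h₀ h₁ h₂ h₃,
      ih (hc.past.sign_mem_two d _ h₂) (hc.past.pair_mem_two d _ h₃)]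
    simp only [List.reverse_cons, signMap, pairMap, wordMap_append]
    rfl

lemma isCompact_box0 (c : Rates) : IsCompact c.box0 := by
  convert E4.isCompact_box ![-1 - 2 * c.cu0⁻¹, -1 - 2 * c.u⁻¹, -2, -2]
    ![-1 + 2 * c.cu0⁻¹, -1 + 2 * c.u⁻¹, 2, 2] using 1
  ext x
  simp [box0, Fin.forall_fin_succ]

lemma isCompact_box1 (c : Rates) : IsCompact c.box1 := by
  convert E4.isCompact_box ![1 - 3 * c.cu1⁻¹, 1 - 2 * c.u⁻¹, -2, -2]
    ![1 + c.cu1⁻¹, 1 + 2 * c.u⁻¹, 2, 2] using 1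
  ext x
  simp [box1, Fin.forall_fin_succ]

lemma box_subset (c : Rates) (d : Bool) : c.box d ⊆ c.box0 ∪ c.box1 := by
  cases d
  · exact subset_union_left
  · exact subset_union_right

lemma Admissible.two_mul_inv_u_lt (hc : c.Admissible) : 2 * c.u⁻¹ < 1 := by
  have := hc.u_gt
  rw [mul_inv_lt_iff₀ hc.u_pos]; linarith

lemma disjoint_tangencyBox (c : Rates) {δ : ℝ} (hδ : δ < 1 - 2 * c.u⁻¹) :
    Disjoint (tangencyBox δ) (c.box0 ∪ c.box1) := by
  rw [Set.disjoint_left]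
  rintro x hx (h | h)
  · have h1 := hx.2.1.1; have h2 := h.2.1.2; linarith
  · have h1 := hx.2.1.2; have h2 := h.2.1.1; linarith

end Rates

lemma isCompact_tangencyBox (δ : ℝ) : IsCompact (tangencyBox δ) := by
  convert E4.isCompact_box ![-δ, -δ, -2, -2] ![δ, δ, 2, 2] using 1
  ext x
  simp [tangencyBox, Fin.forall_fin_succ]

/-! ### Routes: orbits of boxes which follow prescribed words between tangency passages -/

lemma E4.convex_box (a b : Fin 4 → ℝ) : Convex ℝ {x : E4 | ∀ i, x i ∈ Ioo (a i) (b i)} := by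
  intro x hx y hy p q hp hq hpq i
  exact convex_Ioo (a i) (b i) (hx i) (hy i) hp hq hpq

lemma wordRate_reverse {r : Bool → ℝ} (w : List Bool) : wordRate r w.reverse = wordRate r w := by
  induction w with
  | nil => rfl
  | cons d w ih =>
    rw [List.reverse_cons, wordRate_append, ih]
    simp [wordRate, mul_comm]

lemma wordRate_le_one {r : Bool → ℝ} (h0 : ∀ d, 0 < r d) (h1 : ∀ d, r d ≤ 1) (w : List Bool) :
    wordRate r w ≤ 1 := by
  have := wordRate_le h0 h1 w
  rwa [one_pow] at this

namespace Rates

/-- The stable coordinates reached from `(0, 0)` after a word. -/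
def arrival (c : Rates) (w : List Bool) : ℝ × ℝ :=
  (signMap c.s w.reverse 0, pairMap c.cs0 c.cs1 w.reverse 0)

/-- The box around the arrival point of the `k`-th word. -/
def routeBox (c : Rates) (w : ℕ → List Bool) (ε η : ℕ → ℝ) (k : ℕ) : Set E4 :=
  {x | |x 0| ≤ ε k ∧ |x 1| ≤ ε k ∧ |x 2 - (c.arrival (w k)).1| ≤ η k ∧
    |x 3 - (c.arrival (w k)).2| ≤ η k}

/-- The interior of the first box. -/
def routeDomain (c : Rates) (w : ℕ → List Bool) (ε η : ℕ → ℝ) : Set E4 :=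
  {x | |x 0| < ε 0 ∧ |x 1| < ε 0 ∧ |x 2 - (c.arrival (w 0)).1| < η 0 ∧
    |x 3 - (c.arrival (w 0)).2| < η 0}

/-- The times of the passages near the tangency. -/
def routeTime (w : ℕ → List Bool) : ℕ → ℕ
  | 0 => 0
  | k + 1 => routeTime w k + 1 + (w (k + 1)).length

/-- The map `f` sends the boxes around the arrival points of the words to the beginning of the
next word, and the sizes of the boxes are adapted to the expansion along the words. -/
structure IsRoute (c : Rates) (f : E4 → E4) (l m a₁ a₂ δ : ℝ) (w : ℕ → List Bool)
    (ε η : ℕ → ℝ) : Prop where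
  affine : c.IsAffineOn f
  tangency : ∀ k, ∀ x ∈ c.routeBox w ε η k,
    f x = !₂[pairMap c.cu0⁻¹ c.cu1⁻¹ (w (k + 1)) 0 - x 0 ^ 2 + l * (x 2 - (c.arrival (w k)).1),
      signMap c.u⁻¹ (w (k + 1)) 0 - a₁ * x 1 ^ 2 + m * (x 3 - (c.arrival (w k)).2),
      a₂ * x 0, x 1]
  subset_tangencyBox : ∀ k, c.routeBox w ε η k ⊆ tangencyBox δ
  l_nonneg : 0 ≤ l
  m_nonneg : 0 ≤ m
  a₁_nonneg : 0 ≤ a₁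
  a₂_nonneg : 0 ≤ a₂
  ε_pos : ∀ k, 0 < ε k
  η_pos : ∀ k, 0 < η k
  ε_le : ∀ k, ε k ≤ 1
  a₂_mul_le : ∀ k, a₂ * ε k ≤ 1
  expand₀ : ∀ k, c.u ^ (w (k + 1)).length * (ε k ^ 2 + l * η k) ≤ ε (k + 1)
  expand₁ : ∀ k, c.u ^ (w (k + 1)).length * (a₁ * ε k ^ 2 + m * η k) ≤ ε (k + 1)
  contract₂ : ∀ k, wordRate (pairRate c.cs0 c.cs1) (w (k + 1)) * (a₂ * ε k) ≤ η (k + 1)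
  contract₃ : ∀ k, wordRate (pairRate c.cs0 c.cs1) (w (k + 1)) * ε k ≤ η (k + 1)
  tendsto_ε : Tendsto ε atTop (𝓝 0)
  tendsto_η : Tendsto η atTop (𝓝 0)
  tendsto_length : Tendsto (fun k => (w k).length) atTop atTop

variable {c : Rates} {f : E4 → E4} {l m a₁ a₂ δ : ℝ} {w : ℕ → List Bool} {ε η : ℕ → ℝ}

/-- A displacement `y` at the beginning of a word comes from the displacement `y / wordRate r w` at
its end, and no digit expands by more than `q`. -/
lemma start_of_abs_le {r v : Bool → ℝ} (hb : ∀ d, 0 < r d) {q : ℝ} (hq : 0 < q)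
    (hqr : ∀ d, q⁻¹ ≤ r d) (w : List Bool) {y e : ℝ} (hy : q ^ w.length * |y| ≤ e) :
    ∃ z, |z| ≤ e ∧ wordMap r v w z = wordMap r v w 0 + y := by
  have h1 := le_wordRate (inv_nonneg.2 hq.le) hqr w
  have h2 := wordRate_pos hb w
  refine ⟨y / wordRate r w, ?_, ?_⟩
  · rw [abs_div, abs_of_pos h2, div_le_iff₀ h2]
    have h3 : |y| ≤ e * (q⁻¹) ^ w.length := by
      rw [inv_pow, ← div_eq_mul_inv, le_div_iff₀ (by positivity)]
      linarith
    have h4 : 0 ≤ e := le_trans (by positivity) hy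
    exact h3.trans (mul_le_mul_of_nonneg_left h1 h4)
  · have := wordMap_sub (r := r) (v := v) w (y / wordRate r w) 0
    rw [sub_zero, mul_div_cancel₀ _ h2.ne'] at this
    linarith

namespace IsRoute

/-- The passage produces unstable errors quadratic in `ε k` and linear in `η k`; the conditions
`expand₀` and `expand₁` say that these are still at most `ε (k + 1)` when the next word has expanded
them. -/
lemma exists_start (h : c.IsRoute f l m a₁ a₂ δ w ε η) (hc : c.Admissible) (k : ℕ) {x : E4}
    (hx : x ∈ c.routeBox w ε η k) :
    ∃ z₀ z₁, |z₀| ≤ ε (k + 1) ∧ |z₁| ≤ ε (k + 1) ∧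
      f x = c.start (w (k + 1)) z₀ z₁ (a₂ * x 0) (x 1) := by
  obtain ⟨h0, h1, h2, h3⟩ := id hx
  have hu := hc.u_pos
  have hup : 0 < c.u ^ (w (k + 1)).length := pow_pos hu _
  have sq0 : x 0 ^ 2 ≤ ε k ^ 2 := by rw [← sq_abs]; exact pow_le_pow_left₀ (abs_nonneg _) h0 2
  have sq1 : x 1 ^ 2 ≤ ε k ^ 2 := by rw [← sq_abs]; exact pow_le_pow_left₀ (abs_nonneg _) h1 2
  obtain ⟨z₀, hz₀, e₀⟩ := start_of_abs_le (v := pairShift c.cu1⁻¹)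
    hc.future.pairRate_pos hu
    (fun d => hc.future.t_lt.le.trans (hc.future.le_pairRate d)) (w (k + 1))
    (y := -x 0 ^ 2 + l * (x 2 - (c.arrival (w k)).1)) (e := ε (k + 1)) (by
      refine le_trans (mul_le_mul_of_nonneg_left ?_ hup.le) (h.expand₀ k)
      refine (abs_add_le _ _).trans (add_le_add ?_ ?_)
      · rw [abs_neg, abs_of_nonneg (sq_nonneg _)]; exact sq0
      · rw [abs_mul, abs_of_nonneg h.l_nonneg]
        exact mul_le_mul_of_nonneg_left h2 h.l_nonneg)
  obtain ⟨z₁, hz₁, e₁⟩ := start_of_abs_le (r := fun _ => c.u⁻¹)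
    (v := signShift) (fun _ => inv_pos.2 hu) hu (fun _ => le_rfl) (w (k + 1))
    (y := -(a₁ * x 1 ^ 2) + m * (x 3 - (c.arrival (w k)).2)) (e := ε (k + 1)) (by
      refine le_trans (mul_le_mul_of_nonneg_left ?_ hup.le) (h.expand₁ k)
      refine (abs_add_le _ _).trans (add_le_add ?_ ?_)
      · rw [abs_neg, abs_mul, abs_of_nonneg h.a₁_nonneg, abs_of_nonneg (sq_nonneg _)]
        exact mul_le_mul_of_nonneg_left sq1 h.a₁_nonneg
      · rw [abs_mul, abs_of_nonneg h.m_nonneg]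
        exact mul_le_mul_of_nonneg_left h3 h.m_nonneg)
  refine ⟨z₀, z₁, hz₀, hz₁, ?_⟩
  rw [h.tangency k x hx, start, pairMap, signMap, e₀, e₁]
  simp only [sub_eq_add_neg, add_assoc]

lemma abs_a₂_mul_le (h : c.IsRoute f l m a₁ a₂ δ w ε η) (k : ℕ) {y : ℝ} (hy : |y| ≤ ε k) :
    |a₂ * y| ≤ a₂ * ε k := by
  rw [abs_mul, abs_of_nonneg h.a₂_nonneg]
  exact mul_le_mul_of_nonneg_left hy h.a₂_nonneg

lemma mem_Icc_two {x : ℝ} (h : |x| ≤ 1) : x ∈ Icc (-2 : ℝ) 2 := by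
  rw [abs_le] at h; constructor <;> linarith

/-- The new stable coordinates are contracted copies of the old unstable ones, which the passage has
turned into `a₂ * x 0` and `x 1`. The slope `s` is smaller than both slopes of the overlapping pair,
so one rate serves for both coordinates. -/
lemma iterate_mem (h : c.IsRoute f l m a₁ a₂ δ w ε η) (hc : c.Admissible) (k : ℕ) {x : E4}
    (hx : x ∈ c.routeBox w ε η k) : f^[1 + (w (k + 1)).length] x ∈ c.routeBox w ε η (k + 1) := by
  obtain ⟨z₀, z₁, hz₀, hz₁, e⟩ := h.exists_start hc k hx
  have h2 := h.abs_a₂_mul_le k hx.1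
  rw [add_comm 1, Function.iterate_add_apply, Function.iterate_one, e]
  have key := h.affine.iterate_start hc (w (k + 1)) [] (mem_Icc_two (hz₀.trans (h.ε_le _)))
    (mem_Icc_two (hz₁.trans (h.ε_le _))) (mem_Icc_two (h2.trans (h.a₂_mul_le k)))
    (mem_Icc_two (hx.2.1.trans (h.ε_le k)))
  rw [List.append_nil] at key
  rw [key]
  have hσ := wordRate_pos hc.past.pairRate_pos (w (k + 1))
  refine ⟨hz₀, hz₁, ?_, ?_⟩
  · change |signMap c.s _ _ - signMap c.s _ 0| ≤ _
    rw [signMap_sub, sub_zero, List.length_reverse, abs_mul,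
      abs_of_pos (pow_pos hc.past.t_pos _)]
    refine le_trans ?_ (h.contract₂ k)
    refine mul_le_mul ?_ h2 (abs_nonneg _) hσ.le
    exact (pow_le_pow_left₀ hc.past.t_pos.le hc.past.t_lt.le _).trans
      (le_wordRate hc.past.pos.le hc.past.le_pairRate _)
  · change |pairMap c.cs0 c.cs1 _ _ - pairMap c.cs0 c.cs1 _ 0| ≤ _
    rw [pairMap, abs_wordMap_sub hc.past.pairRate_pos, sub_zero, wordRate_reverse]
    exact (mul_le_mul_of_nonneg_left hx.2.1 hσ.le).trans (h.contract₃ k)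

lemma domain_subset : c.routeDomain w ε η ⊆ c.routeBox w ε η 0 := fun _ hx =>
  ⟨hx.1.le, hx.2.1.le, hx.2.2.1.le, hx.2.2.2.le⟩

lemma iterate_time_mem (h : c.IsRoute f l m a₁ a₂ δ w ε η) (hc : c.Admissible) (k : ℕ) {x : E4}
    (hx : x ∈ c.routeDomain w ε η) : f^[routeTime w k] x ∈ c.routeBox w ε η k := by
  induction k with
  | zero => exact domain_subset hx
  | succ k ih =>
    have := h.iterate_mem hc k ih
    rw [← Function.iterate_add_apply] at this
    rw [routeTime]
    convert this using 2
    ring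

/-- The orbit of a point of the domain along the `k`-th word. -/
lemma exists_orbit (h : c.IsRoute f l m a₁ a₂ δ w ε η) (hc : c.Admissible) (k : ℕ) {x : E4}
    (hx : x ∈ c.routeDomain w ε η) :
    ∃ z₀ z₁ x₂ x₃, |z₀| ≤ ε (k + 1) ∧ |z₁| ≤ ε (k + 1) ∧ |x₂| ≤ a₂ * ε k ∧ |x₃| ≤ ε k ∧
      z₀ ∈ Icc (-2 : ℝ) 2 ∧ z₁ ∈ Icc (-2 : ℝ) 2 ∧ x₂ ∈ Icc (-2 : ℝ) 2 ∧ x₃ ∈ Icc (-2 : ℝ) 2 ∧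
      ∀ w₁ w₂, w (k + 1) = w₁ ++ w₂ → f^[routeTime w k + 1 + w₁.length] x =
        c.start w₂ z₀ z₁ (signMap c.s w₁.reverse x₂) (pairMap c.cs0 c.cs1 w₁.reverse x₃) := by
  have hx' := h.iterate_time_mem hc k hx
  obtain ⟨z₀, z₁, hz₀, hz₁, e⟩ := h.exists_start hc k hx'
  have h2 := h.abs_a₂_mul_le k hx'.1
  refine ⟨z₀, z₁, _, _, hz₀, hz₁, h2, hx'.2.1, (mem_Icc_two (hz₀.trans (h.ε_le _))),
    (mem_Icc_two (hz₁.trans (h.ε_le _))), (mem_Icc_two (h2.trans (h.a₂_mul_le k))),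
    (mem_Icc_two (hx'.2.1.trans (h.ε_le k))), fun w₁ w₂ hw => ?_⟩
  rw [add_comm, Function.iterate_add_apply, add_comm (routeTime w k) 1,
    Function.iterate_add_apply f 1, Function.iterate_one, e, hw]
  exact h.affine.iterate_start hc w₁ w₂ (mem_Icc_two (hz₀.trans (h.ε_le _)))
    (mem_Icc_two (hz₁.trans (h.ε_le _))) (mem_Icc_two (h2.trans (h.a₂_mul_le k)))
    (mem_Icc_two (hx'.2.1.trans (h.ε_le k)))

/-- During the `k`-th word the orbit visits the boxes prescribed by the digits. -/
lemma iterate_mem_box (h : c.IsRoute f l m a₁ a₂ δ w ε η) (hc : c.Admissible) (k : ℕ) {x : E4}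
    (hx : x ∈ c.routeDomain w ε η) {w₁ w₂ : List Bool} {d : Bool}
    (hw : w (k + 1) = w₁ ++ d :: w₂) : f^[routeTime w k + 1 + w₁.length] x ∈ c.box d := by
  obtain ⟨z₀, z₁, x₂, x₃, -, -, -, -, h0, h1, h2, h3, e⟩ := h.exists_orbit hc k hx
  rw [e _ _ hw]
  exact hc.start_cons_mem_box d w₂ h0 h1 (wordMap_mem_Icc hc.past.sign_mem_two _ h2)
    (wordMap_mem_Icc hc.past.pair_mem_two _ h3)

lemma time_strictMono : StrictMono (routeTime w) :=
  strictMono_nat_of_lt_succ fun k => by rw [routeTime]; omega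

lemma exists_split {k i : ℕ} (h1 : routeTime w k < i) (h2 : i < routeTime w (k + 1)) :
    ∃ w₁ d w₂, w (k + 1) = w₁ ++ d :: w₂ ∧ i = routeTime w k + 1 + w₁.length := by
  obtain ⟨j, rfl⟩ := Nat.exists_eq_add_of_lt h1
  rw [routeTime] at h2
  have hj : j < (w (k + 1)).length := by omega
  refine ⟨(w (k + 1)).take j, (w (k + 1))[j], (w (k + 1)).drop (j + 1), ?_, ?_⟩
  · rw [← List.drop_eq_getElem_cons hj, List.take_append_drop]
  · rw [List.length_take, min_eq_left hj.le]; ring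

lemma iterate_mem_boxes (h : c.IsRoute f l m a₁ a₂ δ w ε η) (hc : c.Admissible) {k i : ℕ}
    (h1 : routeTime w k < i) (h2 : i < routeTime w (k + 1)) {x : E4}
    (hx : x ∈ c.routeDomain w ε η) : f^[i] x ∈ c.box0 ∪ c.box1 := by
  obtain ⟨w₁, d, w₂, hw, rfl⟩ := exists_split h1 h2
  exact c.box_subset d (h.iterate_mem_box hc k hx hw)

lemma isOpen_domain : IsOpen (c.routeDomain w ε η) := by
  have hc : ∀ i : Fin 4, Continuous fun x : E4 => x i := fun i => by fun_prop
  exact (isOpen_lt (hc 0).abs continuous_const).inter <|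
    (isOpen_lt (hc 1).abs continuous_const).inter <|
    (isOpen_lt ((hc 2).sub continuous_const).abs continuous_const).inter <|
    isOpen_lt ((hc 3).sub continuous_const).abs continuous_const

lemma isConnected_domain (h : c.IsRoute f l m a₁ a₂ δ w ε η) :
    IsConnected (c.routeDomain w ε η) := by
  refine ⟨⟨!₂[0, 0, (c.arrival (w 0)).1, (c.arrival (w 0)).2], ?_⟩, ?_⟩
  · simp [routeDomain, h.ε_pos, h.η_pos]
  · have hset : c.routeDomain w ε η = {x : E4 | ∀ i, x i ∈
        Ioo (![-ε 0, -ε 0, (c.arrival (w 0)).1 - η 0, (c.arrival (w 0)).2 - η 0] i)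
          (![ε 0, ε 0, (c.arrival (w 0)).1 + η 0, (c.arrival (w 0)).2 + η 0] i)} := by
      ext x
      refine Iff.trans ?_ (Fin.forall_fin_succ (P := fun i => x i ∈ Ioo _ _)).symm
      simp only [Fin.forall_fin_succ, routeDomain, mem_ofPred_eq, abs_lt, sub_lt_iff_lt_add',
        neg_lt_sub_iff_lt_add']
      simp [sub_lt_iff_lt_add]
    rw [hset]
    exact (E4.convex_box _ _).isPreconnected

lemma dist_start_le (hc : c.Admissible) (w : List Bool) {z₀ z₁ y₀ y₁ x₂ x₃ y₂ y₃ : ℝ} :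
    dist (c.start w z₀ z₁ x₂ x₃) (c.start w y₀ y₁ y₂ y₃) ≤
      |z₀ - y₀| + |z₁ - y₁| + |x₂ - y₂| + |x₃ - y₃| := by
  refine (E4.dist_le _ _).trans ?_
  have h0 : |pairMap c.cu0⁻¹ c.cu1⁻¹ w z₀ - pairMap c.cu0⁻¹ c.cu1⁻¹ w y₀| ≤ |z₀ - y₀| := by
    rw [pairMap, abs_wordMap_sub hc.future.pairRate_pos]
    exact mul_le_of_le_one_left (abs_nonneg _)
      (wordRate_le_one hc.future.pairRate_pos (fun d => (hc.future.pairRate_lt_one d).le) _)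
  have h1 : |signMap c.u⁻¹ w z₁ - signMap c.u⁻¹ w y₁| ≤ |z₁ - y₁| := by
    have ht := hc.future.t_pos
    have ht1 : c.u⁻¹ ≤ 1 := by linarith [hc.future.t_lt, hc.future.lt_half]
    rw [signMap, abs_wordMap_sub (fun _ => ht)]
    exact mul_le_of_le_one_left (abs_nonneg _) (wordRate_le_one (fun _ => ht) (fun _ => ht1) _)
  exact add_le_add (add_le_add (add_le_add h0 h1) le_rfl) le_rfl

/-- Along a word the unstable coordinates of two points differ most at its end and the stable ones
at its beginning, and box sizes bound both differences. -/
lemma dist_iterate_le (h : c.IsRoute f l m a₁ a₂ δ w ε η) (hc : c.Admissible) {k i : ℕ}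
    (h1 : routeTime w k ≤ i) (h2 : i < routeTime w (k + 1)) {x y : E4}
    (hx : x ∈ c.routeDomain w ε η) (hy : y ∈ c.routeDomain w ε η) :
    dist (f^[i] x) (f^[i] y) ≤ 4 * ε (k + 1) + 4 * ε k + 2 * (a₂ * ε k) + 4 * η k := by
  have hε := h.ε_pos k
  have hε' := h.ε_pos (k + 1)
  have hη := h.η_pos k
  have ha := mul_nonneg h.a₂_nonneg hε.le
  have tri : ∀ p q r e : ℝ, |p - r| ≤ e → |q - r| ≤ e → |p - q| ≤ 2 * e := by
    intro p q r e hp hq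
    rw [abs_le] at *
    constructor <;> linarith [hp.1, hp.2, hq.1, hq.2]
  have tri0 : ∀ p q e : ℝ, |p| ≤ e → |q| ≤ e → |p - q| ≤ 2 * e := fun p q e hp hq =>
    tri p q 0 e (by simpa using hp) (by simpa using hq)
  rcases h1.eq_or_lt with rfl | h1
  · obtain ⟨a0, a1, a2, a3⟩ := h.iterate_time_mem hc k hx
    obtain ⟨b0, b1, b2, b3⟩ := h.iterate_time_mem hc k hy
    have := E4.dist_le (f^[routeTime w k] x) (f^[routeTime w k] y)
    have := tri0 _ _ _ a0 b0
    have := tri0 _ _ _ a1 b1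
    have := tri _ _ _ _ a2 b2
    have := tri _ _ _ _ a3 b3
    linarith
  · obtain ⟨w₁, d, w₂, hw, rfl⟩ := exists_split h1 h2
    obtain ⟨z₀, z₁, x₂, x₃, a0, a1, a2, a3, -, -, -, -, e⟩ := h.exists_orbit hc k hx
    obtain ⟨z₀', z₁', x₂', x₃', b0, b1, b2, b3, -, -, -, -, e'⟩ := h.exists_orbit hc k hy
    rw [e _ _ hw, e' _ _ hw]
    have h3 : |signMap c.s w₁.reverse x₂ - signMap c.s w₁.reverse x₂'| ≤ |x₂ - x₂'| := by
      have hs1 : c.s ≤ 1 := by linarith [hc.past.t_lt, hc.past.lt_half]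
      rw [signMap, abs_wordMap_sub (fun _ => hc.past.t_pos)]
      exact mul_le_of_le_one_left (abs_nonneg _)
        (wordRate_le_one (fun _ => hc.past.t_pos) (fun _ => hs1) _)
    have h4 : |pairMap c.cs0 c.cs1 w₁.reverse x₃ - pairMap c.cs0 c.cs1 w₁.reverse x₃'|
        ≤ |x₃ - x₃'| := by
      rw [pairMap, abs_wordMap_sub hc.past.pairRate_pos]
      exact mul_le_of_le_one_left (abs_nonneg _)
        (wordRate_le_one hc.past.pairRate_pos (fun d => (hc.past.pairRate_lt_one d).le) _)
    have := dist_start_le hc (d :: w₂) (z₀ := z₀) (z₁ := z₁) (y₀ := z₀') (y₁ := z₁')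
      (x₂ := signMap c.s w₁.reverse x₂) (x₃ := pairMap c.cs0 c.cs1 w₁.reverse x₃)
      (y₂ := signMap c.s w₁.reverse x₂') (y₃ := pairMap c.cs0 c.cs1 w₁.reverse x₃')
    have := tri0 _ _ _ a0 b0
    have := tri0 _ _ _ a1 b1
    have := tri0 _ _ _ a2 b2
    have := tri0 _ _ _ a3 b3
    linarith

theorem isContractingWanderingDomain (h : c.IsRoute f l m a₁ a₂ δ w ε η) (hc : c.Admissible)
    (hδ : δ < 1 - 2 * c.u⁻¹) (hf : Continuous f) (hinj : Function.Injective f) :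
    IsContractingWanderingDomain f (c.routeDomain w ε η) := by
  refine isContractingWanderingDomain_of_gaps (T := routeTime w)
    (η := fun k => 4 * ε (k + 1) + 4 * ε k + 2 * (a₂ * ε k) + 4 * η k) hf hinj isOpen_domain
    h.isConnected_domain (isCompact_tangencyBox δ)
    (c.isCompact_box0.union c.isCompact_box1).isClosed (c.disjoint_tangencyBox hδ)
    rfl time_strictMono ?_ (fun k x hx => h.subset_tangencyBox k (h.iterate_time_mem hc k hx))
    (fun k i h1 h2 x hx => h.iterate_mem_boxes hc h1 h2 hx) ?_
    (fun k i h1 h2 x hx y hy => h.dist_iterate_le hc h1 h2 hx hy)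
  · have h1 := (tendsto_add_atTop_iff_nat 1).2 h.tendsto_length
    refine tendsto_atTop_mono (fun k => ?_) h1
    rw [routeTime]; omega
  · have h1 := (tendsto_add_atTop_iff_nat 1).2 h.tendsto_ε
    simpa using (((h1.const_mul 4).add (h.tendsto_ε.const_mul 4)).add
      ((h.tendsto_ε.const_mul a₂).const_mul 2)).add (h.tendsto_η.const_mul 4)

theorem isBounded_orbit (h : c.IsRoute f l m a₁ a₂ δ w ε η) (hc : c.Admissible) :
    Bornology.IsBounded (⋃ i : ℕ, f^[i] '' c.routeDomain w ε η) := by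
  refine (((isCompact_tangencyBox δ).union
    (c.isCompact_box0.union c.isCompact_box1)).isBounded).subset ?_
  rintro _ ⟨_, ⟨i, rfl⟩, x, hx, rfl⟩
  obtain ⟨k, h1, h2⟩ := exists_return_interval (T := routeTime w) rfl time_strictMono i
  rcases h1.eq_or_lt with rfl | h1
  · exact Or.inl (h.subset_tangencyBox k (h.iterate_time_mem hc k hx))
  · exact Or.inr (h.iterate_mem_boxes hc h1 h2 hx)

end IsRoute

end Rates

/-! ### Averages along sequences -/

/-- A sequence with long windows of zeros followed by equally long windows of ones has no Cesàro
limit. -/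
lemma not_tendsto_average_of_windows {b : ℕ → ℝ} {p a : ℕ → ℕ} {C v : ℝ} (hC : 0 < C)
    (hp : Tendsto p atTop atTop) (ha : ∀ k, 0 < a k)
    (hpa : ∀ k, ((p k + 2 * a k : ℕ) : ℝ) ≤ C * a k)
    (h0 : ∀ k i, p k ≤ i → i < p k + a k → b i = 0)
    (h1 : ∀ k i, p k + a k ≤ i → i < p k + 2 * a k → b i = 1) :
    ¬ Tendsto (fun n : ℕ => ((n : ℝ) + 1)⁻¹ * ∑ i ∈ Finset.range (n + 1), b i) atTop (𝓝 v) := by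
  intro h
  -- If the averages tended to `v`, the partial sums up to `p + 2 * a` would equal `v * n` up to `a
  -- / 8`. The two windows have increments `0` and `a`, and both would have to be within `a / 4` of
  -- `v * a`.
  have hε : 0 < 1 / (8 * C) := by positivity
  obtain ⟨N, hN⟩ := eventually_atTop.1 ((Metric.tendsto_nhds.1 h) _ hε)
  set S : ℕ → ℝ := fun n => ∑ i ∈ Finset.range n, b i with hS
  have key : ∀ n, N < n → |S n - v * n| ≤ 1 / (8 * C) * n := by
    intro n hn
    obtain ⟨m, rfl⟩ := Nat.exists_eq_add_of_lt hn
    have h2 := (hN (N + m) (by omega)).le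
    rw [Real.dist_eq] at h2
    have hpos : (0 : ℝ) < ((N + m : ℕ) : ℝ) + 1 := by positivity
    have h3 : S (N + m + 1) - v * ((N + m + 1 : ℕ) : ℝ)
        = (((N + m : ℕ) : ℝ) + 1) * ((((N + m : ℕ) : ℝ) + 1)⁻¹ * S (N + m + 1) - v) := by
      have : ((N + m + 1 : ℕ) : ℝ) = ((N + m : ℕ) : ℝ) + 1 := by push_cast; ring
      rw [this]
      field_simp
    rw [h3, abs_mul, abs_of_pos hpos, mul_comm]
    refine (mul_le_mul_of_nonneg_right h2 hpos.le).trans (le_of_eq ?_)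
    push_cast; ring
  obtain ⟨k, hk⟩ := (hp.eventually_gt_atTop N).exists
  have e1 : S (p k + a k) = S (p k) := by
    rw [hS]
    simp only
    rw [Finset.sum_range_add, add_eq_left]
    refine Finset.sum_eq_zero fun i hi => ?_
    have := Finset.mem_range.1 hi
    exact h0 k _ (by omega) (by omega)
  have e2 : S (p k + 2 * a k) = S (p k + a k) + a k := by
    rw [hS]
    simp only
    rw [show p k + 2 * a k = p k + a k + a k by ring, Finset.sum_range_add]
    congr 1
    rw [Finset.sum_congr rfl (g := fun _ => (1 : ℝ))]
    · simp
    · intro i hi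
      have := Finset.mem_range.1 hi
      exact h1 k _ (by omega) (by omega)
  have k1 := abs_le.1 (key (p k) hk)
  have k2 := abs_le.1 (key (p k + a k) (by omega))
  have k3 := abs_le.1 (key (p k + 2 * a k) (by omega))
  have hak : (0 : ℝ) < a k := by exact_mod_cast ha k
  have hpk := hpa k
  have hp0 : (0 : ℝ) ≤ p k := Nat.cast_nonneg _
  push_cast at k2 k3 hpk
  have h4 : 1 / (8 * C) * (p k + 2 * a k) ≤ a k / 8 := by
    rw [div_mul_eq_mul_div, one_mul, div_le_div_iff₀ (by positivity) (by norm_num)]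
    nlinarith
  have h5 : 0 < 1 / (8 * C) * (p k + 2 * (a k : ℝ)) := by positivity
  have h6 : 1 / (8 * C) * (p k + a k) ≤ 1 / (8 * C) * (p k + 2 * (a k : ℝ)) :=
    mul_le_mul_of_nonneg_left (by linarith) hε.le
  have h7 : 1 / (8 * C) * (p k : ℝ) ≤ 1 / (8 * C) * (p k + 2 * (a k : ℝ)) :=
    mul_le_mul_of_nonneg_left (by linarith) hε.le
  linarith [k1.1, k1.2, k2.1, k2.2, k3.1, k3.2]

/-- Cesàro averages tend to zero if the averages over suitable blocks do. -/
lemma tendsto_average_zero_of_blocks {b : ℕ → ℝ} (hb : ∀ i, 0 ≤ b i) {T : ℕ → ℕ} {C : ℝ}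
    (h0 : T 0 = 0) (hT : StrictMono T)
    (hTC : ∀ k, 0 < k → (T (k + 1) : ℝ) ≤ C * T k)
    (hblock : ∀ ε > 0, ∀ᶠ k in atTop, ∑ i ∈ Finset.Ico (T k) (T (k + 1)), b i
      ≤ ε * ((T (k + 1) : ℝ) - T k)) :
    Tendsto (fun n : ℕ => ((n : ℝ) + 1)⁻¹ * ∑ i ∈ Finset.range (n + 1), b i) atTop (𝓝 0) := by
  have hC : 0 < C := by
    have h1 := hTC 1 one_pos
    have h2 : (0 : ℝ) < T 1 := by
      have := hT (show 0 < 1 by omega)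
      exact_mod_cast (Nat.zero_le _).trans_lt this
    have h3 : (0 : ℝ) < T (1 + 1) := by
      have := hT (show 1 < 2 by omega)
      exact_mod_cast (Nat.zero_le _).trans_lt this
    by_contra! hC
    nlinarith
  rw [Metric.tendsto_nhds]
  intro ε hε
  -- The sum up to `n` is bounded by the sum up to the end of the block containing `n`, which is at
  -- most `C * n`; the factor `C` in the denominator compensates for this.
  obtain ⟨K, hK⟩ := eventually_atTop.1 (hblock (ε / (4 * C)) (by positivity))
  set S : ℕ → ℝ := fun n => ∑ i ∈ Finset.range n, b i with hS
  have hSm : Monotone S := fun m n h => Finset.sum_le_sum_of_subset_of_nonneg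
    (Finset.range_mono h) fun _ _ _ => hb _
  have hstep : ∀ j, S (T (K + j)) ≤ S (T K) + ε / (4 * C) * T (K + j) := by
    intro j
    induction j with
    | zero =>
      have : 0 ≤ ε / (4 * C) * T (K + 0) := by positivity
      simpa using this
    | succ j ih =>
      have h1 := hK (K + j) (by omega)
      have h2 : S (T (K + j + 1)) = S (T (K + j))
          + ∑ i ∈ Finset.Ico (T (K + j)) (T (K + j + 1)), b i := by
        rw [hS]
        exact (Finset.sum_range_add_sum_Ico _ (hT (Nat.lt_succ_self _)).le).symm
      rw [← add_assoc, h2]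
      linarith
  have hlim : Tendsto (fun n : ℕ => S (T K) * ((n : ℝ) + 1)⁻¹) atTop (𝓝 0) := by
    simpa [one_div] using
      (tendsto_one_div_add_atTop_nhds_zero_nat (𝕜 := ℝ)).const_mul (S (T K))
  filter_upwards [hlim.eventually_lt_const (show 0 < ε / 2 by positivity),
    eventually_ge_atTop (T (K + 1))] with n hn hnK
  obtain ⟨k, hk1, hk2⟩ := exists_return_interval h0 hT n
  have hKk : K < k := by
    by_contra! hlt
    have := hT.monotone (show k + 1 ≤ K + 1 by omega)
    omega
  obtain ⟨j, hj⟩ := Nat.exists_eq_add_of_le (show K ≤ k + 1 by omega)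
  have h3 : S (n + 1) ≤ S (T (k + 1)) := hSm hk2
  have h4 := hstep j
  rw [← hj] at h4
  have h5 := hTC k (by omega)
  have h6 : (T k : ℝ) ≤ n := by exact_mod_cast hk1
  have h7 : ε / (4 * C) * T (k + 1) ≤ ε / 4 * n := by
    calc ε / (4 * C) * T (k + 1) ≤ ε / (4 * C) * (C * n) := by
          refine mul_le_mul_of_nonneg_left (h5.trans ?_) (by positivity)
          exact mul_le_mul_of_nonneg_left h6 hC.le
      _ = ε / 4 * n := by field_simp
  have hS0 : 0 ≤ S (n + 1) := Finset.sum_nonneg fun _ _ => hb _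
  have hnp : (0 : ℝ) < (n : ℝ) + 1 := by positivity
  rw [Real.dist_eq, sub_zero, abs_of_nonneg (mul_nonneg (inv_nonneg.2 hnp.le) hS0),
    inv_mul_lt_iff₀ hnp]
  rw [← div_eq_mul_inv, div_lt_iff₀ hnp] at hn
  nlinarith

lemma integral_empirical {M : Type*} [TopologicalSpace M] [MeasurableSpace M]
    [OpensMeasurableSpace M] (f : M → M) (x : M) (n : ℕ) (g : BoundedContinuousFunction M ℝ) :
    ∫ y, g y ∂(empirical f x n : Measure M) =
      ((n : ℝ) + 1)⁻¹ * ∑ i ∈ Finset.range (n + 1), g (f^[i] x) := by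
  change ∫ y, g y ∂(empiricalMeasure f x n) = _
  rw [empiricalMeasure, integral_smul_measure, integral_finsetSum_measure]
  · have h1 : (((n : ℝ≥0∞) + 1)⁻¹).toReal = ((n : ℝ) + 1)⁻¹ := by
      rw [ENNReal.toReal_inv, ENNReal.toReal_add (by simp) (by simp)]
      simp
    rw [h1, smul_eq_mul]
    congr 1
    refine Finset.sum_congr rfl fun i _ => ?_
    exact integral_dirac' _ _ g.continuous.measurable.stronglyMeasurable
  · intro i _
    exact g.integrable _

/-! ### Empirical measures along a route -/

namespace Rates

variable {c : Rates} {f : E4 → E4} {l m a₁ a₂ δ : ℝ} {w : ℕ → List Bool} {ε η : ℕ → ℝ}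

/-- A bounded continuous function which is one on the first and zero on the second box. -/
def boxSeparator (c : Rates) : BoundedContinuousFunction E4 ℝ :=
  BoundedContinuousFunction.ofNormedAddCommGroup
    (fun x : E4 => max 0 (min 1 (-(x 1) / (1 - 2 * c.u⁻¹)))) (by fun_prop) 1 (fun x => by
      rw [Real.norm_of_nonneg (le_max_left _ _)]
      exact max_le zero_le_one (min_le_left _ _))

lemma Admissible.boxSeparator_box (hc : c.Admissible) {d : Bool} {x : E4} (hx : x ∈ c.box d) :
    c.boxSeparator x = cond d 0 1 := by
  have h := hc.two_mul_inv_u_lt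
  change max 0 (min 1 (-(x 1) / (1 - 2 * c.u⁻¹))) = _
  cases d
  · have h1 : 1 ≤ -(x 1) / (1 - 2 * c.u⁻¹) := by
      rw [le_div_iff₀ (by linarith)]
      have := hx.2.1.2
      linarith
    rw [min_eq_left h1]; simp
  · have h1 : -(x 1) / (1 - 2 * c.u⁻¹) ≤ 0 := by
      rw [div_le_iff₀ (by linarith)]
      have := hx.2.1.1
      linarith
    rw [min_eq_right (h1.trans zero_le_one), max_eq_left h1]; simp

/-- Words with long runs of ones followed by equally long runs of zeros give historic behavior. -/
theorem IsRoute.hasHistoricBehavior (h : c.IsRoute f l m a₁ a₂ δ w ε η) (hc : c.Admissible)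
    {φ ψ : ℕ → List Bool} {a : ℕ → ℕ} {C : ℝ} (hC : 0 < C) (ha : ∀ k, 0 < a k)
    (hw : ∀ k, w (k + 1) = φ k ++ List.replicate (a k) true ++ List.replicate (a k) false ++ ψ k)
    (hT : ∀ k, (routeTime w (k + 1) : ℝ) ≤ C * a k) {x : E4} (hx : x ∈ c.routeDomain w ε η) :
    HasHistoricBehavior f x := by
  rintro ⟨μ, hμ⟩
  have h1 := (ProbabilityMeasure.tendsto_iff_forall_integral_tendsto.1 hμ) c.boxSeparator
  simp only [integral_empirical] at h1
  -- The separating function vanishes on the second box and equals one on the first, so a run of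
  -- `true` is a window of zeros. The summand `1` in `p` is the passage near the tangency.
  refine not_tendsto_average_of_windows (p := fun k => routeTime w k + 1 + (φ k).length)
    (a := a) hC ?_ ha ?_ ?_ ?_ h1
  · refine tendsto_atTop_mono (fun k => ?_) time_strictMono.tendsto_atTop (f := routeTime w)
    omega
  · intro k
    refine le_trans ?_ (hT k)
    rw [routeTime, hw]
    simp only [List.length_append, List.length_replicate]
    exact_mod_cast (by omega)
  · intro k i hi1 hi2
    obtain ⟨j, rfl⟩ := Nat.exists_eq_add_of_le hi1
    have hj : a k = j + (1 + (a k - j - 1)) := by omega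
    have hw' : w (k + 1) = (φ k ++ List.replicate j true) ++ true ::
        (List.replicate (a k - j - 1) true ++ List.replicate (a k) false ++ ψ k) := by
      rw [hw]
      conv_lhs => rw [hj, List.replicate_add j, List.replicate_add 1, ← hj]
      simp
    have h2 := h.iterate_mem_box hc k hx hw'
    have h3 := hc.boxSeparator_box h2
    rw [List.length_append, List.length_replicate, ← add_assoc] at h3
    exact h3
  · intro k i hi1 hi2
    obtain ⟨j, rfl⟩ := Nat.exists_eq_add_of_le hi1
    have hj : a k = j + (1 + (a k - j - 1)) := by omega
    have hw' : w (k + 1) = (φ k ++ List.replicate (a k) true ++ List.replicate j false) ++ false ::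
        (List.replicate (a k - j - 1) false ++ ψ k) := by
      rw [hw]
      have : List.replicate (a k) false = List.replicate j false ++ false ::
          List.replicate (a k - j - 1) false := by
        conv_lhs => rw [hj, List.replicate_add j, List.replicate_add 1]
        simp
      rw [this]
      simp
    have h2 := h.iterate_mem_box hc k hx hw'
    have h3 := hc.boxSeparator_box h2
    rw [List.length_append, List.length_append, List.length_replicate, List.length_replicate,
      ← add_assoc, ← add_assoc] at h3
    exact h3

/-- The fixed point in the first box. -/
def p₀ (c : Rates) : E4 :=
  !₂[-(1 / (1 - c.cu0⁻¹)), -(1 / (1 - c.u⁻¹)), -(1 / (1 - c.s)), -(1 / (1 - c.cs0))]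

lemma abs_replicate_false_sub_le {r v : Bool → ℝ} {p : ℝ} (h0 : 0 < r false)
    (h1 : r false ≤ 1 / 2) (hp : r false * p + v false = p) (n : ℕ) (x : ℝ) :
    |wordMap r v (List.replicate n false) x - p| ≤ (1 / 2) ^ n * |x - p| := by
  induction n with
  | zero => simp [wordMap]
  | succ n ih =>
    rw [List.replicate_succ, wordMap]
    have h2 : r false * wordMap r v (List.replicate n false) x + v false - p
        = r false * (wordMap r v (List.replicate n false) x - p) := by linear_combination hp
    rw [h2, abs_mul, abs_of_pos h0, pow_succ, mul_comm (_ ^ n), mul_assoc]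
    exact mul_le_mul h1 ih (abs_nonneg _) (by norm_num)

/-- In the middle of a long run of zeros the orbit is close to the fixed point. -/
lemma Admissible.dist_start_p₀_le (hc : c.Admissible) (N : ℕ) (w₁ w₂ : List Bool)
    {z₀ z₁ x₂ x₃ : ℝ} (h₀ : z₀ ∈ Icc (-2 : ℝ) 2) (h₁ : z₁ ∈ Icc (-2 : ℝ) 2)
    (h₂ : x₂ ∈ Icc (-2 : ℝ) 2) (h₃ : x₃ ∈ Icc (-2 : ℝ) 2) :
    dist (c.start (List.replicate N false ++ w₂) z₀ z₁
      (signMap c.s (List.replicate N false ++ w₁) x₂)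
      (pairMap c.cs0 c.cs1 (List.replicate N false ++ w₁) x₃)) c.p₀ ≤ 16 * (1 / 2) ^ N := by
  have hF := hc.future
  have hP := hc.past
  have bound : ∀ y p : ℝ, y ∈ Icc (-2 : ℝ) 2 → 0 ≤ p → p < 2 →
      (1 / 2 : ℝ) ^ N * |y - -p| ≤ 4 * (1 / 2) ^ N := by
    intro y p hy hp hp2
    rw [mul_comm]
    refine mul_le_mul_of_nonneg_right ?_ (by positivity)
    rw [abs_le]; constructor <;> linarith [hy.1, hy.2]
  have e0 := (abs_replicate_false_sub_le (r := pairRate c.cu0⁻¹ c.cu1⁻¹)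
    (v := pairShift c.cu1⁻¹) (p := -(1 / (1 - c.cu0⁻¹))) (hF.pairRate_pos _) hF.lt_half.le
    (by simp only [pairRate, pairShift, cond_false]; linarith [hF.end_mul]) N
    (pairMap c.cu0⁻¹ c.cu1⁻¹ w₂ z₀)).trans (bound _ _ (wordMap_mem_Icc hF.pair_mem_two _ h₀)
      (by linarith [hF.one_lt_end]) hF.end_lt_two)
  have e1 := (abs_replicate_false_sub_le (r := fun _ => c.u⁻¹)
    (v := signShift) (p := -(1 / (1 - c.u⁻¹))) hF.t_pos (hF.t_lt.trans hF.lt_half).le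
    (by simp only [signShift, cond_false]; linarith [hF.sign_end_mul]) N
    (signMap c.u⁻¹ w₂ z₁)).trans (bound _ _ (wordMap_mem_Icc hF.sign_mem_two _ h₁)
      (by linarith [hF.one_lt_sign_end]) hF.sign_end_lt_two)
  have e2 := (abs_replicate_false_sub_le (r := fun _ => c.s)
    (v := signShift) (p := -(1 / (1 - c.s))) hP.t_pos (hP.t_lt.trans hP.lt_half).le
    (by simp only [signShift, cond_false]; linarith [hP.sign_end_mul]) N
    (signMap c.s w₁ x₂)).trans (bound _ _ (wordMap_mem_Icc hP.sign_mem_two _ h₂)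
      (by linarith [hP.one_lt_sign_end]) hP.sign_end_lt_two)
  have e3 := (abs_replicate_false_sub_le (r := pairRate c.cs0 c.cs1)
    (v := pairShift c.cs1) (p := -(1 / (1 - c.cs0))) (hP.pairRate_pos _) hP.lt_half.le
    (by simp only [pairRate, pairShift, cond_false]; linarith [hP.end_mul]) N
    (pairMap c.cs0 c.cs1 w₁ x₃)).trans (bound _ _ (wordMap_mem_Icc hP.pair_mem_two _ h₃)
      (by linarith [hP.one_lt_end]) hP.end_lt_two)
  simp only [pairMap, signMap] at e0 e1 e2 e3
  rw [← wordMap_append] at e0 e1 e2 e3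
  refine (E4.dist_le _ _).trans ?_
  have := add_le_add (add_le_add (add_le_add e0 e1) e2) e3
  refine le_trans this (le_of_eq ?_)
  ring

/-- Words with long runs of zeros give physical behavior. -/
theorem IsRoute.tendsto_empirical (h : c.IsRoute f l m a₁ a₂ δ w ε η) (hc : c.Admissible)
    {φ ψ : ℕ → List Bool} {a : ℕ → ℕ} {C : ℝ} (ha : Tendsto a atTop atTop)
    (hw : ∀ k, w (k + 1) = φ k ++ List.replicate (a k) false ++ ψ k)
    (hT : ∀ k, 0 < k → (routeTime w (k + 1) : ℝ) ≤ C * routeTime w k)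
    (hratio : ∀ e : ℝ, 0 < e → ∀ᶠ k in atTop,
      (((φ k).length + (ψ k).length + 1 : ℕ) : ℝ) ≤ e * a k)
    {x : E4} (hx : x ∈ c.routeDomain w ε η) :
    Tendsto (empirical f x) atTop
      (𝓝 (⟨Measure.dirac c.p₀, inferInstance⟩ : ProbabilityMeasure E4)) := by
  refine ProbabilityMeasure.tendsto_iff_forall_integral_tendsto.2 fun g => ?_
  have hd : ∫ y, g y ∂((⟨Measure.dirac c.p₀, inferInstance⟩ : ProbabilityMeasure E4) : Measure E4)
      = g c.p₀ := integral_dirac' _ _ g.continuous.measurable.stronglyMeasurable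
  refine Eq.subst (motive := fun v => Tendsto _ atTop (𝓝 v)) hd.symm ?_
  refine Tendsto.congr (fun n => (integral_empirical f x n g).symm) ?_
  set b : ℕ → ℝ := fun i => |g (f^[i] x) - g c.p₀| with hb
  have hbB : ∀ i, b i ≤ 2 * ‖g‖ := fun i => by
    have := g.dist_le_two_norm (f^[i] x) c.p₀
    rwa [Real.dist_eq] at this
  have hmain : Tendsto (fun n : ℕ => ((n : ℝ) + 1)⁻¹ * ∑ i ∈ Finset.range (n + 1), b i)
      atTop (𝓝 0) := by
    refine tendsto_average_zero_of_blocks (fun i => abs_nonneg _) (T := routeTime w) rfl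
      time_strictMono hT ?_
    intro e he
    obtain ⟨ρ, hρ, hg⟩ := Metric.continuousAt_iff.1 (g.continuous.continuousAt (x := c.p₀))
      (e / 2) (by positivity)
    obtain ⟨N, hN⟩ := exists_pow_lt_of_lt_one (show 0 < ρ / 16 by positivity)
      (show (1 / 2 : ℝ) < 1 by norm_num)
    have hB : 0 ≤ 2 * ‖g‖ := by positivity
    filter_upwards [hratio (e / (4 * (2 * ‖g‖ + 1))) (by positivity),
      ha.eventually_ge_atTop (2 * N + ⌈4 * (2 * ‖g‖) * (2 * N) / e⌉₊)] with k hk1 hk2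
    have hk3 : 2 * ‖g‖ * (2 * N) ≤ e / 4 * a k := by
      have h1 : 4 * (2 * ‖g‖) * (2 * N) / e ≤ a k := by
        exact (Nat.le_ceil _).trans (Nat.cast_le.2 (by omega))
      rw [div_le_iff₀ he] at h1
      linarith
    set t := routeTime w k
    -- At times between `n₁` and `n₂`, at least `N` zeros lie behind, which brings the stable
    -- coordinates close to those of `p₀`, and at least `N` zeros lie ahead, which does the same for
    -- the unstable ones. The remaining times are few and are estimated by `2 * ‖g‖`.
    set n₁ := t + 1 + (φ k).length + N with hn₁
    set n₂ := t + 1 + (φ k).length + (a k - N) with hn₂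
    have hlen : routeTime w (k + 1) = t + 1 + ((φ k).length + a k + (ψ k).length) := by
      rw [routeTime, hw]; simp [t, add_assoc]
    have hsum : ∀ p q : ℕ, p ≤ q → ∀ B : ℝ, (∀ i, p ≤ i → i < q → b i ≤ B) →
        ∑ i ∈ Finset.Ico p q, b i ≤ ((q - p : ℕ) : ℝ) * B := by
      intro p q _ B hB
      have := Finset.sum_le_card_nsmul (Finset.Ico p q) b B fun i hi =>
        hB i (Finset.mem_Ico.1 hi).1 (Finset.mem_Ico.1 hi).2
      rwa [Nat.card_Ico, nsmul_eq_mul] at this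
    have s1 := hsum t n₁ (by omega) _ fun i _ _ => hbB i
    have s3 := hsum n₂ (routeTime w (k + 1)) (by omega) _ fun i _ _ => hbB i
    have s2 := hsum n₁ n₂ (by omega) (e / 2) (by
      intro i hi1 hi2
      obtain ⟨j, rfl⟩ := Nat.exists_eq_add_of_le hi1
      obtain ⟨z₀, z₁, x₂, x₃, -, -, -, -, k0, k1, k2, k3, hor⟩ := h.exists_orbit hc k hx
      have hsplit : w (k + 1) = (φ k ++ List.replicate j false ++ List.replicate N false) ++
          (List.replicate N false ++ (List.replicate (a k - N - j - N) false ++ ψ k)) := by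
        rw [hw]
        have : a k = j + (N + (N + (a k - N - j - N))) := by omega
        conv_lhs => rw [this, List.replicate_add j, List.replicate_add N, List.replicate_add N]
        simp only [List.append_assoc]
      have hor' := hor _ _ hsplit
      have hd := hc.dist_start_p₀_le N (φ k ++ List.replicate j false).reverse
        (List.replicate (a k - N - j - N) false ++ ψ k) k0 k1 k2 k3
      have hrev : (φ k ++ List.replicate j false ++ List.replicate N false).reverse =
          List.replicate N false ++ (φ k ++ List.replicate j false).reverse := by
        rw [List.reverse_append, List.reverse_replicate]
      rw [← hrev, ← hor'] at hd
      have hidx : t + 1 + (φ k ++ List.replicate j false ++ List.replicate N false).length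
          = n₁ + j := by
        simp only [List.length_append, List.length_replicate]; omega
      rw [hidx] at hd
      have := hg (hd.trans_lt (by linarith))
      rw [Real.dist_eq] at this
      exact this.le)
    rw [← Finset.sum_Ico_consecutive b (show t ≤ n₁ by omega)
        (show n₁ ≤ routeTime w (k + 1) by omega),
      ← Finset.sum_Ico_consecutive b (show n₁ ≤ n₂ by omega)
        (show n₂ ≤ routeTime w (k + 1) by omega)]
    have c1 : ((n₁ - t : ℕ) : ℝ) + ((routeTime w (k + 1) - n₂ : ℕ) : ℝ)
        = (((φ k).length + (ψ k).length + 1 : ℕ) : ℝ) + 2 * N := by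
      have : n₁ - t + (routeTime w (k + 1) - n₂)
        = (φ k).length + (ψ k).length + 1 + 2 * N := by omega
      exact_mod_cast this
    have c2 : ((n₂ - n₁ : ℕ) : ℝ) ≤ a k := by exact_mod_cast (by omega)
    have c3 : (a k : ℝ) ≤ (routeTime w (k + 1) : ℝ) - t := by
      rw [hlen]; push_cast
      have : (0 : ℝ) ≤ 1 + (φ k).length + (ψ k).length := by positivity
      linarith
    have c4 : 2 * ‖g‖ * (((φ k).length + (ψ k).length + 1 : ℕ) : ℝ) ≤ e / 4 * a k := by
      refine (mul_le_mul_of_nonneg_left hk1 hB).trans ?_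
      have : 2 * ‖g‖ * (e / (4 * (2 * ‖g‖ + 1)) * a k)
          = (2 * ‖g‖ / (2 * ‖g‖ + 1)) * (e / 4 * a k) := by field_simp
      rw [this]
      refine mul_le_of_le_one_left (by positivity) ?_
      rw [div_le_one (by positivity)]
      linarith
    have c5 := mul_le_mul_of_nonneg_right c2 (show 0 ≤ e / 2 by positivity)
    have c6 := mul_le_mul_of_nonneg_left c3 he.le
    have c7 := congrArg (fun y => 2 * ‖g‖ * y) c1
    simp only [mul_add] at c7
    linarith
  rw [tendsto_iff_dist_tendsto_zero]
  refine squeeze_zero (fun _ => dist_nonneg) (fun n => ?_) hmain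
  rw [Real.dist_eq]
  have hn : (0 : ℝ) < (n : ℝ) + 1 := by positivity
  have h1 : ((n : ℝ) + 1)⁻¹ * ∑ i ∈ Finset.range (n + 1), g (f^[i] x) - g c.p₀
      = ((n : ℝ) + 1)⁻¹ * ∑ i ∈ Finset.range (n + 1), (g (f^[i] x) - g c.p₀) := by
    rw [Finset.sum_sub_distrib, Finset.sum_const, Finset.card_range, nsmul_eq_mul]
    push_cast
    field_simp
  rw [h1, abs_mul, abs_of_pos (inv_pos.2 hn)]
  exact mul_le_mul_of_nonneg_left (Finset.abs_sum_le_sum_abs _ _) (inv_nonneg.2 hn.le)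

end Rates

/-! ### Growth of the words -/

/-- For constant `E` and without the linear term, the last two inequalities read `3 ≤ 4` and `3 ≤ κ
+ 2`. Both are strict, so there is room for a growth rate `1 + ι` slightly above one; a large
initial value makes the linear term at most `ι * E k`. -/
lemma exists_growth {κ N : ℝ} (hκ : 1 < κ) (hN : 0 < N) :
    ∃ (ρ : ℝ) (E : ℕ → ℝ), 1 < ρ ∧ ρ ≤ 2 ∧ (∀ k, E k = E 0 * ρ ^ k) ∧
      (∀ k : ℕ, N * (k + 1) ≤ E k) ∧ (∀ k : ℕ, 3 * E (k + 1) + N * (k + 1) ≤ 4 * E k) ∧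
      ∀ k : ℕ, 3 * E (k + 1) + N * (k + 1) ≤ κ * E k + 2 * E k / ρ := by
  set ι := min (1 / 12) ((κ - 1) / 6) with hι
  have hι0 : 0 < ι := lt_min (by norm_num) (by linarith)
  have hι1 : ι ≤ 1 / 12 := min_le_left _ _
  have hι2 : ι ≤ (κ - 1) / 6 := min_le_right _ _
  have hbern : ∀ k : ℕ, ι * (k + 1) ≤ (1 + ι) ^ k := by
    intro k
    have := one_add_mul_le_pow (show -2 ≤ ι by linarith) k
    nlinarith
  have hE : ∀ k : ℕ, N * (k + 1) ≤ ι * (N / ι ^ 2 * (1 + ι) ^ k) := by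
    intro k
    have h1 : ι * (N / ι ^ 2 * (1 + ι) ^ k) = N / ι * (1 + ι) ^ k := by field_simp
    rw [h1]
    calc N * (k + 1) = N / ι * (ι * (k + 1)) := by field_simp
      _ ≤ _ := mul_le_mul_of_nonneg_left (hbern k) (by positivity)
  refine ⟨1 + ι, fun k => N / ι ^ 2 * (1 + ι) ^ k, by linarith, by linarith, fun k => by simp,
    fun k => ?_, fun k => ?_, fun k => ?_⟩
  all_goals
    have h1 := hE k
    have h2 : 0 < N / ι ^ 2 * (1 + ι) ^ k := by positivity
    set X := N / ι ^ 2 * (1 + ι) ^ k with hX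
  · nlinarith
  · have h3 : N / ι ^ 2 * (1 + ι) ^ (k + 1) = X * (1 + ι) := by rw [hX]; ring
    simp only [h3]
    nlinarith
  · have h3 : N / ι ^ 2 * (1 + ι) ^ (k + 1) = X * (1 + ι) := by rw [hX]; ring
    simp only [h3]
    have h4 : 2 * X * (1 - ι) ≤ 2 * X / (1 + ι) := by
      rw [le_div_iff₀ (by linarith)]
      nlinarith [mul_nonneg h2.le (sq_nonneg ι)]
    nlinarith

/-- The words joining consecutive junctions: the future part of a junction, a run of equal digits,
a run of zeros, and the past part of the next junction. -/
def routeWord (e f : ℕ → List Bool) (a : ℕ → ℕ) (b : Bool) : ℕ → List Bool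
  | 0 => (e 0).reverse
  | k + 1 => f k ++ List.replicate (a k) b ++ List.replicate (a k) false ++ (e (k + 1)).reverse

/-! ### Choice of run lengths and box sizes -/

namespace Rates

variable {c : Rates}

/-- The exponent `κ` compares the contraction along one digit of each kind with the strongest
expansion along two digits; `cs0 * cs1 * u ^ 2 < 1` says exactly that it exceeds one. -/
lemma Admissible.exists_kappa (hc : c.Admissible) :
    ∃ κ : ℝ, 1 < κ ∧ c.cs0 * c.cs1 = c.u ^ (-2 * κ) := by
  have hu := hc.u_pos
  have h0 : 0 < c.cs0 * c.cs1 := mul_pos hc.past.pos (by linarith [hc.half_lt_cs1])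
  have hlog : 0 < Real.log c.u := Real.log_pos (by linarith [hc.u_gt])
  refine ⟨-(Real.log (c.cs0 * c.cs1) / Real.log c.u) / 2, ?_, ?_⟩
  · have h1 := Real.log_neg (by positivity) hc.contraction
    rw [Real.log_mul h0.ne' (by positivity), Real.log_pow] at h1
    rw [lt_div_iff₀ two_pos, one_mul, ← neg_div, lt_div_iff₀ hlog]
    push_cast at h1
    linarith
  · rw [Real.rpow_def_of_pos hu]
    have : Real.log c.u * (-2 * (-(Real.log (c.cs0 * c.cs1) / Real.log c.u) / 2))
        = Real.log (c.cs0 * c.cs1) := by field_simp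
    rw [this, Real.exp_log h0]

/-- Only the two runs are counted. A digit of the first run has slope at most `cs1` whatever `b` is,
so the bound holds for both kinds of routes. -/
lemma Admissible.wordRate_routeWord_le (hc : c.Admissible) (e f : ℕ → List Bool) (a : ℕ → ℕ)
    (b : Bool) (k : ℕ) :
    wordRate (pairRate c.cs0 c.cs1) (routeWord e f a b (k + 1)) ≤ (c.cs0 * c.cs1) ^ a k := by
  have hP := hc.past
  have hpos := hP.pairRate_pos
  have h1 : ∀ w, wordRate (pairRate c.cs0 c.cs1) w ≤ 1 := fun w =>
    wordRate_le_one hpos (fun d => (hP.pairRate_lt_one d).le) w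
  have hrep : ∀ (d : Bool) (n : ℕ), wordRate (pairRate c.cs0 c.cs1) (List.replicate n d)
      = pairRate c.cs0 c.cs1 d ^ n := by
    intro d n
    induction n with
    | zero => rfl
    | succ n ih => rw [List.replicate_succ, wordRate, ih, pow_succ, mul_comm]
  rw [routeWord, wordRate_append, wordRate_append, wordRate_append, hrep, hrep, mul_pow]
  have h2 : pairRate c.cs0 c.cs1 b ^ a k ≤ c.cs1 ^ a k :=
    pow_le_pow_left₀ (hpos b).le (hP.pairRate_le b) _
  have h3 : pairRate c.cs0 c.cs1 false ^ a k = c.cs0 ^ a k := rfl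
  have hc0 : 0 < c.cs0 ^ a k := pow_pos hP.pos _
  have hc1 : 0 < c.cs1 ^ a k := pow_pos (by linarith [hc.half_lt_cs1]) _
  rw [h3]
  have h4 := h1 (f k)
  have h5 := h1 (e (k + 1)).reverse
  have p4 := wordRate_pos hpos (f k)
  have p5 := wordRate_pos hpos (e (k + 1)).reverse
  have p2 : 0 < pairRate c.cs0 c.cs1 b ^ a k := pow_pos (hpos b) _
  calc _ ≤ 1 * c.cs1 ^ a k * c.cs0 ^ a k * 1 := by gcongr
    _ = _ := by ring

set_option maxHeartbeats 1000000 in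
/-- Long runs can be chosen, growing geometrically, so that the boxes fit. -/
theorem Admissible.exists_sizes (hc : c.Admissible) (e f : ℕ → List Bool) (b : Bool) (N : ℕ)
    (hN : ∀ k, (e k).length + (f k).length ≤ N * (k + 1)) {M : ℝ} (hM : 1 ≤ M) :
    ∃ (a : ℕ → ℕ) (ε η : ℕ → ℝ), (∀ k, 0 < ε k) ∧ (∀ k, 0 < η k) ∧
      (∀ k, M * c.u ^ (N * (k + 1)) * ε k ≤ 1) ∧ (∀ k, M * c.u ^ (N * (k + 1)) * η k ≤ 1) ∧
      (∀ k, c.u ^ (routeWord e f a b (k + 1)).length * (M * (ε k ^ 2 + η k)) ≤ ε (k + 1)) ∧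
      (∀ k, wordRate (pairRate c.cs0 c.cs1) (routeWord e f a b (k + 1)) * (M * ε k) ≤ η (k + 1)) ∧
      Tendsto ε atTop (𝓝 0) ∧ Tendsto η atTop (𝓝 0) ∧ (∀ k, 0 < a k) ∧ Tendsto a atTop atTop ∧
      (∃ C : ℝ, 0 < C ∧ (∀ k, (routeTime (routeWord e f a b) (k + 1) : ℝ) ≤ C * a k) ∧
        ∀ k, 0 < k → (routeTime (routeWord e f a b) (k + 1) : ℝ)
          ≤ C * routeTime (routeWord e f a b) k) ∧
      ∀ t : ℝ, 0 < t → ∀ᶠ k in atTop,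
        (((f k).length + (e (k + 1)).reverse.length + 1 : ℕ) : ℝ) ≤ t * a k := by
  obtain ⟨κ, hκ, hκeq⟩ := hc.exists_kappa
  have hu := hc.u_pos
  have hu1 : 1 ≤ c.u := by linarith [hc.u_gt]
  -- Constants are absorbed into `u ^ K`. The linear term `(3 * N + 3 + K) * (k + 1)` below then
  -- covers the words `f k` and `e (k + 1)`, the rounding of `a k` and this exponent.
  obtain ⟨K, hK⟩ := pow_unbounded_of_one_lt (2 * M ^ 2) (show 1 < c.u by linarith [hc.u_gt])
  obtain ⟨ρ, E, hρ, hρ2, hE0, hE1, hE2, hE3⟩ :=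
    exists_growth (κ := κ) (N := 3 * N + 3 + K) hκ (by positivity)
  have hEs : ∀ k, E (k + 1) = ρ * E k := fun k => by rw [hE0, hE0 k]; ring
  have hNk : ∀ k : ℕ, (0 : ℝ) ≤ N * (k + 1) := fun k => by positivity
  have hKk : ∀ k : ℕ, (K : ℝ) ≤ K * (k + 1) := fun k => by
    have : (0 : ℝ) ≤ K * k := by positivity
    linarith
  have hEk : ∀ k : ℕ, (k : ℝ) + 1 ≤ E k ∧ N * ((k : ℝ) + 1) + K ≤ E k ∧
      3 * N * ((k : ℝ) + 1) + 3 * (k + 1) ≤ E k := by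
    intro k
    have h1 := hE1 k
    have h2 := hNk k
    have h3 := hKk k
    have h4 : (0 : ℝ) ≤ k := Nat.cast_nonneg k
    refine ⟨by nlinarith, by nlinarith, by nlinarith⟩
  have hEpos : ∀ k, 0 < E k := fun k => by
    have := (hEk k).1
    have h4 : (0 : ℝ) ≤ k := Nat.cast_nonneg k
    linarith
  set a : ℕ → ℕ := fun k => ⌈E (k + 1) / 2⌉₊ with ha
  have ha1 : ∀ k, E (k + 1) ≤ 2 * a k := fun k => by
    have := Nat.le_ceil (E (k + 1) / 2)
    simp only [ha]; linarith
  have ha2 : ∀ k, 2 * (a k : ℝ) ≤ E (k + 1) + 2 := fun k => by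
    have := Nat.ceil_lt_add_one (show 0 ≤ E (k + 1) / 2 by have := hEpos (k + 1); positivity)
    simp only [ha]; linarith
  -- The two runs have total length about `E (k + 1)`. The size `η (k + 1)` is defined as `M * u ^
  -- (-κ * E (k + 1)) * ε k`, the contraction bound applied to the previous unstable size, with `E
  -- k` written as `E (k + 1) / ρ`.
  set ε : ℕ → ℝ := fun k => c.u ^ (-2 * E k) with hε
  set η : ℕ → ℝ := fun k => M * c.u ^ (-κ * E k - 2 * E k / ρ) with hη
  have hM0 : 0 < M := by linarith
  have hMK : 2 * M ^ 2 ≤ c.u ^ (K : ℝ) := by rw [Real.rpow_natCast]; exact hK.le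
  have hMK1 : 2 * M ≤ c.u ^ (K : ℝ) := by nlinarith
  have hEtop : Tendsto E atTop atTop := by
    refine tendsto_atTop_mono (fun k => ?_) tendsto_natCast_atTop_atTop
    linarith [(hEk k).1]
  have hdiv : ∀ k, 0 ≤ 2 * E k / ρ := fun k => by have := hEpos k; positivity
  have hlen : ∀ k, ((routeWord e f a b (k + 1)).length : ℝ)
      ≤ E (k + 1) + (3 * N * ((k : ℝ) + 1) + 2) := by
    intro k
    have h1 : (f k).length ≤ N * (k + 1) := le_trans (Nat.le_add_left _ _) (hN k)
    have h2 : (e (k + 1)).length ≤ N * (k + 1 + 1) := le_trans (Nat.le_add_right _ _) (hN (k + 1))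
    have h1' : ((f k).length : ℝ) ≤ N * (k + 1) := by exact_mod_cast h1
    have h2' : ((e (k + 1)).length : ℝ) ≤ N * (k + 1 + 1) := by exact_mod_cast h2
    have h3 := ha2 k
    have h4 : (0 : ℝ) ≤ N * k := by positivity
    simp only [routeWord, List.length_append, List.length_replicate, List.length_reverse]
    push_cast
    nlinarith
  have hlen' : ∀ k, 2 * (a k : ℝ) ≤ ((routeWord e f a b (k + 1)).length : ℝ) := by
    intro k
    simp only [routeWord, List.length_append, List.length_replicate, List.length_reverse]
    push_cast
    have : (0 : ℝ) ≤ (f k).length + (e (k + 1)).length := by positivity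
    linarith
  -- Each word with its passage takes time at most `2 * E (k + 1)`, and the geometric series is
  -- dominated by its last term. The elapsed time is thus comparable to the current run.
  have hT1 : ∀ k, (routeTime (routeWord e f a b) k : ℝ) ≤ 2 * ρ / (ρ - 1) * E k := by
    intro k
    induction k with
    | zero =>
      have := hEpos 0
      have h1 : 0 < ρ - 1 := by linarith
      simp only [routeTime, Nat.cast_zero]
      positivity
    | succ k ih =>
      rw [routeTime]
      push_cast
      have h1 := hlen k
      have h2 := (hEk k).2.2
      have h3 := hEpos k
      have h5 : E k ≤ E (k + 1) := by rw [hEs]; nlinarith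
      have h4 : (0 : ℝ) ≤ k := Nat.cast_nonneg k
      have h6 : 2 * ρ / (ρ - 1) * E (k + 1) = 2 * ρ / (ρ - 1) * E k + 2 * E (k + 1) := by
        rw [hEs]
        have : ρ - 1 ≠ 0 := by linarith
        field_simp
        ring
      rw [h6]
      linarith
  have hρ1 : 0 < ρ - 1 := by linarith
  have haT : ∀ k, (routeTime (routeWord e f a b) (k + 1) : ℝ) ≤ 2 * ρ / (ρ - 1) * (2 * a k) :=
    fun k => (hT1 (k + 1)).trans (mul_le_mul_of_nonneg_left (ha1 k) (by positivity))
  refine ⟨a, ε, η, fun k => Real.rpow_pos_of_pos hu _,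
    fun k => mul_pos hM0 (Real.rpow_pos_of_pos hu _), ?_, ?_, ?_, ?_, ?_, ?_, ?_, ?_, ?_, ?_⟩
  · intro k
    have h1 : M ≤ c.u ^ (K : ℝ) := by linarith
    rw [← Real.rpow_natCast]
    calc M * c.u ^ ((N * (k + 1) : ℕ) : ℝ) * c.u ^ (-2 * E k)
        ≤ c.u ^ (K : ℝ) * c.u ^ ((N * (k + 1) : ℕ) : ℝ) * c.u ^ (-2 * E k) := by gcongr
      _ = c.u ^ ((K : ℝ) + ((N * (k + 1) : ℕ) : ℝ) + -2 * E k) := by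
          rw [Real.rpow_add hu, Real.rpow_add hu]
      _ ≤ 1 := by
          apply Real.rpow_le_one_of_one_le_of_nonpos hu1
          push_cast
          have := (hEk k).2.1
          have := hEpos k
          linarith
  · intro k
    rw [← Real.rpow_natCast]
    calc M * c.u ^ ((N * (k + 1) : ℕ) : ℝ) * (M * c.u ^ (-κ * E k - 2 * E k / ρ))
        = M ^ 2 * c.u ^ ((N * (k + 1) : ℕ) : ℝ) * c.u ^ (-κ * E k - 2 * E k / ρ) := by ring
      _ ≤ c.u ^ (K : ℝ) * c.u ^ ((N * (k + 1) : ℕ) : ℝ) * c.u ^ (-κ * E k - 2 * E k / ρ) := by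
          have : M ^ 2 ≤ c.u ^ (K : ℝ) := by nlinarith
          gcongr
      _ = c.u ^ ((K : ℝ) + ((N * (k + 1) : ℕ) : ℝ) + (-κ * E k - 2 * E k / ρ)) := by
          rw [Real.rpow_add hu, Real.rpow_add hu]
      _ ≤ 1 := by
          apply Real.rpow_le_one_of_one_le_of_nonpos hu1
          push_cast
          have := (hEk k).2.1
          have := hEpos k
          have := hdiv k
          nlinarith
  · intro k
    have hl := hlen k
    have h2 := hE2 k
    have h3 := hE3 k
    have hkK := hKk k
    have h4 : (0 : ℝ) ≤ k := Nat.cast_nonneg k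
    -- In exponents of `u`, up to the linear term: `E (k + 1) - 4 * E k ≤ -2 * E (k + 1)` for the
    -- quadratic part, and `E (k + 1) - κ * E k - 2 * E k / ρ ≤ -2 * E (k + 1)` for the part from
    -- `η`. These are the two inequalities of `exists_growth`.
    have e1 : c.u ^ (routeWord e f a b (k + 1)).length * (M * ε k ^ 2) ≤ ε (k + 1) / 2 := by
      rw [le_div_iff₀ two_pos, ← Real.rpow_natCast]
      have hsq : ε k ^ 2 = c.u ^ (-4 * E k) := by
        rw [hε, ← Real.rpow_natCast, ← Real.rpow_mul hu.le]; congr 1; push_cast; ring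
      rw [hsq]
      calc c.u ^ ((routeWord e f a b (k + 1)).length : ℝ) * (M * c.u ^ (-4 * E k)) * 2
          = 2 * M * c.u ^ ((routeWord e f a b (k + 1)).length : ℝ) * c.u ^ (-4 * E k) := by ring
        _ ≤ c.u ^ (K : ℝ) * c.u ^ ((routeWord e f a b (k + 1)).length : ℝ) * c.u ^ (-4 * E k) := by
            gcongr
        _ = c.u ^ ((K : ℝ) + ((routeWord e f a b (k + 1)).length : ℝ) + -4 * E k) := by
            rw [Real.rpow_add hu, Real.rpow_add hu]
        _ ≤ c.u ^ (-2 * E (k + 1)) := Real.rpow_le_rpow_of_exponent_le hu1 (by linarith)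
    have e2 : c.u ^ (routeWord e f a b (k + 1)).length * (M * η k) ≤ ε (k + 1) / 2 := by
      rw [le_div_iff₀ two_pos, ← Real.rpow_natCast]
      calc c.u ^ ((routeWord e f a b (k + 1)).length : ℝ)
            * (M * (M * c.u ^ (-κ * E k - 2 * E k / ρ))) * 2
          = 2 * M ^ 2 * c.u ^ ((routeWord e f a b (k + 1)).length : ℝ)
            * c.u ^ (-κ * E k - 2 * E k / ρ) := by ring
        _ ≤ c.u ^ (K : ℝ) * c.u ^ ((routeWord e f a b (k + 1)).length : ℝ)
            * c.u ^ (-κ * E k - 2 * E k / ρ) := by gcongr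
        _ = c.u ^ ((K : ℝ) + ((routeWord e f a b (k + 1)).length : ℝ)
            + (-κ * E k - 2 * E k / ρ)) := by
            rw [Real.rpow_add hu, Real.rpow_add hu]
        _ ≤ c.u ^ (-2 * E (k + 1)) := Real.rpow_le_rpow_of_exponent_le hu1 (by linarith)
    linarith
  · intro k
    have h1 := hc.wordRate_routeWord_le e f a b k
    have h2 : (c.cs0 * c.cs1) ^ a k ≤ c.u ^ (-κ * E (k + 1)) := by
      rw [hκeq, ← Real.rpow_natCast, ← Real.rpow_mul hu.le]
      apply Real.rpow_le_rpow_of_exponent_le hu1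
      nlinarith [ha1 k]
    have h3 : ε k = c.u ^ (-(2 * E (k + 1) / ρ)) := by
      rw [hε, hEs]
      have : ρ ≠ 0 := by linarith
      field_simp
    rw [h3]
    have h4 : η (k + 1) = c.u ^ (-κ * E (k + 1)) * (M * c.u ^ (-(2 * E (k + 1) / ρ))) := by
      rw [hη]
      simp only
      rw [sub_eq_add_neg, Real.rpow_add hu]; ring
    rw [h4]
    exact mul_le_mul_of_nonneg_right (h1.trans h2)
      (mul_nonneg hM0.le (Real.rpow_pos_of_pos hu _).le)
  · exact (tendsto_rpow_atBot_of_base_gt_one c.u (by linarith [hc.u_gt])).comp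
      (hEtop.const_mul_atTop_of_neg (by norm_num))
  · rw [show (0 : ℝ) = M * 0 by ring]
    refine Tendsto.const_mul M ?_
    refine (tendsto_rpow_atBot_of_base_gt_one c.u (by linarith [hc.u_gt])).comp ?_
    refine tendsto_atBot_mono (fun k => ?_)
      (hEtop.const_mul_atTop_of_neg (show -κ < 0 by linarith))
    linarith [hdiv k]
  · intro k
    have h1 := ha1 k
    have h2 := hEpos (k + 1)
    have : (0 : ℝ) < a k := by linarith
    exact_mod_cast this
  · have h1 : Tendsto (fun k => (a k : ℝ)) atTop atTop := by
      refine tendsto_atTop_mono (fun k => ?_)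
        (((tendsto_add_atTop_iff_nat 1).2 hEtop).atTop_div_const two_pos)
      linarith [ha1 k]
    exact tendsto_natCast_atTop_iff.1 h1
  · refine ⟨2 * ρ / (ρ - 1) * 2, by positivity, fun k => ?_, fun k hk => ?_⟩
    · linarith [haT k]
    · obtain ⟨j, rfl⟩ := Nat.exists_eq_succ_of_ne_zero hk.ne'
      refine (hT1 _).trans ?_
      rw [mul_assoc]
      refine mul_le_mul_of_nonneg_left ?_ (by positivity)
      rw [Nat.succ_eq_add_one, hEs]
      have h1 : E (j + 1) ≤ routeTime (routeWord e f a b) (j + 1) := by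
        rw [routeTime]; push_cast
        have h2 := hlen' j
        have h3 := ha1 j
        have : (0 : ℝ) ≤ routeTime (routeWord e f a b) j := Nat.cast_nonneg _
        linarith
      have := hEpos (j + 1)
      nlinarith
  · intro t ht
    -- The junction words grow linearly and the runs exponentially.
    have hlim : Tendsto (fun k : ℕ => (3 * N + 3 : ℝ) * ((k : ℝ) ^ 1 / ρ ^ k)) atTop (𝓝 0) := by
      simpa using (tendsto_pow_const_div_const_pow_of_one_lt 1 hρ).const_mul (3 * N + 3 : ℝ)
    have hlim' := (tendsto_add_atTop_iff_nat 1).2 hlim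
    filter_upwards [hlim'.eventually_lt_const (show 0 < t / 2 * E 0 by
      have := hEpos 0; positivity)] with k hk
    have h1 : (f k).length ≤ N * (k + 1) := le_trans (Nat.le_add_left _ _) (hN k)
    have h2 : (e (k + 1)).length ≤ N * (k + 1 + 1) := le_trans (Nat.le_add_right _ _) (hN (k + 1))
    have h1' : ((f k).length : ℝ) ≤ N * (k + 1) := by exact_mod_cast h1
    have h2' : ((e (k + 1)).length : ℝ) ≤ N * (k + 1 + 1) := by exact_mod_cast h2
    have h3 := ha1 k
    rw [hE0] at h3
    have hρk : 0 < ρ ^ (k + 1) := by positivity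
    rw [pow_one, mul_div_assoc', div_lt_iff₀ hρk] at hk
    have h4 : (0 : ℝ) ≤ N * k := by positivity
    have h6 : (0 : ℝ) ≤ k := Nat.cast_nonneg k
    have h5 : t / 2 * (E 0 * ρ ^ (k + 1)) ≤ t / 2 * (2 * a k) :=
      mul_le_mul_of_nonneg_left h3 (by positivity)
    rw [List.length_reverse]
    push_cast at hk ⊢
    nlinarith

end Rates

/-! ### Perturbations with prescribed routes -/

lemma exists_linear_rate {β q X Y : ℝ} (hβ0 : 0 < β) (hβ1 : β < 1) (hq : 0 < q) (hX : 0 < X)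
    (hY : 0 < Y) : ∃ n₀ : ℕ, ∀ k n : ℕ, n₀ * (k + 1) ≤ n → Y * β ^ n ≤ X * q ^ (k + 1) := by
  obtain ⟨n₀, hn₀⟩ := exists_pow_lt_of_lt_one (show 0 < min 1 (X / Y) * q by positivity) hβ1
  refine ⟨n₀, fun k n hn => ?_⟩
  have h1 : β ^ n ≤ (β ^ n₀) ^ (k + 1) := by
    rw [← pow_mul]; exact pow_le_pow_of_le_one hβ0.le hβ1.le hn
  have h2 : (β ^ n₀) ^ (k + 1) ≤ (min 1 (X / Y) * q) ^ (k + 1) :=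
    pow_le_pow_left₀ (by positivity) hn₀.le _
  have hm0 : 0 < min 1 (X / Y) := by positivity
  have h3 : min 1 (X / Y) ^ (k + 1) ≤ X / Y := by
    rw [pow_succ]
    exact (mul_le_of_le_one_left hm0.le (pow_le_one₀ hm0.le (min_le_left _ _))).trans
      (min_le_right _ _)
  rw [mul_pow] at h2
  have h4 := h1.trans (h2.trans (mul_le_mul_of_nonneg_right h3 (by positivity)))
  rw [div_mul_eq_mul_div, le_div_iff₀ hY] at h4
  linarith

namespace Rates

variable {c : Rates}

/-- The data of a route with long runs. -/
def HasLongRuns (w : ℕ → List Bool) (b : Bool) : Prop :=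
  ∃ (φ ψ : ℕ → List Bool) (a : ℕ → ℕ) (C : ℝ), 0 < C ∧ (∀ k, 0 < a k) ∧ Tendsto a atTop atTop ∧
    (∀ k, w (k + 1) = φ k ++ List.replicate (a k) b ++ List.replicate (a k) false ++ ψ k) ∧
    (∀ k, (routeTime w (k + 1) : ℝ) ≤ C * a k) ∧
    (∀ k, 0 < k → (routeTime w (k + 1) : ℝ) ≤ C * routeTime w k) ∧
    ∀ t : ℝ, 0 < t → ∀ᶠ k in atTop, (((φ k).length + (ψ k).length + 1 : ℕ) : ℝ) ≤ t * a k

set_option maxHeartbeats 2000000 in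
/-- Arbitrarily small perturbations of the model map have routes with long runs. -/
theorem Admissible.exists_perturbed_route (hc : c.Admissible) :
    ∃ L : ℝ, 0 < L ∧ ∀ lst mst δ a₁ a₂ : ℝ, L ≤ lst → L ≤ mst → 0 < δ → δ < 1 - 2 * c.u⁻¹ →
      0 ≤ a₁ → 0 ≤ a₂ → ∀ r : ℕ, 1 ≤ r → ∀ F : E4 → E4, IsModelMap c lst mst δ a₁ a₂ F →
      ∀ ξ₀ : ℝ, 0 < ξ₀ → ∀ b : Bool, ∃ h : E4 → E4, ContDiff ℝ r h ∧
        (∀ x ∉ tangencyBox δ, h x = 0) ∧ (∀ i ≤ r, ∀ x, ‖iteratedFDeriv ℝ i h x‖ ≤ ξ₀) ∧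
        ∃ (w : ℕ → List Bool) (ε η : ℕ → ℝ),
          c.IsRoute (fun x => F x + h x) lst⁻¹ mst a₁ a₂ δ w ε η ∧ HasLongRuns w b := by
  have hF := hc.future
  have hP := hc.past
  obtain ⟨L, hL1, hL⟩ := exists_junctions hF hP
  refine ⟨L, by linarith, ?_⟩
  intro lst mst δ a₁ a₂ hlst hmst hδ hδu ha₁ ha₂ r hr F hmodel ξ₀ hξ₀ b
  have hlst0 : 0 < lst := by linarith
  have hmst0 : 0 < mst := by linarith
  have hmst1 : 1 ≤ mst := by linarith
  have hu := hc.u_pos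
  have hu1 : 1 < c.u := by linarith [hc.u_gt]
  set as := 1 / (1 - c.s) with has
  set au := 1 / (1 - c.u⁻¹) with hau
  have has1 : 1 < as := hP.one_lt_sign_end
  have has2 : as < 2 := hP.sign_end_lt_two
  have hau1 : 1 < au := hF.one_lt_sign_end
  have hau2 : au < 2 := hF.sign_end_lt_two
  -- the bump around the tangency
  set zc : E4 := !₂[0, 0, as, 1] with hzc
  set ρ := min δ (2 - as) / 4 with hρ
  have hδ1 : δ < 1 := by have := inv_pos.2 hu; linarith
  have hρ0 : 0 < ρ := by have : 0 < min δ (2 - as) := lt_min hδ (by linarith); positivity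
  have hρδ : 4 * ρ ≤ δ := by have := min_le_left δ (2 - as); linarith
  have hρs : 4 * ρ ≤ 2 - as := by have := min_le_right δ (2 - as); linarith
  have hball : ∀ x : E4, dist x zc ≤ 4 * ρ → x ∈ tangencyBox δ := by
    intro x hx
    have h0 := abs_le.1 ((E4.abs_sub_apply_le x zc 0).trans hx)
    have h1 := abs_le.1 ((E4.abs_sub_apply_le x zc 1).trans hx)
    have h2 := abs_le.1 ((E4.abs_sub_apply_le x zc 2).trans hx)
    have h3 := abs_le.1 ((E4.abs_sub_apply_le x zc 3).trans hx)
    simp only [hzc, PiLp.toLp_apply, Matrix.cons_val] at h0 h1 h2 h3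
    exact ⟨⟨by linarith, by linarith⟩, ⟨by linarith, by linarith⟩,
      ⟨by linarith, by linarith⟩, ⟨by linarith, by linarith⟩⟩
  obtain ⟨χ, hχin, hχout⟩ : ∃ χ : ContDiffBump zc, χ.rIn = 2 * ρ ∧ χ.rOut = 4 * ρ :=
    ⟨⟨2 * ρ, 4 * ρ, by positivity, by linarith⟩, rfl, rfl⟩
  have hχc : ContDiff ℝ r χ := χ.contDiff
  obtain ⟨Cχ, hCχ, hCχb⟩ := exists_iteratedFDeriv_bound hχc χ.hasCompactSupport
  obtain ⟨Cb, hCb, hbump⟩ := exists_bump_sum (E := E4) r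
  set ξ := min (ρ / 2) (ξ₀ / (2 * Cχ * (1 + mst))) with hξ
  have hξ0 : 0 < ξ := by positivity
  obtain ⟨cc, dd, hcc, hdd, stem, C, hstem, hstemlen, hjunc⟩ :=
    hL lst⁻¹ mst⁻¹ (inv_pos.2 hlst0) (inv_pos.2 hmst0)
      ((inv_le_inv₀ hlst0 (by linarith)).2 hlst) ((inv_le_inv₀ hmst0 (by linarith)).2 hmst) ξ hξ0
  set ξ₁ := min 1 (ξ₀ / (2 * Cb)) with hξ₁
  have hξ₁0 : 0 < ξ₁ := by positivity
  have hξ₁1 : ξ₁ ≤ 1 := min_le_left _ _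
  -- By `signMap_separated`, codes parting after `stem i` differ by at least `2 * (2 - au) * u⁻¹ ^
  -- (stem i).length`, and the past relation scales this by `mst⁻¹`. A fifth leaves three radii `d
  -- i` after two corrections of at most one radius each.
  set c₀ := min (ρ / 2) (mst⁻¹ * (2 * (2 - au)) / 5) with hc₀
  have hmi : 0 < mst⁻¹ := inv_pos.2 hmst0
  have hc₀0 : 0 < c₀ := by
    have : 0 < 2 - au := by linarith
    positivity
  have hui : 0 < c.u⁻¹ := inv_pos.2 hu
  have hui1 : c.u⁻¹ < 1 := inv_lt_one_of_one_lt₀ hu1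
  set d : ℕ → ℝ := fun k => c₀ * (c.u⁻¹) ^ (stem k).length with hd
  have hd0 : ∀ k, 0 < d k := fun k => by positivity
  have hρ1 : ρ / 2 ≤ 1 / 8 := by linarith
  have hdc₀ : ∀ k, d k ≤ c₀ := fun k =>
    mul_le_of_le_one_right hc₀0.le (pow_le_one₀ hui.le hui1.le)
  have hdρ : ∀ k, d k ≤ ρ / 2 := fun k => (hdc₀ k).trans (min_le_left _ _)
  have hd1 : ∀ k, d k ≤ 1 := fun k => (hdρ k).trans (by linarith)
  have hdanti : ∀ i j, i < j → d j ≤ d i := by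
    intro i j hij
    refine mul_le_mul_of_nonneg_left (pow_le_pow_of_le_one hui.le hui1.le ?_) hc₀0.le
    have := (hstem i j hij).length_le
    rw [List.length_append] at this
    omega
  have hdlow : ∀ k, c₀ * (c.u⁻¹ ^ C) ^ (k + 1) ≤ d k := by
    intro k
    rw [← pow_mul]
    exact mul_le_mul_of_nonneg_left (pow_le_pow_of_le_one hui.le hui1.le (hstemlen k)) hc₀0.le
  -- the junctions
  set β := max c.cu1⁻¹ c.cs1 with hβ
  have hcu1i : 0 < c.cu1⁻¹ := inv_pos.2 hc.cu1_pos
  have hβ0 : 0 < β := lt_max_of_lt_left hcu1i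
  have hβ1 : β < 1 := max_lt hF.lt_one hP.lt_one
  -- Word lengths at least `n₀ * (k + 1)` push the error at the `k`-th junction below `ξ₁ * (1 / 2)
  -- ^ k * d k ^ r`. The radii decay at a fixed geometric rate, so for finite `r` a linear length
  -- suffices.
  obtain ⟨n₀, hn₀⟩ := exists_linear_rate (β := β) (q := 1 / 2 * (c.u⁻¹ ^ C) ^ r)
    (X := ξ₁ * c₀ ^ r) (Y := 3 + 3 * mst) hβ0 hβ1 (by positivity) (by positivity) (by positivity)
  choose e f hlink hle hlf hlen hpre hns hnp using fun k => hjunc (n₀ * (k + 1)) k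
  set N := C * (n₀ + 1) with hN
  have hlenN : ∀ k, (e k).length + (f k).length ≤ N * (k + 1) := by
    intro k
    refine (hlen k).trans (le_of_eq ?_)
    rw [hN]; ring
  set M := 1 + lst⁻¹ + a₁ + mst + a₂ + 4 / c₀ with hM
  have hlsti : 0 < lst⁻¹ := inv_pos.2 hlst0
  have h4c : 0 < 4 / c₀ := by positivity
  have hCN : ∀ k, C * (k + 1) ≤ N * (k + 1) := fun k => by
    rw [hN]; exact Nat.mul_le_mul_right _ (Nat.le_mul_of_pos_right _ (by omega))
  obtain ⟨a, ε, η, hε0, hη0, hεs, hηs, hexp, hcon, hεt, hηt, ha0, hat, ⟨CT, hCT, hT1, hT2⟩, hrat⟩ :=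
    hc.exists_sizes e f b N hlenN (M := M) (by linarith)
  set w := routeWord e f a b with hw
  have hI0 : ∀ {p : ℝ}, 1 < p → (0 : ℝ) ∈ Icc (-p) 1 := fun hp => ⟨by linarith, by linarith⟩
  have hS0 : ∀ {p : ℝ}, 1 < p → (0 : ℝ) ∈ Icc (-p) p := fun hp => ⟨by linarith, by linarith⟩
  -- the arrival points and the errors
  have hrev : ∀ k, ∃ v, (w k).reverse = e k ++ v := by
    intro k
    cases k with
    | zero => exact ⟨[], by simp [hw, routeWord]⟩
    | succ k => exact ⟨_, by rw [hw, routeWord, List.reverse_append, List.reverse_reverse]⟩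
  have hfwd : ∀ k, ∃ v, w (k + 1) = f k ++ v := fun k =>
    ⟨_, by rw [hw, routeWord, List.append_assoc, List.append_assoc]⟩
  choose vr hvr using hrev
  choose vf hvf using hfwd
  set X : ℕ → ℝ := fun k => (c.arrival (w k)).1 with hX
  set Y : ℕ → ℝ := fun k => (c.arrival (w k)).2 with hY
  set A : ℕ → ℝ := fun k => pairMap c.cu0⁻¹ c.cu1⁻¹ (w (k + 1)) 0 with hA
  set B : ℕ → ℝ := fun k => signMap c.u⁻¹ (w (k + 1)) 0 with hB
  have hXe : ∀ k, X k = signMap c.s (e k) (signMap c.s (vr k) 0) := fun k => by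
    simp only [hX, arrival, hvr, signMap, wordMap_append]
  have hYe : ∀ k, Y k = pairMap c.cs0 c.cs1 (e k) (pairMap c.cs0 c.cs1 (vr k) 0) := fun k => by
    simp only [hY, arrival, hvr, pairMap, wordMap_append]
  have hAe : ∀ k, A k = pairMap c.cu0⁻¹ c.cu1⁻¹ (f k) (pairMap c.cu0⁻¹ c.cu1⁻¹ (vf k) 0) :=
    fun k => by simp only [hA, hvf, pairMap, wordMap_append]
  have hBe : ∀ k, B k = signMap c.u⁻¹ (f k) (signMap c.u⁻¹ (vf k) 0) :=
    fun k => by simp only [hB, hvf, signMap, wordMap_append]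
  have mX : ∀ k, signMap c.s (vr k) 0 ∈ Icc (-as) as := fun k =>
    wordMap_mem_Icc hP.sign_mem _ (hS0 has1)
  have mY : ∀ k, pairMap c.cs0 c.cs1 (vr k) 0 ∈ Icc (-(1 / (1 - c.cs0))) 1 := fun k =>
    wordMap_mem_Icc hP.pair_mem _ (hI0 hP.one_lt_end)
  have mA : ∀ k, pairMap c.cu0⁻¹ c.cu1⁻¹ (vf k) 0 ∈ Icc (-(1 / (1 - c.cu0⁻¹))) 1 := fun k =>
    wordMap_mem_Icc hF.pair_mem _ (hI0 hF.one_lt_end)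
  have mB : ∀ k, signMap c.u⁻¹ (vf k) 0 ∈ Icc (-au) au := fun k =>
    wordMap_mem_Icc hF.sign_mem _ (hS0 hau1)
  -- What the shifted map lacks at the arrival point to hit the beginning of the next word. The
  -- second relation was stated for `Y` in terms of `B`; solving it for the new `y_u` brings in the
  -- factor `-mst`.
  set t₀ : ℕ → ℝ := fun k => A k - (lst⁻¹ * X k + (1 + cc - lst⁻¹ * as)) with ht₀
  set t₁ : ℕ → ℝ := fun k => -(mst * (Y k - (mst⁻¹ * B k + (1 + dd - mst⁻¹ * au)))) with ht₁
  have ht₀b : ∀ k, |t₀ k| ≤ 3 * β ^ (n₀ * (k + 1)) := by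
    intro k
    have h1 := (hlink k).future.error hF hP hlsti.le (mX k) (mA k)
    rw [← hXe, ← hAe] at h1
    refine h1.trans (mul_le_mul_of_nonneg_left ?_ (by norm_num))
    exact (pow_le_pow_left₀ hcu1i.le (le_max_left _ _) _).trans
      (pow_le_pow_of_le_one hβ0.le hβ1.le (hlf k))
  have hcs1 : 0 < c.cs1 := by linarith [hc.half_lt_cs1]
  have ht₁b : ∀ k, |t₁ k| ≤ 3 * mst * β ^ (n₀ * (k + 1)) := by
    intro k
    have h1 := (hlink k).past.error hP hF hmi.le (mB k) (mY k)
    rw [← hYe, ← hBe] at h1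
    simp only [ht₁]
    rw [abs_neg, abs_mul, abs_of_pos hmst0, mul_comm 3, mul_assoc]
    refine mul_le_mul_of_nonneg_left (h1.trans ?_) hmst0.le
    refine mul_le_mul_of_nonneg_left ?_ (by norm_num)
    exact (pow_le_pow_left₀ hcs1.le (le_max_right _ _) _).trans
      (pow_le_pow_of_le_one hβ0.le hβ1.le (hle k))
  have htb : ∀ k, |t₀ k| + |t₁ k| ≤ ξ₁ * (1 / 2) ^ k * d k ^ r := by
    intro k
    have h1 := hn₀ k (n₀ * (k + 1)) le_rfl
    have h2 : ξ₁ * c₀ ^ r * (1 / 2 * (c.u⁻¹ ^ C) ^ r) ^ (k + 1)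
        = ξ₁ * (1 / 2) ^ (k + 1) * (c₀ * (c.u⁻¹ ^ C) ^ (k + 1)) ^ r := by
      rw [mul_pow, mul_pow, ← pow_mul, ← pow_mul, ← pow_mul, ← pow_mul]; ring
    rw [h2] at h1
    have h3 : (c₀ * (c.u⁻¹ ^ C) ^ (k + 1)) ^ r ≤ d k ^ r :=
      pow_le_pow_left₀ (by positivity) (hdlow k) r
    have h4 : (1 / 2 : ℝ) ^ (k + 1) ≤ (1 / 2) ^ k :=
      pow_le_pow_of_le_one (by norm_num) (by norm_num) (by omega)
    have h5 : ξ₁ * (1 / 2) ^ (k + 1) * (c₀ * (c.u⁻¹ ^ C) ^ (k + 1)) ^ r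
        ≤ ξ₁ * (1 / 2) ^ k * d k ^ r := by gcongr
    linarith [ht₀b k, ht₁b k]
  set P : ℕ → E4 := fun k => !₂[0, 0, X k, Y k] with hPdef
  set t : ℕ → E4 := fun k => !₂[t₀ k, t₁ k, 0, 0] with ht
  have htnorm : ∀ k, ‖t k‖ ≤ ξ₁ * (1 / 2) ^ k * d k ^ r := by
    intro k
    refine (E4.norm_le (t k)).trans ?_
    simpa [ht] using htb k
  have htd : ∀ k, |t₁ k| ≤ d k := by
    intro k
    have h1 := htb k
    have h2 : ξ₁ * (1 / 2) ^ k * d k ^ r ≤ 1 * 1 * d k ^ 1 := by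
      have h3 : (1 / 2 : ℝ) ^ k ≤ 1 := pow_le_one₀ (by norm_num) (by norm_num)
      have h4 : d k ^ r ≤ d k ^ 1 := pow_le_pow_of_le_one (hd0 k).le (hd1 k) hr
      have h5 := (hd0 k).le
      gcongr
    linarith [abs_nonneg (t₀ k)]
  -- The stems separate the values `B k`, which belong to the future, while the bumps sit at arrival
  -- points, which belong to the past; the past relation transfers the separation to `Y k`.
  have hYB : ∀ k, Y k = 1 + dd - mst⁻¹ * au + mst⁻¹ * B k - mst⁻¹ * t₁ k := by
    intro k
    simp only [ht₁]
    field_simp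
    ring
  have hsep : ∀ i j, i < j → 3 * d i ≤ |Y i - Y j| := by
    intro i j hij
    have h1 : stem i ++ [false] <+: f j :=
      (hstem i j hij).trans ((List.prefix_append _ _).trans (hpre j))
    have h2 := signMap_separated hF (hpre i) h1 (mB i) (mB j)
    rw [← hBe, ← hBe] at h2
    have h3 : 5 * d i ≤ mst⁻¹ * (B i - B j) := by
      have h4 : c₀ ≤ mst⁻¹ * (2 * (2 - au)) / 5 := min_le_right _ _
      have h5 : 0 < c.u⁻¹ ^ (stem i).length := by positivity
      have h6 := mul_le_mul_of_nonneg_right h4 h5.le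
      have h7 := mul_le_mul_of_nonneg_left h2 hmi.le
      simp only [hd]
      linarith
    have hmi1 : mst⁻¹ ≤ 1 := inv_le_one_of_one_le₀ hmst1
    have h8 : ∀ k, |mst⁻¹ * t₁ k| ≤ d k := fun k => by
      rw [abs_mul, abs_of_pos hmi]
      exact (mul_le_of_le_one_left (abs_nonneg _) hmi1).trans (htd k)
    have h9 := abs_le.1 (h8 i)
    have h10 := abs_le.1 (h8 j)
    have h11 := hdanti i j hij
    rw [hYB i, hYB j]
    refine le_trans ?_ (le_abs_self _)
    linarith [h9.1, h9.2, h10.1, h10.2]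
  have hPdist : ∀ i j, |Y i - Y j| ≤ dist (P i) (P j) := fun i j =>
    E4.abs_sub_apply_le (P i) (P j) 3
  have hsep' : ∀ j k, j ≠ k → 2 * d j + d k ≤ dist (P j) (P k) := by
    intro j k hjk
    refine le_trans ?_ (hPdist j k)
    rcases lt_or_gt_of_ne hjk with h1 | h1
    · linarith [hsep j k h1, hdanti j k h1]
    · rw [abs_sub_comm]
      linarith [hsep k j h1, hdanti k j h1]
  obtain ⟨g, hgc, hgb, hgt, hgs⟩ := hbump ξ₁ hξ₁0 P d t hd0 hd1 htnorm hsep'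
  have hξρ : ξ ≤ ρ / 2 := min_le_left _ _
  have hPz : ∀ k, dist (P k) zc ≤ ρ := by
    intro k
    have h1 := hns k _ (mX k)
    have h2 := hnp k _ (mY k)
    rw [← hXe] at h1
    rw [← hYe] at h2
    refine (E4.dist_le _ _).trans ?_
    simp only [hPdef, hzc, PiLp.toLp_apply, Matrix.cons_val, sub_self, abs_zero]
    linarith
  -- The common shift: `cc` acts directly on `x_u`, whereas `dd` shifts the relation for `y_s` and
  -- therefore enters `y_u` multiplied by `-mst`.
  set σ : E4 := !₂[cc, -(mst * dd), 0, 0] with hσ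
  have hσn : ‖σ‖ ≤ (1 + mst) * ξ := by
    refine (E4.norm_le σ).trans ?_
    simp only [hσ, PiLp.toLp_apply, Matrix.cons_val, abs_zero, abs_neg, abs_mul,
      abs_of_pos hmst0]
    linarith only [hcc, mul_le_mul_of_nonneg_left hdd hmst0.le]
  refine ⟨fun x => χ x • σ + g x, (hχc.smul_const σ).add hgc, ?_, ?_, w, ε, η, ?_, ?_⟩
  · intro x hx
    have hx' : 4 * ρ < dist x zc := by
      by_contra! h
      exact hx (hball x h)
    have h1 : χ x = 0 := χ.zero_of_le_dist (by rw [hχout]; exact hx'.le)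
    have h2 : g x = 0 := by
      by_contra hne
      obtain ⟨k, hk⟩ := hgs x hne
      have h3 := dist_triangle x (P k) zc
      linarith [hPz k, hdρ k]
    beta_reduce
    rw [h1, h2]; simp
  · intro i hi x
    have hi' : (i : WithTop ℕ∞) ≤ r := by exact_mod_cast hi
    have h1 := norm_iteratedFDeriv_smul_const_le hχc σ hi x
    have h2 := hgb i hi x
    have h3 : iteratedFDeriv ℝ i (fun x => χ x • σ + g x) x
        = iteratedFDeriv ℝ i (fun x => χ x • σ) x + iteratedFDeriv ℝ i g x :=
      iteratedFDeriv_add_apply (((hχc.smul_const σ).of_le hi').contDiffAt)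
        ((hgc.of_le hi').contDiffAt)
    rw [h3]
    have h4 : ‖σ‖ * ‖iteratedFDeriv ℝ i χ x‖ ≤ ξ₀ / 2 := by
      have h5 : ξ ≤ ξ₀ / (2 * Cχ * (1 + mst)) := min_le_right _ _
      calc ‖σ‖ * ‖iteratedFDeriv ℝ i χ x‖ ≤ ((1 + mst) * (ξ₀ / (2 * Cχ * (1 + mst)))) * Cχ := by
            refine mul_le_mul (hσn.trans ?_) (hCχb i hi x) (norm_nonneg _) (by positivity)
            exact mul_le_mul_of_nonneg_left h5 (by positivity)
        _ = ξ₀ / 2 := by field_simp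
    have h6 : Cb * ξ₁ ≤ ξ₀ / 2 := by
      calc Cb * ξ₁ ≤ Cb * (ξ₀ / (2 * Cb)) := mul_le_mul_of_nonneg_left (min_le_right _ _) hCb.le
        _ = ξ₀ / 2 := by field_simp
    refine (norm_add_le _ _).trans ?_
    linarith
  · have hsmall : ∀ k, 4 * ε k ≤ d k ∧ 4 * η k ≤ d k := by
      intro k
      have h1 : c.u ^ (stem k).length ≤ c.u ^ (N * (k + 1)) :=
        pow_le_pow_right₀ hu1.le ((hstemlen k).trans (hCN k))
      have h2 : 4 / c₀ ≤ M := by rw [hM]; linarith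
      have h3 : ∀ y, 0 < y → M * c.u ^ (N * (k + 1)) * y ≤ 1 → 4 * y ≤ d k := by
        intro y hy hy1
        have h4 : 4 / c₀ * c.u ^ (stem k).length * y ≤ 1 := by
          refine le_trans ?_ hy1
          gcongr
        simp only [hd]
        rw [inv_pow, ← div_eq_mul_inv, le_div_iff₀ (by positivity)]
        rw [div_mul_eq_mul_div, div_mul_eq_mul_div, div_le_one hc₀0] at h4
        linarith
      exact ⟨h3 _ (hε0 k) (hεs k), h3 _ (hη0 k) (hηs k)⟩
    have hbox : ∀ k, ∀ x ∈ c.routeBox w ε η k, dist x (P k) ≤ d k := by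
      rintro k x ⟨h0, h1, h2, h3⟩
      refine (E4.dist_le _ _).trans ?_
      have := hsmall k
      simp only [hPdef, PiLp.toLp_apply, Matrix.cons_val, sub_zero]
      linarith
    have hbox' : ∀ k, ∀ x ∈ c.routeBox w ε η k, dist x zc ≤ 2 * ρ := by
      intro k x hx
      have h1 := dist_triangle x (P k) zc
      linarith [hPz k, hdρ k, hbox k x hx]
    have hout : ∀ x, (x 1 < -δ ∨ δ < x 1) → χ x • σ + g x = 0 := by
      intro x hx
      have hx' : 4 * ρ < dist x zc := by
        by_contra! h
        have := (hball x h).2.1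
        rcases hx with hx | hx
        · linarith [this.1]
        · linarith [this.2]
      have h1 : χ x = 0 := χ.zero_of_le_dist (by rw [hχout]; exact hx'.le)
      have h2 : g x = 0 := by
        by_contra hne
        obtain ⟨k, hk⟩ := hgs x hne
        have h3 := dist_triangle x (P k) zc
        linarith [hPz k, hdρ k]
      rw [h1, h2]; simp
    have hup : ∀ k, 0 < c.u ^ (w (k + 1)).length := fun k => by positivity
    have hone : ∀ k, (1 : ℝ) ≤ c.u ^ (N * (k + 1)) := fun k => one_le_pow₀ hu1.le
    have hMb : 1 ≤ M ∧ lst⁻¹ ≤ M ∧ a₁ ≤ M ∧ mst ≤ M ∧ a₂ ≤ M := by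
      rw [hM]; refine ⟨?_, ?_, ?_, ?_, ?_⟩ <;> linarith
    obtain ⟨hM1, hM2, hM3, hM4, hM5⟩ := hMb
    have hMε : ∀ k, M * ε k ≤ 1 := fun k => by
      refine le_trans ?_ (hεs k)
      rw [mul_right_comm]
      exact le_mul_of_one_le_right (mul_nonneg (by linarith) (hε0 k).le) (hone k)
    refine ⟨⟨fun x hx => ?_, fun x hx => ?_⟩, fun k x hx => ?_, fun k x hx => ?_, hlsti.le,
      hmst0.le, ha₁, ha₂, hε0, hη0, fun k => ?_, fun k => ?_, fun k => ?_, fun k => ?_,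
      fun k => ?_, fun k => ?_, hεt, hηt, ?_⟩
    · beta_reduce
      rw [hout x (Or.inl (by linarith [hx.2.1.2])), add_zero]
      exact hmodel.on_box0 x hx
    · beta_reduce
      rw [hout x (Or.inr (by linarith [hx.2.1.1])), add_zero]
      exact hmodel.on_box1 x hx
    · have h1 : χ x = 1 := χ.one_of_mem_closedBall (by rw [hχin]; exact hbox' k x hx)
      have h2 := hgt k x (hbox k x hx)
      have h3 : x ∈ tangencyBox δ := hball x (by linarith [hbox' k x hx])
      beta_reduce
      rw [h1, h2, hmodel.on_tangencyBox x h3, one_smul]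
      ext i
      fin_cases i
      · simp [hσ, ht, ht₀, hX, hA, a_s]; ring
      · simp [hσ, ht, ht₁, hY, hB, show c.a_u = au from hau.symm]; field_simp; ring
      · simp [hσ, ht]
      · simp [hσ, ht]
    · exact hball x (by linarith [hbox' k x hx])
    · exact (le_mul_of_one_le_left (hε0 k).le hM1).trans (hMε k)
    · exact (mul_le_mul_of_nonneg_right hM5 (hε0 k).le).trans (hMε k)
    · refine le_trans (mul_le_mul_of_nonneg_left ?_ (hup k).le) (hexp k)
      linarith only [mul_le_mul_of_nonneg_right hM1 (sq_nonneg (ε k)),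
        mul_le_mul_of_nonneg_right hM2 (hη0 k).le]
    · refine le_trans (mul_le_mul_of_nonneg_left ?_ (hup k).le) (hexp k)
      linarith only [mul_le_mul_of_nonneg_right hM3 (sq_nonneg (ε k)),
        mul_le_mul_of_nonneg_right hM4 (hη0 k).le]
    · refine le_trans (mul_le_mul_of_nonneg_left ?_ (wordRate_pos hP.pairRate_pos _).le) (hcon k)
      exact mul_le_mul_of_nonneg_right hM5 (hε0 k).le
    · refine le_trans (mul_le_mul_of_nonneg_left ?_ (wordRate_pos hP.pairRate_pos _).le) (hcon k)
      exact le_mul_of_one_le_left (hε0 k).le hM1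
    · refine (tendsto_add_atTop_iff_nat 1).1 (tendsto_atTop_mono (fun k => ?_) hat)
      simp only [hw, routeWord, List.length_append, List.length_replicate]
      omega
  · exact ⟨f, fun k => (e (k + 1)).reverse, a, CT, hCT, ha0, hat, fun k => rfl, hT1, hT2, hrat⟩

end Rates

/-! ### Points coded by infinite words -/

/-- The point coded by an infinite word for a pair of affine contractions. -/
def codePoint (r v : Bool → ℝ) (d : ℕ → Bool) : ℝ :=
  ∑' n, (∏ k ∈ Finset.range n, r (d k)) * v (d n)

/-- The slopes are positive and bounded away from one. -/
def IsContractionPair (r : Bool → ℝ) : Prop := ∃ ρ : ℝ, ρ < 1 ∧ ∀ b, 0 < r b ∧ r b ≤ ρ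

section Codes

variable {r v : Bool → ℝ}

lemma IsContractionPair.exists_bound (hr : IsContractionPair r) (v : Bool → ℝ) :
    ∃ u : ℕ → ℝ, Summable u ∧ ∀ n (d : ℕ → Bool),
      ‖(∏ k ∈ Finset.range n, r (d k)) * v (d n)‖ ≤ u n := by
  obtain ⟨ρ, hρ1, hρ⟩ := hr
  have hρ0 : 0 ≤ ρ := (hρ true).1.le.trans (hρ true).2
  refine ⟨fun n => ρ ^ n * (|v true| + |v false|),
    (summable_geometric_of_lt_one hρ0 hρ1).mul_right _, fun n d => ?_⟩
  rw [norm_mul, Real.norm_eq_abs, Real.norm_eq_abs]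
  have h1 : |∏ k ∈ Finset.range n, r (d k)| ≤ ρ ^ n := by
    rw [Finset.abs_prod]
    calc ∏ k ∈ Finset.range n, |r (d k)| ≤ ∏ _k ∈ Finset.range n, ρ :=
          Finset.prod_le_prod (fun _ _ => abs_nonneg _) fun k _ => by
            rw [abs_of_pos (hρ _).1]; exact (hρ _).2
      _ = ρ ^ n := by simp
  have h2 : |v (d n)| ≤ |v true| + |v false| := by
    cases d n
    · linarith [abs_nonneg (v true)]
    · linarith [abs_nonneg (v false)]
  exact mul_le_mul h1 h2 (abs_nonneg _) (pow_nonneg hρ0 _)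

lemma continuous_codePoint (hr : IsContractionPair r) (v : Bool → ℝ) :
    Continuous (codePoint r v) := by
  obtain ⟨u, hu, hb⟩ := hr.exists_bound v
  refine continuous_tsum (fun n => ?_) hu hb
  refine Continuous.mul (continuous_finsetProd _ fun k _ => ?_) ?_
  · exact continuous_of_discreteTopology.comp (continuous_apply k)
  · exact continuous_of_discreteTopology.comp (continuous_apply n)

lemma codePoint_eq (hr : IsContractionPair r) (d : ℕ → Bool) :
    codePoint r v d = r (d 0) * codePoint r v (fun n => d (n + 1)) + v (d 0) := by
  obtain ⟨u, hu, hb⟩ := hr.exists_bound v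
  have hs : Summable fun n => (∏ k ∈ Finset.range n, r (d k)) * v (d n) :=
    .of_norm_bounded hu fun n => hb n d
  rw [codePoint, hs.tsum_eq_zero_add, codePoint, ← tsum_mul_left, add_comm]
  congr 1
  · exact tsum_congr fun n => by rw [Finset.prod_range_succ']; ring
  · simp

lemma exists_abs_codePoint_le (hr : IsContractionPair r) (v : Bool → ℝ) :
    ∃ C, 0 ≤ C ∧ ∀ d, |codePoint r v d| ≤ C := by
  obtain ⟨C, hC⟩ := (isCompact_range (continuous_codePoint hr v)).isBounded.exists_norm_le
  exact ⟨C, (norm_nonneg _).trans (hC _ ⟨fun _ => true, rfl⟩), fun d => hC _ ⟨d, rfl⟩⟩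

/-- The coded point is the only one with a bounded orbit following the word. -/
lemma eq_codePoint (hr : IsContractionPair r) {d : ℕ → Bool} {y : ℕ → ℝ} {B : ℝ}
    (hB : ∀ n, |y n| ≤ B) (hy : ∀ n, y n = r (d n) * y (n + 1) + v (d n)) :
    y 0 = codePoint r v d := by
  obtain ⟨C, hC0, hC⟩ := exists_abs_codePoint_le hr v
  have hr' := hr
  obtain ⟨ρ, hρ1, hρ⟩ := hr
  have hρ0 : 0 ≤ ρ := (hρ true).1.le.trans (hρ true).2
  have key : ∀ n m, |y m - codePoint r v (fun k => d (k + m))| ≤ ρ ^ n * (B + C) := by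
    intro n
    induction n with
    | zero =>
      intro m
      rw [pow_zero, one_mul]
      exact (abs_sub _ _).trans (add_le_add (hB m) (hC _))
    | succ n ih =>
      intro m
      have h1 : y m - codePoint r v (fun k => d (k + m)) =
          r (d m) * (y (m + 1) - codePoint r v (fun k => d (k + (m + 1)))) := by
        rw [codePoint_eq hr', hy m]
        simp only [zero_add, add_assoc, add_comm 1 m]
        ring
      rw [h1, abs_mul, abs_of_pos (hρ _).1, pow_succ, mul_comm (ρ ^ n), mul_assoc]
      exact mul_le_mul (hρ _).2 (ih _) (abs_nonneg _) hρ0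
  have h2 : Tendsto (fun n => ρ ^ n * (B + C)) atTop (𝓝 0) := by
    simpa using (tendsto_pow_atTop_nhds_zero_of_lt_one hρ0 hρ1).mul_const (B + C)
  have h3 := ge_of_tendsto' h2 fun n => key n 0
  simpa [sub_eq_zero] using abs_nonpos_iff.1 h3

/-- The coded point is a limit of images of `a` under finite prefixes of the code, and these stay in
the closed interval. -/
lemma codePoint_mem {a b : ℝ} (hr : IsContractionPair r) (hab : a ≤ b)
    (h : ∀ d, ∀ x ∈ Icc a b, r d * x + v d ∈ Icc a b) (d : ℕ → Bool) :
    codePoint r v d ∈ Icc a b := by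
  obtain ⟨C, hC0, hC⟩ := exists_abs_codePoint_le hr v
  have hr' := hr
  obtain ⟨ρ, hρ1, hρ⟩ := hr
  have hρ0 : 0 ≤ ρ := (hρ true).1.le.trans (hρ true).2
  have key : ∀ n, ∀ d : ℕ → Bool, ∃ z ∈ Icc a b, |codePoint r v d - z| ≤ ρ ^ n * (C + |a|) := by
    intro n
    induction n with
    | zero =>
      intro d
      refine ⟨a, left_mem_Icc.2 hab, ?_⟩
      rw [pow_zero, one_mul]
      exact (abs_sub _ _).trans (add_le_add (hC d) le_rfl)
    | succ n ih =>
      intro d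
      obtain ⟨z, hz, hz'⟩ := ih fun n => d (n + 1)
      refine ⟨_, h (d 0) z hz, ?_⟩
      rw [codePoint_eq hr', add_sub_add_right_eq_sub, ← mul_sub, abs_mul, abs_of_pos (hρ _).1,
        pow_succ, mul_comm (ρ ^ n), mul_assoc]
      exact mul_le_mul (hρ _).2 hz' (abs_nonneg _) hρ0
  have h2 : Tendsto (fun n => ρ ^ n * (C + |a|)) atTop (𝓝 0) := by
    simpa using (tendsto_pow_atTop_nhds_zero_of_lt_one hρ0 hρ1).mul_const (C + |a|)
  refine isClosed_Icc.closure_subset (Metric.mem_closure_iff.2 fun ε hε => ?_)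
  obtain ⟨n, hn⟩ := (h2.eventually_lt_const hε).exists
  obtain ⟨z, hz, hz'⟩ := key n d
  exact ⟨z, hz, by rw [Real.dist_eq]; exact hz'.trans_lt hn⟩

/-- If the two images cover an interval, then all its points are coded. -/
lemma exists_codePoint_eq {a b : ℝ} (hr : IsContractionPair r)
    (h : ∀ y ∈ Icc a b, ∃ d, ∃ z ∈ Icc a b, y = r d * z + v d) {y : ℝ} (hy : y ∈ Icc a b) :
    ∃ d, codePoint r v d = y := by
  choose! d g hg hd using h
  have hm : ∀ n, g^[n] y ∈ Icc a b := by
    intro n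
    induction n with
    | zero => exact hy
    | succ n ih => rw [Function.iterate_succ_apply']; exact hg _ ih
  refine ⟨fun n => d (g^[n] y), (eq_codePoint (y := fun n => g^[n] y) hr (B := |a| + |b|) ?_ ?_).symm⟩
  · intro n
    have := hm n
    refine (abs_le_max_abs_abs this.1 this.2).trans (max_le ?_ ?_) <;>
      linarith [abs_nonneg a, abs_nonneg b]
  · intro n
    rw [Function.iterate_succ_apply']
    exact hd _ (hm n)

end Codes

namespace IsBlend

variable {b₀ b₁ t : ℝ}

lemma pair_contraction (h : IsBlend b₀ b₁ t) : IsContractionPair (pairRate b₀ b₁) :=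
  ⟨b₁, h.lt_one, fun d => ⟨h.pairRate_pos d, h.pairRate_le d⟩⟩

lemma sign_contraction (h : IsBlend b₀ b₁ t) : IsContractionPair fun _ => t :=
  ⟨t, by linarith [h.t_lt, h.lt_half], fun _ => ⟨h.t_pos, le_rfl⟩⟩

/-- This covering is the source of the blender property: beyond the right end `b₀ - 1` of the first
image the second image has already begun. -/
lemma exists_preimage (h : IsBlend b₀ b₁ t) {y : ℝ} (hy : y ∈ Icc (-(1 / (1 - b₀))) 1) :
    ∃ d, ∃ z ∈ Icc (-(1 / (1 - b₀))) 1, y = pairRate b₀ b₁ d * z + pairShift b₁ d := by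
  have hb := h.pos
  have hb1 : 0 < b₁ := by linarith [h.half_lt]
  have he := h.end_mul
  have ho := h.overlapLength_pos
  unfold overlapLength at ho
  by_cases hc : y ≤ b₀ - 1
  · refine ⟨false, (y + 1) / b₀, ⟨?_, ?_⟩, ?_⟩
    · rw [le_div_iff₀ hb]; nlinarith [hy.1]
    · rw [div_le_iff₀ hb]; linarith
    · simp only [pairRate, pairShift, cond_false]; field_simp; ring
  · push Not at hc
    refine ⟨true, (y - (1 - b₁)) / b₁, ⟨?_, ?_⟩, ?_⟩
    · rw [le_div_iff₀ hb1]; nlinarith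
    · rw [div_le_iff₀ hb1]; linarith [hy.2]
    · simp only [pairRate, pairShift, cond_true]; field_simp; ring

lemma range_codePoint (h : IsBlend b₀ b₁ t) :
    range (codePoint (pairRate b₀ b₁) (pairShift b₁)) = Icc (-(1 / (1 - b₀))) 1 := by
  refine Subset.antisymm ?_ fun y hy =>
    exists_codePoint_eq h.pair_contraction (fun y hy => h.exists_preimage hy) hy
  rintro _ ⟨d, rfl⟩
  exact codePoint_mem h.pair_contraction (by linarith [h.one_lt_end]) h.pair_mem d

lemma pair_codePoint_mem (h : IsBlend b₀ b₁ t) (d : ℕ → Bool) :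
    codePoint (pairRate b₀ b₁) (pairShift b₁) d ∈ Ioo (-2 : ℝ) 2 := by
  have h1 : codePoint (pairRate b₀ b₁) (pairShift b₁) d ∈ Icc (-(1 / (1 - b₀))) 1 :=
    h.range_codePoint ▸ mem_range_self d
  exact ⟨by linarith [h1.1, h.end_lt_two], by linarith [h1.2]⟩

lemma sign_codePoint_mem (h : IsBlend b₀ b₁ t) (d : ℕ → Bool) :
    codePoint (fun _ => t) signShift d ∈ Ioo (-2 : ℝ) 2 := by
  have h1 := codePoint_mem h.sign_contraction (by linarith [h.one_lt_sign_end]) h.sign_mem d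
  exact ⟨by linarith [h1.1, h.sign_end_lt_two], by linarith [h1.2, h.sign_end_lt_two]⟩

end IsBlend

/-! ### Diagonal maps -/

/-- The diagonal linear map with the given entries. -/
def diagMap {n : ℕ} (a : Fin n → ℝ) :
    EuclideanSpace ℝ (Fin n) →L[ℝ] EuclideanSpace ℝ (Fin n) :=
  LinearMap.toContinuousLinearMap (Matrix.toEuclideanLin (Matrix.diagonal a))

@[simp] lemma diagMap_apply {n : ℕ} (a : Fin n → ℝ) (x : EuclideanSpace ℝ (Fin n)) (i : Fin n) :
    diagMap a x i = a i * x i := by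
  simp [diagMap, Matrix.toEuclideanLin, Matrix.toLpLin_apply, Matrix.mulVec_diagonal]

lemma norm_diagMap_le {n : ℕ} {a : Fin n → ℝ} {x : EuclideanSpace ℝ (Fin n)} {K : ℝ} (hK : 0 ≤ K)
    (h : ∀ i, |a i * x i| ≤ K * |x i|) : ‖diagMap a x‖ ≤ K * ‖x‖ := by
  rw [EuclideanSpace.norm_eq, EuclideanSpace.norm_eq, ← Real.sqrt_sq hK,
    ← Real.sqrt_mul (sq_nonneg K), Finset.mul_sum]
  refine Real.sqrt_le_sqrt (Finset.sum_le_sum fun i _ => ?_)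
  rw [← mul_pow, diagMap_apply]
  exact pow_le_pow_left₀ (norm_nonneg _) (h i) 2

lemma aroots_charpoly_diagMap (a : Fin 4 → ℝ) :
    (LinearMap.charpoly (diagMap a : E4 →ₗ[ℝ] E4)).aroots ℂ =
      Finset.univ.val.map fun i => (a i : ℂ) := by
  have h1 : LinearMap.charpoly (diagMap a : E4 →ₗ[ℝ] E4) =
      ∏ i, (Polynomial.X - Polynomial.C (a i)) := by
    rw [← Matrix.charpoly_diagonal]
    have h2 : ((diagMap a : E4 →L[ℝ] E4) : E4 →ₗ[ℝ] E4) =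
        Matrix.toLin (EuclideanSpace.basisFun (Fin 4) ℝ).toBasis
          (EuclideanSpace.basisFun (Fin 4) ℝ).toBasis (Matrix.diagonal a) := by
      rw [← Matrix.toEuclideanLin_eq_toLin_orthonormal]; rfl
    rw [h2, Matrix.charpoly_toLin]
  rw [h1, Polynomial.aroots, Polynomial.map_prod]
  simpa [Multiset.map_map, Function.comp_def, Finset.prod] using
    Polynomial.roots_multiset_prod_X_sub_C (Finset.univ.val.map fun i => (a i : ℂ))

lemma isSaddleFixedPoint_of_diag {f : E4 → E4} {p : E4} {a : Fin 4 → ℝ} (hp : f p = p)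
    (hf : fderiv ℝ f p = diagMap a) (ha : ∀ i, |a i| ≠ 1) (i j : Fin 4) (hi : |a i| < 1)
    (hj : 1 < |a j|) : IsSaddleFixedPoint f p := by
  rw [IsSaddleFixedPoint, hf, aroots_charpoly_diagMap]
  refine ⟨hp, fun z hz => ?_, ⟨a i, Multiset.mem_map_of_mem _ (Finset.mem_univ i), by simpa⟩,
    ⟨a j, Multiset.mem_map_of_mem _ (Finset.mem_univ j), by simpa⟩⟩
  obtain ⟨k, -, rfl⟩ := Multiset.mem_map.1 hz
  simpa using ha k

/-! ### The horseshoe -/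

namespace Rates

variable {c : Rates}

/-- The derivative of the affine map on the box of the given digit. -/
def digitRate (c : Rates) (d : Bool) : Fin 4 → ℝ :=
  ![cond d c.cu1 c.cu0, c.u, c.s, cond d c.cs1 c.cs0]

lemma Admissible.digitRate_pos (hc : c.Admissible) (d : Bool) (i : Fin 4) :
    0 < c.digitRate d i := by
  have h0 := hc.cu0_pos
  have h1 := hc.cu1_pos
  have h2 := hc.u_pos
  have h3 := hc.s_pos
  have h4 := hc.past.pos
  have h5 := hc.half_lt_cs1
  cases d <;> fin_cases i <;> simp [digitRate] <;> linarith

/-- The point of the horseshoe with the given itinerary. -/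
def point (c : Rates) (w : ℤ → Bool) : E4 :=
  !₂[codePoint (pairRate c.cu0⁻¹ c.cu1⁻¹) (pairShift c.cu1⁻¹) fun n => w n,
    codePoint (fun _ => c.u⁻¹) signShift fun n => w n,
    codePoint (fun _ => c.s) signShift fun n => w (-1 - n),
    codePoint (pairRate c.cs0 c.cs1) (pairShift c.cs1) fun n => w (-1 - n)]

lemma Admissible.point_eq_start (hc : c.Admissible) (w : ℤ → Bool) :
    c.point w = c.start [w 0] (c.point (fun k => w (k + 1)) 0) (c.point (fun k => w (k + 1)) 1)
      (c.point w 2) (c.point w 3) := by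
  ext i
  fin_cases i
  · exact codePoint_eq hc.future.pair_contraction _
  · exact codePoint_eq hc.future.sign_contraction _
  · rfl
  · rfl

lemma Admissible.abs_point_lt (hc : c.Admissible) (w : ℤ → Bool) (i : Fin 4) :
    c.point w i ∈ Ioo (-2 : ℝ) 2 := by
  fin_cases i
  · exact hc.future.pair_codePoint_mem _
  · exact hc.future.sign_codePoint_mem _
  · exact hc.past.sign_codePoint_mem _
  · exact hc.past.pair_codePoint_mem _

lemma Admissible.continuous_point (hc : c.Admissible) : Continuous c.point := by
  have h : Continuous fun w => ![c.point w 0, c.point w 1, c.point w 2, c.point w 3] := by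
    refine continuous_pi fun i => ?_
    fin_cases i
    · exact (continuous_codePoint hc.future.pair_contraction _).comp
        (continuous_pi fun n => continuous_apply _)
    · exact (continuous_codePoint hc.future.sign_contraction _).comp
        (continuous_pi fun n => continuous_apply _)
    · exact (continuous_codePoint hc.past.sign_contraction _).comp
        (continuous_pi fun n => continuous_apply _)
    · exact (continuous_codePoint hc.past.pair_contraction _).comp
        (continuous_pi fun n => continuous_apply _)
  exact (PiLp.continuous_toLp 2 _).comp h

lemma IsAffineOn.apply_point {f : E4 → E4} (hf : c.IsAffineOn f) (hc : c.Admissible)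
    (w : ℤ → Bool) : f (c.point w) = c.point fun k => w (k + 1) := by
  have hm : ∀ v i, c.point v i ∈ Icc (-2 : ℝ) 2 := fun v i =>
    Ioo_subset_Icc_self (hc.abs_point_lt v i)
  rw [hc.point_eq_start w, hf.apply_start_cons hc _ _ (hm _ _) (hm _ _) (hm _ _) (hm _ _)]
  have h : ∀ n : ℕ, w (-1 - ((n + 1 : ℕ) : ℤ) + 1) = w (-1 - n) := fun n => by
    congr 1; push_cast; ring
  ext i
  fin_cases i
  · rfl
  · rfl
  · have h1 := codePoint_eq (v := signShift) hc.past.sign_contraction fun n : ℕ => w (-1 - n + 1)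
    simp only [h] at h1
    exact h1.symm
  · have h1 := codePoint_eq (v := pairShift c.cs1) hc.past.pair_contraction
      fun n : ℕ => w (-1 - n + 1)
    simp only [h] at h1
    exact h1.symm

lemma Admissible.point_mem_box (hc : c.Admissible) (w : ℤ → Bool) : c.point w ∈ c.box (w 0) := by
  have hm : ∀ v i, c.point v i ∈ Icc (-2 : ℝ) 2 := fun v i =>
    Ioo_subset_Icc_self (hc.abs_point_lt v i)
  rw [hc.point_eq_start w]
  exact hc.start_cons_mem_box _ _ (hm _ _) (hm _ _) (hm _ _) (hm _ _)

/-- Coded coordinates lie strictly between `-2` and `2`, so the horseshoe lies in the interior of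
the boxes and the derivative there is that of the affine formula. -/
lemma Admissible.box_mem_nhds (hc : c.Admissible) (w : ℤ → Bool) :
    c.box (w 0) ∈ 𝓝 (c.point w) := by
  have e0 : 0 < c.cu0⁻¹ := inv_pos.2 hc.cu0_pos
  have e1 : 0 < c.cu1⁻¹ := inv_pos.2 hc.cu1_pos
  have e2 : 0 < c.u⁻¹ := inv_pos.2 hc.u_pos
  have h0 := hc.abs_point_lt (fun k => w (k + 1)) 0
  have h1 := hc.abs_point_lt (fun k => w (k + 1)) 1
  have h2 := hc.abs_point_lt w 2
  have h3 := hc.abs_point_lt w 3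
  have hci : ∀ i : Fin 4, ContinuousAt (fun x : E4 => x i) (c.point w) := fun i => by fun_prop
  have key : ∀ {a b : ℝ} (i : Fin 4), c.point w i ∈ Ioo a b →
      ∀ᶠ x : E4 in 𝓝 (c.point w), x i ∈ Icc a b := fun i h =>
    (hci i).eventually (Icc_mem_nhds h.1 h.2)
  have p0 : c.point w 0 = _ := congrArg (fun x : E4 => x 0) (hc.point_eq_start w)
  have p1 : c.point w 1 = _ := congrArg (fun x : E4 => x 1) (hc.point_eq_start w)
  generalize w 0 = d at p0 p1 ⊢
  cases d
  · change _ = c.cu0⁻¹ * c.point (fun k => w (k + 1)) 0 + -1 at p0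
    change _ = c.u⁻¹ * c.point (fun k => w (k + 1)) 1 + -1 at p1
    filter_upwards [key 0 (a := -1 - 2 * c.cu0⁻¹) (b := -1 + 2 * c.cu0⁻¹)
        (by rw [p0]; constructor <;> nlinarith [h0.1, h0.2]),
      key 1 (a := -1 - 2 * c.u⁻¹) (b := -1 + 2 * c.u⁻¹)
        (by rw [p1]; constructor <;> nlinarith [h1.1, h1.2]), key 2 h2, key 3 h3] with x q0 q1 q2 q3
      using ⟨q0, q1, q2, q3⟩
  · change _ = c.cu1⁻¹ * c.point (fun k => w (k + 1)) 0 + (1 - c.cu1⁻¹) at p0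
    change _ = c.u⁻¹ * c.point (fun k => w (k + 1)) 1 + 1 at p1
    filter_upwards [key 0 (a := 1 - 3 * c.cu1⁻¹) (b := 1 + c.cu1⁻¹)
        (by rw [p0]; constructor <;> nlinarith [h0.1, h0.2]),
      key 1 (a := 1 - 2 * c.u⁻¹) (b := 1 + 2 * c.u⁻¹)
        (by rw [p1]; constructor <;> nlinarith [h1.1, h1.2]), key 2 h2, key 3 h3] with x q0 q1 q2 q3
      using ⟨q0, q1, q2, q3⟩

lemma IsAffineOn.eq_diag {f : E4 → E4} (hf : c.IsAffineOn f) {d : Bool} {x : E4}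
    (hx : x ∈ c.box d) : f x = diagMap (c.digitRate d) x +
      !₂[cond d (1 - c.cu1) c.cu0, cond d (-c.u) c.u, signShift d, pairShift c.cs1 d] := by
  cases d
  · rw [hf.on_box0 x hx]
    ext i
    fin_cases i <;> simp [digitRate, signShift, pairShift] <;> ring
  · rw [hf.on_box1 x hx]
    ext i
    fin_cases i <;> simp [digitRate, signShift, pairShift] <;> ring

lemma IsAffineOn.hasFDerivAt_point {f : E4 → E4} (hf : c.IsAffineOn f) (hc : c.Admissible)
    (w : ℤ → Bool) : HasFDerivAt f (diagMap (c.digitRate (w 0))) (c.point w) := by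
  refine ((diagMap (c.digitRate (w 0))).hasFDerivAt.add_const
    (!₂[cond (w 0) (1 - c.cu1) c.cu0, cond (w 0) (-c.u) c.u, signShift (w 0),
      pairShift c.cs1 (w 0)] : E4)).congr_of_eventuallyEq ?_
  filter_upwards [hc.box_mem_nhds w] with x hx using hf.eq_diag hx

lemma Admissible.box_coords (hc : c.Admissible) {d : Bool} {x : E4} (hx : x ∈ c.box d) (i : Fin 4) :
    |x i| ≤ 2 := by
  have e0 := hc.future.lt_half
  have e1 := hc.future.lt_one
  have e2 := hc.two_mul_inv_u_lt
  rw [abs_le]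
  cases d
  · obtain ⟨⟨_, _⟩, ⟨_, _⟩, ⟨_, _⟩, _, _⟩ := hx
    fin_cases i <;> constructor <;> dsimp at * <;> linarith
  · obtain ⟨⟨_, _⟩, ⟨_, _⟩, ⟨_, _⟩, _, _⟩ := hx
    fin_cases i <;> constructor <;> dsimp at * <;> linarith

lemma Admissible.digit_eq (hc : c.Admissible) {d : Bool} {x : E4} (hx : x ∈ c.box d) :
    decide (0 < x 1) = d := by
  have e2 := hc.two_mul_inv_u_lt
  cases d
  · obtain ⟨_, ⟨_, _⟩, _⟩ := hx
    simp only [decide_eq_false_iff_not, not_lt]; linarith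
  · obtain ⟨_, ⟨_, _⟩, _⟩ := hx
    simp only [decide_eq_true_eq]; linarith

/-! ### The maximal invariant set: coding and hyperbolicity -/

section

variable {r : ℕ} {F : CrDiffeo r}

/-- Integer powers in the permutation group treat forward and backward iterates together. -/
lemma IsAffineOn.zpow_point (hF : c.IsAffineOn F) (hc : c.Admissible) (w : ℤ → Bool) (k : ℤ) :
    ((F.toEquiv : Equiv.Perm E4) ^ k) (c.point w) = c.point fun n => w (n + k) := by
  have h1 : ∀ v, (F.toEquiv : Equiv.Perm E4) (c.point v) = c.point fun n => v (n + 1) :=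
    fun v => hF.apply_point hc v
  induction k with
  | zero => simp
  | succ k ih =>
    rw [add_comm, zpow_add, zpow_one, Equiv.Perm.mul_apply, ih, h1]
    congr 1; ext n; congr 1; ring
  | pred k ih =>
    rw [sub_eq_add_neg, add_comm, zpow_add, Equiv.Perm.mul_apply, ih, zpow_neg_one,
      Equiv.Perm.inv_eq_iff_eq, h1]
    congr 1; ext n; congr 1; ring

lemma iterate_eq_zpow (F : CrDiffeo r) (n : ℕ) (x : E4) :
    F^[n] x = ((F.toEquiv : Equiv.Perm E4) ^ (n : ℤ)) x := by
  rw [zpow_natCast, ← Equiv.Perm.iterate_eq_pow]; rfl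

lemma symm_iterate_eq_zpow (F : CrDiffeo r) (n : ℕ) (x : E4) :
    F.symm^[n] x = ((F.toEquiv : Equiv.Perm E4) ^ (-n : ℤ)) x := by
  rw [← inv_zpow', zpow_natCast, ← Equiv.Perm.iterate_eq_pow]; rfl

lemma mem_horseshoe_iff {x : E4} : x ∈ horseshoe c F ↔
    ∀ k : ℤ, ((F.toEquiv : Equiv.Perm E4) ^ k) x ∈ c.box0 ∪ c.box1 := by
  constructor
  · intro h k
    obtain ⟨n, rfl | rfl⟩ := k.eq_nat_or_neg
    · rw [← iterate_eq_zpow]; exact (h n).1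
    · rw [← symm_iterate_eq_zpow]; exact (h n).2
  · intro h n
    rw [iterate_eq_zpow, symm_iterate_eq_zpow]
    exact ⟨h _, h _⟩

/-- A full orbit in the boxes is bounded. Its unstable coordinates satisfy a recursion contracting
towards the past and its stable ones a recursion contracting towards the future; the only bounded
solutions are the coded points (`eq_codePoint`). -/
lemma IsAffineOn.range_point (hF : c.IsAffineOn F) (hc : c.Admissible) :
    range c.point = horseshoe c F := by
  refine Subset.antisymm ?_ fun x hx => ?_
  · rintro _ ⟨w, rfl⟩
    refine mem_horseshoe_iff.2 fun k => ?_
    rw [hF.zpow_point hc]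
    exact c.box_subset _ (hc.point_mem_box _)
  rw [mem_horseshoe_iff] at hx
  set X : ℤ → E4 := fun k => ((F.toEquiv : Equiv.Perm E4) ^ k) x with hX
  have hd : ∀ k, ∃ d, X k ∈ c.box d := fun k => by
    rcases hx k with h | h
    exacts [⟨false, h⟩, ⟨true, h⟩]
  choose w hw using hd
  have hstep : ∀ k, X (k + 1) = F (X k) := fun k => by
    simp only [hX]
    rw [add_comm, zpow_add, zpow_one, Equiv.Perm.mul_apply]; rfl
  have hb : ∀ k i, |X k i| ≤ 2 := fun k => hc.box_coords (hw k)
  have hs : ∀ k, X (k + 1) = _ := fun k => (hstep k).trans (hF.eq_diag (hw k))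
  have e0 := hc.cu0_pos.ne'
  have e1 := hc.cu1_pos.ne'
  have e2 := hc.u_pos.ne'
  have h0 : ∀ k, X k 0 = pairRate c.cu0⁻¹ c.cu1⁻¹ (w k) * X (k + 1) 0 + pairShift c.cu1⁻¹ (w k) := by
    intro k
    rw [hs k]
    cases w k <;> simp [digitRate, pairRate, pairShift] <;> field_simp <;> ring
  have h1 : ∀ k, X k 1 = c.u⁻¹ * X (k + 1) 1 + signShift (w k) := by
    intro k
    rw [hs k]
    cases w k <;> simp [digitRate, signShift] <;> field_simp <;> ring
  have h2 : ∀ k, X (k + 1) 2 = c.s * X k 2 + signShift (w k) := by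
    intro k
    rw [hs k]
    cases w k <;> simp [digitRate, signShift]
  have h3 : ∀ k, X (k + 1) 3 = pairRate c.cs0 c.cs1 (w k) * X k 3 + pairShift c.cs1 (w k) := by
    intro k
    rw [hs k]
    cases w k <;> simp [digitRate, pairRate, pairShift]
  have hneg : ∀ n : ℕ, -(n : ℤ) = (-1 - n) + 1 := fun n => by ring
  have hneg' : ∀ n : ℕ, -((n + 1 : ℕ) : ℤ) = -1 - n := fun n => by push_cast; ring
  refine ⟨w, ?_⟩
  have hx0 : x = X 0 := by simp [hX]
  rw [hx0]
  ext i
  fin_cases i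
  · exact (eq_codePoint (y := fun n => X n 0) hc.future.pair_contraction
      (fun n => hb n 0) fun n => h0 n).symm
  · exact (eq_codePoint (y := fun n => X n 1) hc.future.sign_contraction
      (fun n => hb n 1) fun n => h1 n).symm
  · refine (eq_codePoint (y := fun n => X (-n) 2) hc.past.sign_contraction
      (fun n => hb _ 2) fun n => ?_).symm
    rw [hneg', hneg]; exact h2 _
  · refine (eq_codePoint (y := fun n => X (-n) 3) hc.past.pair_contraction
      (fun n => hb _ 3) fun n => ?_).symm
    rw [hneg', hneg]; exact h3 _

lemma IsAffineOn.point_injective (hF : c.IsAffineOn F) (hc : c.Admissible) :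
    Function.Injective c.point := by
  intro w w' h
  ext k
  have h1 := hF.zpow_point hc w k
  rw [h, hF.zpow_point hc] at h1
  have h2 := hc.digit_eq (hc.point_mem_box fun n => w (n + k))
  rw [← h1, hc.digit_eq (hc.point_mem_box fun n => w' (n + k))] at h2
  simpa using h2.symm

theorem IsAffineOn.isConjugateToFullShift (hF : c.IsAffineOn F) (hc : c.Admissible) :
    IsConjugateToFullShift F (horseshoe c F) := by
  have hm : ∀ w, c.point w ∈ horseshoe c F := fun w => hF.range_point hc ▸ mem_range_self w
  let e : (ℤ → Bool) ≃ horseshoe c F := Equiv.ofBijective (fun w => ⟨c.point w, hm w⟩)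
    ⟨fun w w' h => hF.point_injective hc (congrArg Subtype.val h), fun x => by
      obtain ⟨w, hw⟩ := (hF.range_point hc).ge x.2
      exact ⟨w, Subtype.ext hw⟩⟩
  have he : Continuous e := hc.continuous_point.subtype_mk hm
  exact ⟨he.homeoOfEquivCompactToT2, fun w => (hF.apply_point hc w).symm⟩

/-- The coordinate `x_u` depends only on the digits with index at least zero, and these can be
prescribed arbitrarily. -/
lemma IsAffineOn.image_zero (hF : c.IsAffineOn F) (hc : c.Admissible) :
    (fun x : E4 => x 0) '' horseshoe c F = Icc (-c.a_cu) 1 := by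
  rw [← hF.range_point hc, a_cu, ← hc.future.range_codePoint, ← range_comp]
  refine Subset.antisymm (range_subset_iff.2 fun w => ⟨_, rfl⟩)
    (range_subset_iff.2 fun d => ⟨fun k => d k.toNat, rfl⟩)

lemma IsAffineOn.image_three (hF : c.IsAffineOn F) (hc : c.Admissible) :
    (fun x : E4 => x 3) '' horseshoe c F = Icc (-c.a_cs) 1 := by
  rw [← hF.range_point hc, a_cs, ← hc.past.range_codePoint, ← range_comp]
  refine Subset.antisymm (range_subset_iff.2 fun w => ⟨_, rfl⟩)
    (range_subset_iff.2 fun d => ⟨fun k => d (-1 - k).toNat, ?_⟩)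
  have h : ∀ n : ℕ, (-1 - (-1 - (n : ℤ))).toNat = n := fun n => by omega
  change codePoint _ _ (fun n : ℕ => d (-1 - (-1 - (n : ℤ))).toNat) = _
  simp only [h]

lemma diag_symm {A : Fin 4 → ℝ} {x : E4} (hr : 1 ≤ r) (hA : ∀ i, A i ≠ 0)
    (h : HasFDerivAt F (diagMap A) x) : fderiv ℝ F.symm (F x) = diagMap fun i => (A i)⁻¹ := by
  have hr' : (r : WithTop ℕ∞) ≠ 0 := by simp; omega
  have hd : DifferentiableAt ℝ F.symm (F x) := (F.symm.contDiff.differentiable hr') _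
  have h1 := hd.hasFDerivAt.comp x h
  have h2 : F.symm ∘ F = id := funext fun x => F.symm_apply_apply x
  rw [h2] at h1
  have h3 := h1.unique (hasFDerivAt_id x)
  ext1 v
  have h4 : diagMap A (diagMap (fun i => (A i)⁻¹) v) = v := by
    ext i; simp [hA i]
  have h5 := congrArg (fun T : E4 →L[ℝ] E4 => T (diagMap (fun i => (A i)⁻¹) v)) h3
  simp only [ContinuousLinearMap.comp_apply, h4] at h5
  exact h5

theorem IsAffineOn.isHyperbolicSet (hF : c.IsAffineOn F) (hc : c.Admissible) (hr : 1 ≤ r) :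
    IsHyperbolicSet F (horseshoe c F) := by
  have hr' : (r : WithTop ℕ∞) ≠ 0 := by simp; omega
  have hdF : Differentiable ℝ F := F.contDiff.differentiable hr'
  have hdS : Differentiable ℝ F.symm := F.symm.contDiff.differentiable hr'
  rw [← hF.range_point hc]
  refine ⟨isCompact_range hc.continuous_point, ?_, ?_⟩
  · refine Subset.antisymm ?_ ?_
    · rintro _ ⟨_, ⟨w, rfl⟩, rfl⟩
      exact ⟨_, (hF.apply_point hc w).symm⟩
    · rintro _ ⟨w, rfl⟩
      refine ⟨_, ⟨fun k => w (k - 1), rfl⟩, ?_⟩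
      rw [hF.apply_point hc]
      simp
  have hpos := hc.digitRate_pos
  set lam := max c.cs1 c.cu1⁻¹ with hlam
  have hlam0 : 0 < lam := lt_max_of_lt_right (inv_pos.2 hc.cu1_pos)
  have hst : ∀ d i, 2 ≤ i → |c.digitRate d i| ≤ lam := by
    intro d i hi
    rw [abs_of_pos (hpos d i)]
    refine le_trans ?_ (le_max_left _ _)
    have h1 := hc.s_lt_cs0
    have h4 := hc.cs0_lt_half
    have h5 := hc.half_lt_cs1
    cases d <;> fin_cases i <;> simp [digitRate] at hi ⊢ <;> linarith
  have hun : ∀ d i, i < 2 → |(c.digitRate d i)⁻¹| ≤ lam := by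
    intro d i hi
    rw [abs_of_pos (inv_pos.2 (hpos d i))]
    refine le_trans ?_ (le_max_right _ _)
    rw [inv_le_inv₀ (hpos d i) hc.cu1_pos]
    have h1 := hc.cu1_lt_two
    have h4 := hc.two_lt_cu0
    have h5 := hc.cu0_lt_u
    cases d <;> fin_cases i <;> simp [digitRate] at hi ⊢ <;> linarith
  -- The splitting is constant: all derivatives along the horseshoe are diagonal with the same
  -- expanding and contracting coordinates, and the weakest rates are `cu1` and `cs1`.
  refine ⟨fun _ => diagMap ![0, 0, 1, 1], continuousOn_const, ?_, ?_, 1, lam, one_pos, hlam0,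
    max_lt hc.cs1_lt_one hc.future.lt_one, ?_⟩
  · intro x _
    ext v i
    fin_cases i <;> simp
  · rintro _ ⟨w, rfl⟩
    rw [(hF.hasFDerivAt_point hc w).fderiv]
    ext v i
    simp only [ContinuousLinearMap.comp_apply, diagMap_apply]
    ring
  rintro _ ⟨w, rfl⟩ n
  have hPs : ∀ v : E4, diagMap ![0, 0, 1, 1] v = v → v 0 = 0 ∧ v 1 = 0 := fun v hv => by
    constructor
    · have := congrArg (fun x : E4 => x 0) hv
      simpa using this.symm
    · have := congrArg (fun x : E4 => x 1) hv
      simpa using this.symm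
  have hPu : ∀ v : E4, diagMap ![0, 0, 1, 1] v = 0 → v 2 = 0 ∧ v 3 = 0 := fun v hv => by
    constructor
    · have := congrArg (fun x : E4 => x 2) hv
      simpa using this
    · have := congrArg (fun x : E4 => x 3) hv
      simpa using this
  constructor
  · intro v hv
    obtain ⟨hv0, hv1⟩ := hPs v hv
    clear hv
    induction n generalizing w v with
    | zero => simp
    | succ n ih =>
      have h1 : fderiv ℝ (F^[n + 1]) (c.point w) =
          fderiv ℝ (F^[n]) (F (c.point w)) ∘L fderiv ℝ F (c.point w) := by
        rw [Function.iterate_succ]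
        exact fderiv_comp _ ((hdF.iterate n) _) (hdF _)
      rw [h1, (hF.hasFDerivAt_point hc w).fderiv, hF.apply_point hc, ContinuousLinearMap.comp_apply]
      refine (ih _ _ (by simp [hv0]) (by simp [hv1])).trans ?_
      have h2 : ‖diagMap (c.digitRate (w 0)) v‖ ≤ lam * ‖v‖ := by
        refine norm_diagMap_le hlam0.le fun i => ?_
        rw [abs_mul]
        by_cases hi : 2 ≤ i
        · exact mul_le_mul_of_nonneg_right (hst _ i hi) (abs_nonneg _)
        · have : v i = 0 := by fin_cases i <;> simp_all
          simp [this]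
      calc 1 * lam ^ n * ‖diagMap (c.digitRate (w 0)) v‖ ≤ 1 * lam ^ n * (lam * ‖v‖) := by gcongr
        _ = 1 * lam ^ (n + 1) * ‖v‖ := by ring
  · intro v hv
    obtain ⟨hv0, hv1⟩ := hPu v hv
    clear hv
    induction n generalizing w v with
    | zero => simp
    | succ n ih =>
      have h0 : F (c.point fun k => w (k - 1)) = c.point w := by
        rw [hF.apply_point hc]; simp
      have h0' : F.symm (c.point w) = c.point fun k => w (k - 1) := by
        rw [← h0, F.symm_apply_apply]
      have h1 : fderiv ℝ (F.symm^[n + 1]) (c.point w) =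
          fderiv ℝ (F.symm^[n]) (F.symm (c.point w)) ∘L fderiv ℝ F.symm (c.point w) := by
        rw [Function.iterate_succ]
        exact fderiv_comp _ ((hdS.iterate n) _) (hdS _)
      have h3 := diag_symm hr (fun i => (hpos _ i).ne')
        (hF.hasFDerivAt_point hc fun k => w (k - 1))
      rw [h0] at h3
      rw [h1, h3, h0', ContinuousLinearMap.comp_apply]
      refine (ih _ _ (by simp [hv0]) (by simp [hv1])).trans ?_
      have h2 : ‖diagMap (fun i => (c.digitRate (w (0 - 1)) i)⁻¹) v‖ ≤ lam * ‖v‖ := by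
        refine norm_diagMap_le hlam0.le fun i => ?_
        rw [abs_mul]
        by_cases hi : i < 2
        · exact mul_le_mul_of_nonneg_right (hun _ i hi) (abs_nonneg _)
        · have : v i = 0 := by fin_cases i <;> simp_all
          simp [this]
      calc 1 * lam ^ n * ‖diagMap (fun i => (c.digitRate (w (0 - 1)) i)⁻¹) v‖
          ≤ 1 * lam ^ n * (lam * ‖v‖) := by gcongr
        _ = 1 * lam ^ (n + 1) * ‖v‖ := by ring

end

lemma Admissible.point_true (hc : c.Admissible) : (c.point fun _ => true) = c.q := by
  ext i
  have e1 := hc.future.sign_end_mul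
  have e2 := hc.past.sign_end_mul
  fin_cases i
  · exact (eq_codePoint (y := fun _ => 1) hc.future.pair_contraction (fun _ => le_rfl)
      fun n => by simp [pairRate, pairShift]).symm
  · exact (eq_codePoint (y := fun _ => c.a_u) hc.future.sign_contraction (fun _ => le_rfl)
      fun n => by simp only [a_u, signShift, cond_true]; linarith).symm
  · exact (eq_codePoint (y := fun _ => c.a_s) hc.past.sign_contraction (fun _ => le_rfl)
      fun n => by simp only [a_s, signShift, cond_true]; linarith).symm
  · exact (eq_codePoint (y := fun _ => 1) hc.past.pair_contraction (fun _ => le_rfl)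
      fun n => by simp [pairRate, pairShift]).symm

lemma Admissible.point_false (hc : c.Admissible) : (c.point fun _ => false) = c.p₀ := by
  ext i
  have e1 := hc.future.sign_end_mul
  have e2 := hc.past.sign_end_mul
  have e3 := hc.future.end_mul
  have e4 := hc.past.end_mul
  fin_cases i
  · exact (eq_codePoint (y := fun _ => -(1 / (1 - c.cu0⁻¹))) hc.future.pair_contraction
      (fun _ => le_rfl) fun n => by simp only [pairRate, pairShift, cond_false]; linarith).symm
  · exact (eq_codePoint (y := fun _ => -(1 / (1 - c.u⁻¹))) hc.future.sign_contraction
      (fun _ => le_rfl) fun n => by simp only [signShift, cond_false]; linarith).symm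
  · exact (eq_codePoint (y := fun _ => -(1 / (1 - c.s))) hc.past.sign_contraction
      (fun _ => le_rfl) fun n => by simp only [signShift, cond_false]; linarith).symm
  · exact (eq_codePoint (y := fun _ => -(1 / (1 - c.cs0))) hc.past.pair_contraction
      (fun _ => le_rfl) fun n => by simp only [pairRate, pairShift, cond_false]; linarith).symm

lemma IsAffineOn.isSaddleFixedPoint {f : E4 → E4} (hf : c.IsAffineOn f) (hc : c.Admissible)
    (d : Bool) : IsSaddleFixedPoint f (c.point fun _ => d) := by
  have h0 := hc.two_lt_cu0
  have h1 := hc.one_lt_cu1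
  have h2 := hc.u_gt
  have h3 := hc.s_pos
  have h4 := hc.s_lt_cs0
  have h5 := hc.half_lt_cs1
  have h6 := hc.cs1_lt_one
  have h7 := hc.cs0_lt_half
  have hs : |c.s| < 1 := by rw [abs_of_pos h3]; linarith
  have hu : 1 < |c.u| := by rw [abs_of_pos (by linarith)]; linarith
  refine isSaddleFixedPoint_of_diag (hf.apply_point hc _) (hf.hasFDerivAt_point hc _).fderiv
    (fun i => ?_) 2 1 hs hu
  fin_cases i
  · cases d <;> simp only [digitRate, cond] <;> refine (lt_abs.2 (Or.inl ?_)).ne'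
    · change 1 < c.cu0; linarith
    · change 1 < c.cu1; linarith
  · exact hu.ne'
  · exact hs.ne
  · cases d <;> simp only [digitRate, cond] <;> refine (abs_lt.2 ⟨?_, ?_⟩).ne
    · change -1 < c.cs0; linarith
    · change c.cs0 < 1; linarith
    · change -1 < c.cs1; linarith
    · change c.cs1 < 1; linarith

end Rates

/-! ### Parametrised stable sets -/

lemma contDiff_iterate {r : WithTop ℕ∞} {f : E4 → E4} (hf : ContDiff ℝ r f) (n : ℕ) :
    ContDiff ℝ r (f^[n]) := by
  induction n with
  | zero => exact contDiff_id
  | succ n ih => rw [Function.iterate_succ]; exact ih.comp hf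

/-- The local stable leaf of a fixed point, on which the map is linear, extends to a
parametrisation of the whole stable set. -/
theorem exists_stable_param {r : ℕ} (hr : 1 ≤ r) (f : CrDiffeo r) {V : Type*}
    [NormedAddCommGroup V] [NormedSpace ℝ V] (J : V →L[ℝ] E4) (hJ : Function.Injective J)
    (B : V →L[ℝ] V) (hB : Function.Bijective B) {β : ℝ} (hβ0 : 0 ≤ β) (hβ : β < 1)
    (hBβ : ∀ v, ‖B v‖ ≤ β * ‖v‖) {p : E4} {ρ : ℝ} (hρ : 0 < ρ)
    (hloc : ∀ v, ‖v‖ < ρ → f (p + J v) = p + J (B v))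
    (hstab : ∀ y ∈ stableSet f p, ∃ n v, ‖v‖ < ρ ∧ f^[n] y = p + J v) :
    ∃ ι : V → E4, ContDiff ℝ r ι ∧ Function.Injective ι ∧
      (∀ v, Function.Injective (fderiv ℝ ι v)) ∧ range ι = stableSet f p ∧
      ∀ v, (∀ n, f (p + J ((B ^ n) v)) = p + J ((B ^ (n + 1)) v)) → ι v = p + J v := by
  have hr' : (r : WithTop ℕ∞) ≠ 0 := by simp; omega
  have hsucc : ∀ n v, (B ^ (n + 1)) v = B ((B ^ n) v) := fun n v => by rw [pow_succ']; rfl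
  have hBn : ∀ n, Function.Bijective ⇑(B ^ n) := fun n => by
    rw [FunLike.coe_pow_eq_iterate]; exact hB.iterate n
  have hpow : ∀ n v, ‖(B ^ n) v‖ ≤ β ^ n * ‖v‖ := by
    intro n v
    induction n with
    | zero => simp
    | succ n ih =>
      rw [hsucc, pow_succ', mul_assoc]
      exact (hBβ _).trans (mul_le_mul_of_nonneg_left ih hβ0)
  have hto : ∀ v, Tendsto (fun n => (B ^ n) v) atTop (𝓝 0) := fun v =>
    squeeze_zero_norm (fun n => hpow n v)
      (by simpa using (tendsto_pow_atTop_nhds_zero_of_lt_one hβ0 hβ).mul_const ‖v‖)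
  have hex : ∀ v, ∃ n, ‖(B ^ n) v‖ < ρ := fun v =>
    ((hto v).norm.eventually_lt_const (by simpa using hρ)).exists
  have hmono : ∀ v n m, n ≤ m → ‖(B ^ n) v‖ < ρ → ‖(B ^ m) v‖ < ρ := by
    intro v n m hnm hn
    induction m, hnm using Nat.le_induction with
    | base => exact hn
    | succ m _ ih =>
      rw [hsucc]
      refine lt_of_le_of_lt (hBβ _) (lt_of_le_of_lt ?_ ih)
      exact mul_le_of_le_one_left (norm_nonneg _) hβ.le
  have hsymm : ∀ n x, f.symm^[n] (f^[n] x) = x := fun n =>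
    (show Function.LeftInverse f.symm f from f.symm_apply_apply).iterate n
  have hsymm' : ∀ n x, f^[n] (f.symm^[n] x) = x := fun n =>
    (show Function.LeftInverse f f.symm from f.apply_symm_apply).iterate n
  -- Contract the parameter into the linear leaf and pull the point back. The result no longer
  -- depends on `n` once `(B ^ n) v` is in the ball, so `ι` agrees locally with one smooth `G n`.
  let G : ℕ → V → E4 := fun n v => f.symm^[n] (p + J ((B ^ n) v))
  have hG : ∀ v n m, n ≤ m → ‖(B ^ n) v‖ < ρ → G m v = G n v := by
    intro v n m hnm hn
    induction m, hnm using Nat.le_induction with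
    | base => rfl
    | succ m hm ih =>
      rw [← ih]
      change f.symm^[m + 1] _ = f.symm^[m] _
      rw [Function.iterate_succ_apply, hsucc, ← hloc _ (hmono v n m hm hn), f.symm_apply_apply]
  choose N hN using hex
  let ι : V → E4 := fun v => G (N v) v
  have hι : ∀ v n, ‖(B ^ n) v‖ < ρ → ι v = G n v := by
    intro v n hn
    rcases le_total n (N v) with h | h
    · exact hG v n _ h hn
    · exact (hG v _ n h (hN v)).symm
  have hιf : ∀ v n, ‖(B ^ n) v‖ < ρ → f^[n] (ι v) = p + J ((B ^ n) v) := fun v n hn => by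
    rw [hι v n hn]; exact hsymm' n _
  have hnear : ∀ v, ∀ᶠ u in 𝓝 v, ‖(B ^ (N v)) u‖ < ρ := fun v =>
    (B ^ (N v)).continuous.norm.continuousAt.eventually_lt_const (hN v)
  have hGc : ∀ n, ContDiff ℝ r (G n) := fun n =>
    (contDiff_iterate f.symm.contDiff n).comp (contDiff_const.add (J.contDiff.comp (B ^ n).contDiff))
  have hιc : ContDiff ℝ r ι := contDiff_iff_contDiffAt.2 fun v =>
    (hGc (N v)).contDiffAt.congr_of_eventuallyEq ((hnear v).mono fun u hu => hι u _ hu)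
  have hp : f p = p := by simpa using hloc 0 (by simpa using hρ)
  refine ⟨ι, hιc, ?_, ?_, ?_, ?_⟩
  · intro v w h
    have h1 := hmono v _ _ (le_max_left (N v) (N w)) (hN v)
    have h2 := hmono w _ _ (le_max_right (N v) (N w)) (hN w)
    have h3 := (hιf v _ h1).symm.trans ((congrArg _ h).trans (hιf w _ h2))
    exact (hBn _).1 (hJ (add_left_cancel h3))
  · intro v
    have h1 : (fun u => f^[N v] (ι u)) =ᶠ[𝓝 v] fun u => p + J ((B ^ (N v)) u) :=
      (hnear v).mono fun u hu => hιf u _ hu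
    have h2 : HasFDerivAt (fun u => p + J ((B ^ (N v)) u)) (J ∘L (B ^ (N v))) v :=
      ((J ∘L (B ^ (N v))).hasFDerivAt).const_add p
    have hd : DifferentiableAt ℝ (f^[N v]) (ι v) :=
      ((contDiff_iterate f.contDiff _).differentiable hr') _
    have h3 := (hd.hasFDerivAt.comp v ((hιc.differentiable hr') v).hasFDerivAt).unique
      (h2.congr_of_eventuallyEq h1)
    have h4 : Function.Injective (fderiv ℝ (f^[N v]) (ι v) ∘L fderiv ℝ ι v) := by
      rw [h3]; exact hJ.comp (hBn _).1
    exact Function.Injective.of_comp h4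
  · refine Subset.antisymm ?_ fun y hy => ?_
    · rintro _ ⟨v, rfl⟩
      have h1 : Tendsto (fun n => dist p (p + J ((B ^ n) v))) atTop (𝓝 0) := by
        have := (tendsto_const_nhds (x := p)).dist
          ((tendsto_const_nhds (x := p)).add ((J.continuous.tendsto 0).comp (hto v)))
        simpa using this
      refine h1.congr' ?_
      filter_upwards [eventually_ge_atTop (N v)] with n hn
      rw [Function.iterate_fixed hp, hιf v n (hmono v _ _ hn (hN v))]
    · obtain ⟨n, u, hu, hy'⟩ := hstab y hy
      obtain ⟨v, rfl⟩ := (hBn n).2 u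
      refine ⟨v, ?_⟩
      rw [hι v n hu]
      change f.symm^[n] _ = y
      rw [← hy', hsymm]
  -- The linear formula holds beyond the ball as long as the whole forward orbit follows it; the
  -- tangency is not assumed to be close to the fixed point.
  · intro v hv
    have h1 : ∀ n, f^[n] (p + J v) = p + J ((B ^ n) v) := by
      intro n
      induction n with
      | zero => simp
      | succ n ih => rw [Function.iterate_succ_apply', ih, hv]
    change f.symm^[N v] _ = _
    rw [← h1, hsymm]

/-- Near a fixed point at which the map is affine and diagonal, forward asymptotic orbits have no
expanding coordinates. -/
lemma eventually_coord_eq_of_mem_stableSet {f : E4 → E4} {p y : E4} {A : Fin 4 → ℝ}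
    (hp : f p = p) (hnear : ∀ᶠ x in 𝓝 p, f x = p + diagMap A (x - p)) (hy : y ∈ stableSet f p) :
    ∀ᶠ n in atTop, ∀ i, 1 < A i → (f^[n] y) i = p i := by
  have hlim : Tendsto (fun n => f^[n] y) atTop (𝓝 p) := by
    rw [tendsto_iff_dist_tendsto_zero]
    refine Tendsto.congr (fun n => ?_) (show Tendsto _ _ _ from hy)
    rw [Function.iterate_fixed hp, dist_comm]
  obtain ⟨N, hN⟩ := eventually_atTop.1 ((hlim.eventually hnear).and
    (Metric.tendsto_nhds.1 hlim 1 one_pos))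
  filter_upwards [eventually_ge_atTop N] with n hn i hi
  have h1 : ∀ k, (f^[n + k] y) i - p i = A i ^ k * ((f^[n] y) i - p i) := by
    intro k
    induction k with
    | zero => simp
    | succ k ih =>
      rw [← add_assoc, Function.iterate_succ_apply', (hN (n + k) (by omega)).1]
      simp only [PiLp.add_apply, diagMap_apply, PiLp.sub_apply, ih]
      ring
  by_contra hne
  have h2 : 0 < |(f^[n] y) i - p i| := abs_pos.2 (sub_ne_zero.2 hne)
  obtain ⟨k, hk⟩ := pow_unbounded_of_one_lt (|(f^[n] y) i - p i|⁻¹) hi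
  have h3 := (E4.abs_sub_apply_le (f^[n + k] y) p i).trans_lt (hN (n + k) (by omega)).2
  rw [h1, abs_mul, abs_of_pos (by positivity)] at h3
  rw [inv_lt_iff_one_lt_mul₀ h2] at hk
  linarith

/-- Application of a diffeomorphism fixing `p` permutes its unstable set. -/
lemma image_stableSet_symm {r : ℕ} (f : CrDiffeo r) {p : E4} (hp : f p = p) :
    f '' stableSet f.symm p = stableSet f.symm p := by
  have hp' : f.symm p = p := by
    conv_lhs => rw [← hp]
    exact f.symm_apply_apply p
  have key : ∀ y, f y ∈ stableSet f.symm p ↔ y ∈ stableSet f.symm p := by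
    intro y
    simp only [stableSet, mem_ofPred_eq]
    rw [← tendsto_add_atTop_iff_nat 1]
    simp only [Function.iterate_fixed hp', Function.iterate_succ_apply, f.symm_apply_apply]
  refine Subset.antisymm ?_ fun y hy => ⟨f.symm y, ?_, f.apply_symm_apply y⟩
  · rintro _ ⟨y, hy, rfl⟩
    exact (key y).2 hy
  · rw [← key, f.apply_symm_apply]; exact hy

/-! ### The homoclinic tangency -/

lemma eventually_coord_mem {n : ℕ} {v : EuclideanSpace ℝ (Fin n)} {a b : ℝ} (k : Fin n)
    (ha : a < v k) (hb : v k < b) : ∀ᶠ u in 𝓝 v, u k ∈ Icc a b :=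
  (show ContinuousAt (fun u : EuclideanSpace ℝ (Fin n) => u k) v by fun_prop).eventually
    (Icc_mem_nhds ha hb)

/-- The embedding of the plane as the coordinate plane of the given two coordinates. -/
def coordPlane (i j : Fin 4) : EuclideanSpace ℝ (Fin 2) →L[ℝ] E4 :=
  (EuclideanSpace.proj 0).smulRight (EuclideanSpace.single i (1 : ℝ)) +
    (EuclideanSpace.proj 1).smulRight (EuclideanSpace.single j (1 : ℝ))

lemma coordPlane_apply (i j : Fin 4) (v : EuclideanSpace ℝ (Fin 2)) (k : Fin 4) :
    coordPlane i j v k = v 0 * (if k = i then 1 else 0) + v 1 * (if k = j then 1 else 0) := by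
  simp [coordPlane]

lemma coordPlane_injective {i j : Fin 4} (hij : i ≠ j) : Function.Injective (coordPlane i j) := by
  intro v w h
  have h0 := congrArg (fun x : E4 => x i) h
  have h1 := congrArg (fun x : E4 => x j) h
  simp only [coordPlane_apply, if_true, if_neg hij, if_neg hij.symm] at h0 h1
  ext k
  fin_cases k
  · simpa using h0
  · simpa using h1

lemma norm_coordPlane {i j : Fin 4} (hij : i ≠ j) (v : EuclideanSpace ℝ (Fin 2)) :
    ‖coordPlane i j v‖ = ‖v‖ := by
  rw [EuclideanSpace.norm_eq, EuclideanSpace.norm_eq]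
  congr 1
  simp only [Fin.sum_univ_two, coordPlane_apply]
  rw [← Finset.sum_subset (Finset.subset_univ {i, j}), Finset.sum_pair hij]
  · simp [hij, hij.symm]
  · intro k _ hk
    simp only [Finset.mem_insert, Finset.mem_singleton, not_or] at hk
    simp [hk.1, hk.2]

/-- The stable set of a fixed point at which a diffeomorphism is affine and diagonal, with two
contracting coordinates `i` and `j`. -/
theorem exists_plane_param {r : ℕ} (hr : 1 ≤ r) (f : CrDiffeo r) {p : E4} {A : Fin 4 → ℝ}
    {i j : Fin 4} (hij : i ≠ j) (hA : ∀ k, 0 < A k) (hi : A i < 1) (hj : A j < 1)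
    (hk : ∀ k, k ≠ i → k ≠ j → 1 < A k)
    (hnear : ∀ᶠ x in 𝓝 p, f x = p + diagMap A (x - p)) :
    ∃ ι : EuclideanSpace ℝ (Fin 2) → E4, ContDiff ℝ r ι ∧ Function.Injective ι ∧
      (∀ v, Function.Injective (fderiv ℝ ι v)) ∧ range ι = stableSet f p ∧
      ∀ v, (∀ n, f (p + coordPlane i j !₂[A i ^ n * v 0, A j ^ n * v 1]) =
        p + coordPlane i j !₂[A i ^ (n + 1) * v 0, A j ^ (n + 1) * v 1]) →
        ι v = p + coordPlane i j v := by
  set B : EuclideanSpace ℝ (Fin 2) →L[ℝ] EuclideanSpace ℝ (Fin 2) := diagMap ![A i, A j] with hB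
  have hBn : ∀ n v, (B ^ n) v = !₂[A i ^ n * v 0, A j ^ n * v 1] := by
    intro n v
    induction n with
    | zero => ext k; fin_cases k <;> simp
    | succ n ih =>
      rw [pow_succ']
      change B ((B ^ n) v) = _
      rw [ih]
      ext k; fin_cases k <;> simp [hB, pow_succ', mul_assoc]
  have hBb : Function.Bijective B := by
    refine Function.bijective_iff_has_inverse.2 ⟨diagMap ![(A i)⁻¹, (A j)⁻¹], fun v => ?_,
      fun v => ?_⟩ <;> ext k <;> fin_cases k <;> simp [hB, (hA i).ne', (hA j).ne']
  have hJB : ∀ v, diagMap A (coordPlane i j v) = coordPlane i j (B v) := by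
    intro v
    ext k
    rw [diagMap_apply, coordPlane_apply, coordPlane_apply]
    by_cases h1 : k = i
    · subst h1; simp [hB, hij]
    · by_cases h2 : k = j
      · subst h2; simp [hB, h1]
      · simp [h1, h2]
  obtain ⟨ρ, hρ, hball⟩ := Metric.eventually_nhds_iff.1 hnear
  have hp : f p = p := by simpa using hnear.self_of_nhds
  have hβ0 : 0 ≤ max (A i) (A j) := le_max_of_le_left (hA i).le
  have hBβ : ∀ v, ‖B v‖ ≤ max (A i) (A j) * ‖v‖ := fun v => norm_diagMap_le hβ0 fun k => by
    rw [abs_mul]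
    refine mul_le_mul_of_nonneg_right ?_ (abs_nonneg _)
    fin_cases k
    · exact (abs_of_pos (hA i)).trans_le (le_max_left _ _)
    · exact (abs_of_pos (hA j)).trans_le (le_max_right _ _)
  have hloc : ∀ v, ‖v‖ < ρ → f (p + coordPlane i j v) = p + coordPlane i j (B v) := fun v hv => by
    rw [hball (by rwa [dist_self_add_left, norm_coordPlane hij]), add_sub_cancel_left, hJB]
  have hstab : ∀ y ∈ stableSet f p, ∃ n v, ‖v‖ < ρ ∧ f^[n] y = p + coordPlane i j v := by
    intro y hy
    have hlim : Tendsto (fun n => dist (f^[n] p) (f^[n] y)) atTop (𝓝 0) := hy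
    obtain ⟨n, hn, hn'⟩ := ((eventually_coord_eq_of_mem_stableSet hp hnear hy).and
      (hlim.eventually_lt_const hρ)).exists
    have h6 : f^[n] y = p + coordPlane i j !₂[(f^[n] y) i - p i, (f^[n] y) j - p j] := by
      ext k
      rw [PiLp.add_apply, coordPlane_apply]
      by_cases h1 : k = i
      · subst h1; simp [hij]
      · by_cases h2 : k = j
        · subst h2; simp [h1]
        · simp [h1, h2, hn k (hk k h1 h2)]
    refine ⟨n, _, ?_, h6⟩
    rw [← norm_coordPlane hij]
    rw [Function.iterate_fixed hp, h6, dist_self_add_right] at hn'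
    exact hn'
  obtain ⟨ι, h1, h2, h3, h4, h5⟩ := exists_stable_param hr f (coordPlane i j)
    (coordPlane_injective hij) B hBb hβ0 (max_lt hi hj) hBβ hρ hloc hstab
  refine ⟨ι, h1, h2, h3, h4, fun v hv => h5 v fun n => ?_⟩
  rw [hBn, hBn]; exact hv n

/-! ### Tangent planes of the invariant manifolds of `q` -/

namespace Rates

variable {c : Rates}

lemma IsAffineOn.apply_q {f : E4 → E4} (hf : c.IsAffineOn f) (hc : c.Admissible) :
    f c.q = c.q := by
  rw [← hc.point_true]; exact hf.apply_point hc _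

lemma IsAffineOn.apply_eq_of_mem_box1 {f : E4 → E4} (hf : c.IsAffineOn f) (hc : c.Admissible)
    {x : E4} (hx : x ∈ c.box1) : f x = c.q + diagMap (c.digitRate true) (x - c.q) := by
  have hq : c.q ∈ c.box true := hc.point_true ▸ hc.point_mem_box fun _ => true
  have h1 := hf.eq_diag (d := true) hx
  have h2 := hf.eq_diag hq
  rw [hf.apply_q hc] at h2
  rw [h1, map_sub]
  nth_rewrite 1 [h2]
  abel

lemma Admissible.box1_mem_nhds_q (hc : c.Admissible) : c.box1 ∈ 𝓝 c.q := by
  have := hc.box_mem_nhds fun _ => true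
  rwa [hc.point_true] at this

variable {r : ℕ} {F : CrDiffeo r}

lemma IsAffineOn.eventually_symm_eq (hF : c.IsAffineOn F) (hc : c.Admissible) :
    ∀ᶠ x in 𝓝 c.q, F.symm x = c.q + diagMap (fun i => (c.digitRate true i)⁻¹) (x - c.q) := by
  have hq : F.symm c.q = c.q := by
    conv_lhs => rw [← hF.apply_q hc]
    exact F.symm_apply_apply c.q
  have h1 : Tendsto F.symm (𝓝 c.q) (𝓝 c.q) := by
    have := F.symm.continuous.tendsto c.q
    rwa [hq] at this
  filter_upwards [h1.eventually hc.box1_mem_nhds_q] with x hx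
  have h2 := hF.apply_eq_of_mem_box1 hc hx
  rw [F.apply_symm_apply] at h2
  rw [← sub_eq_iff_eq_add'] at h2 ⊢
  rw [h2]
  ext i
  simp [(hc.digitRate_pos true i).ne']

/-- The tangent space of the stable set of `q` along its local leaf. -/
lemma IsAffineOn.isTangentSpaceAt_stable (hF : c.IsAffineOn F) (hc : c.Admissible) (hr : 1 ≤ r) :
    IsTangentSpaceAt r (stableSet F c.q) !₂[1, c.a_u, 0, 0]
      (LinearMap.range (coordPlane 2 3 : EuclideanSpace ℝ (Fin 2) →ₗ[ℝ] E4)) := by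
  have hs0 := hc.s_pos
  have hs1 : c.s < 1 := by linarith [hc.s_lt_cs0, hc.cs0_lt_half]
  have ht0 : 0 < c.cs1 := by linarith [hc.half_lt_cs1]
  have hs2 : 0 < c.a_s := by have := hc.past.one_lt_sign_end; unfold a_s; linarith
  have hs3 : c.a_s < 2 := hc.past.sign_end_lt_two
  have hq : c.q ∈ c.box1 := mem_of_mem_nhds hc.box1_mem_nhds_q
  obtain ⟨ι, h1, h2, h3, h4, h5⟩ := exists_plane_param hr F (A := c.digitRate true)
    (i := 2) (j := 3) (by decide) (hc.digitRate_pos true) hs1 hc.cs1_lt_one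
    (fun k hk2 hk3 => by
      fin_cases k
      · exact hc.one_lt_cu1
      · exact (one_lt_two.trans hc.u_gt : 1 < c.u)
      · exact absurd rfl hk2
      · exact absurd rfl hk3)
    (by filter_upwards [hc.box1_mem_nhds_q] with x hx using hF.apply_eq_of_mem_box1 hc hx)
  have hleaf : ∀ v : EuclideanSpace ℝ (Fin 2), v 0 ∈ Icc (-2 - c.a_s) (2 - c.a_s) →
      v 1 ∈ Icc (-3 : ℝ) 1 → ι v = c.q + coordPlane 2 3 v := by
    intro v hv0 hv1
    refine h5 v fun n => ?_
    have hp : ∀ {t x a b : ℝ}, 0 ≤ t → t ≤ 1 → a ≤ 0 → 0 ≤ b → x ∈ Icc a b → t * x ∈ Icc a b := by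
      intro t x a b h0 h1 ha hb hx
      constructor <;> nlinarith [hx.1, hx.2]
    have m0 := hp (pow_nonneg hs0.le n) (pow_le_one₀ hs0.le hs1.le) (by linarith) (by linarith) hv0
    have m1 := hp (pow_nonneg ht0.le n) (pow_le_one₀ ht0.le hc.cs1_lt_one.le) (by norm_num)
      (by norm_num) hv1
    rw [hF.apply_eq_of_mem_box1 hc, add_sub_cancel_left]
    · congr 1
      ext k
      fin_cases k <;> simp [coordPlane_apply, digitRate, pow_succ'] <;> ring
    · refine ⟨?_, ?_, ?_, ?_⟩
      · simpa [coordPlane_apply] using hq.1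
      · simpa [coordPlane_apply] using hq.2.1
      · have hx : (c.q + coordPlane 2 3 !₂[c.digitRate true 2 ^ n * v 0,
            c.digitRate true 3 ^ n * v 1]) 2 = c.a_s + c.s ^ n * v 0 := by
          simp [coordPlane_apply, q, digitRate]
        rw [hx]
        constructor <;> linarith [m0.1, m0.2]
      · have hx : (c.q + coordPlane 2 3 !₂[c.digitRate true 2 ^ n * v 0,
            c.digitRate true 3 ^ n * v 1]) 3 = 1 + c.cs1 ^ n * v 1 := by
          simp [coordPlane_apply, q, digitRate]
        rw [hx]
        constructor <;> linarith [m1.1, m1.2]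
  -- The parameter of the tangency point, which lies in the part of the stable leaf of `q` contained
  -- in the second box.
  set v : EuclideanSpace ℝ (Fin 2) := !₂[-c.a_s, -1] with hv
  refine ⟨2, ι, h1, h2, h3, h4, v, ?_, ?_⟩
  · rw [hleaf v (by simp [hv]) (by simp [hv])]
    ext k
    fin_cases k <;> simp [hv, coordPlane_apply, q]
  · have hev : ι =ᶠ[𝓝 v] fun u => c.q + coordPlane 2 3 u := by
      filter_upwards [eventually_coord_mem (v := v) 0 (a := -2 - c.a_s) (b := 2 - c.a_s)
          (by simp [hv]; linarith) (by simp [hv]),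
        eventually_coord_mem (v := v) 1 (a := -3) (b := 1) (by simp [hv]) (by simp [hv])]
        with u hu0 hu1 using hleaf u hu0 hu1
    have h6 : HasFDerivAt ι (coordPlane 2 3) v :=
      ((coordPlane 2 3).hasFDerivAt.const_add c.q).congr_of_eventuallyEq hev
    rw [h6.fderiv]

/-- The tangent space of the unstable set of `q` at the image of the tangency box. -/
lemma isTangentSpaceAt_unstable {lst mst δ a₁ a₂ : ℝ} (hc : c.Admissible) (hr : 1 ≤ r)
    (hF : c.IsAffineOn F) (hm : IsModelMap c lst mst δ a₁ a₂ F) (hδ : 0 < δ) (ha₂ : a₂ ≠ 0) :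
    IsTangentSpaceAt r (stableSet F.symm c.q) !₂[1, c.a_u, 0, 0]
      (LinearMap.range (coordPlane 2 3 : EuclideanSpace ℝ (Fin 2) →ₗ[ℝ] E4)) := by
  have hr' : (r : WithTop ℕ∞) ≠ 0 := by simp; omega
  have hu0 := hc.u_pos
  have hu1 : 1 < c.u := one_lt_two.trans hc.u_gt
  have hcu0 := hc.cu1_pos
  have hau1 : 1 < c.a_u := hc.future.one_lt_sign_end
  have hau2 : c.a_u < 2 := hc.future.sign_end_lt_two
  have hau : c.u⁻¹ * c.a_u = c.a_u - 1 := hc.future.sign_end_mul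
  have has0 : 0 < c.a_s := by have := hc.past.one_lt_sign_end; unfold a_s; linarith
  have has2 : c.a_s < 2 := hc.past.sign_end_lt_two
  have hq : c.q ∈ c.box1 := mem_of_mem_nhds hc.box1_mem_nhds_q
  have hui := inv_lt_one_of_one_lt₀ hu1
  have hcui := inv_lt_one_of_one_lt₀ hc.one_lt_cu1
  have hui0 := inv_pos.2 hu0
  have hcui0 := inv_pos.2 hcu0
  obtain ⟨ι, h1, h2, h3, h4, h5⟩ := exists_plane_param hr F.symm
    (A := fun i => (c.digitRate true i)⁻¹)
    (i := 0) (j := 1) (by decide) (fun i => inv_pos.2 (hc.digitRate_pos true i)) hcui hui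
    (fun k hk0 hk1 => by
      fin_cases k
      · exact absurd rfl hk0
      · exact absurd rfl hk1
      · exact (one_lt_inv₀ hc.s_pos).2 (by linarith [hc.s_lt_cs0, hc.cs0_lt_half])
      · exact (one_lt_inv₀ (by linarith [hc.half_lt_cs1] : 0 < c.cs1)).2 hc.cs1_lt_one)
    (hF.eventually_symm_eq hc)
  have hleaf : ∀ v : EuclideanSpace ℝ (Fin 2), v 0 ∈ Icc (-3 : ℝ) 1 →
      v 1 ∈ Icc (-2 - c.a_u) (2 - c.a_u) → ι v = c.q + coordPlane 0 1 v := by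
    intro v hv0 hv1
    refine h5 v fun n => ?_
    have hp : ∀ {t x a b : ℝ}, 0 ≤ t → t ≤ 1 → a ≤ 0 → 0 ≤ b → x ∈ Icc a b → t * x ∈ Icc a b := by
      intro t x a b h0 h1 ha hb hx
      constructor <;> nlinarith [hx.1, hx.2]
    have m0 := hp (pow_nonneg hcui0.le n) (pow_le_one₀ hcui0.le hcui.le) (by norm_num)
      (by norm_num) hv0
    have m1 := hp (pow_nonneg hui0.le n) (pow_le_one₀ hui0.le hui.le) (by linarith) (by linarith)
      hv1
    refine F.toEquiv.symm_apply_eq.2 (Eq.symm ?_)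
    change F _ = _
    rw [hF.apply_eq_of_mem_box1 hc, add_sub_cancel_left]
    · congr 1
      ext k
      fin_cases k <;> simp [coordPlane_apply, digitRate, pow_succ'] <;> field_simp
    · refine ⟨?_, ?_, ?_, ?_⟩
      · have hx : (c.q + coordPlane 0 1 !₂[(c.digitRate true 0)⁻¹ ^ (n + 1) * v 0,
            (c.digitRate true 1)⁻¹ ^ (n + 1) * v 1]) 0 = 1 + c.cu1⁻¹ * (c.cu1⁻¹ ^ n * v 0) := by
          simp [coordPlane_apply, q, digitRate, pow_succ', mul_assoc]
        rw [hx]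
        constructor <;> nlinarith [m0.1, m0.2]
      · have hx : (c.q + coordPlane 0 1 !₂[(c.digitRate true 0)⁻¹ ^ (n + 1) * v 0,
            (c.digitRate true 1)⁻¹ ^ (n + 1) * v 1]) 1 = c.a_u + c.u⁻¹ * (c.u⁻¹ ^ n * v 1) := by
          simp [coordPlane_apply, q, digitRate, pow_succ', mul_assoc]
        rw [hx]
        constructor <;> nlinarith [m1.1, m1.2]
      · simpa [coordPlane_apply] using hq.2.2.1
      · simpa [coordPlane_apply] using hq.2.2.2
  -- The parameter of `(0, 0, a_s, 1)`, which lies on the flat unstable leaf of `q` and in the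
  -- tangency box; the map sends it to the tangency point.
  set v : EuclideanSpace ℝ (Fin 2) := !₂[-1, -c.a_u] with hv
  have hev : ∀ᶠ u in 𝓝 v, F (ι u) = !₂[-(1 + u 0) ^ 2 + 1, -a₁ * (c.a_u + u 1) ^ 2 + c.a_u,
      a₂ * (1 + u 0), c.a_u + u 1] := by
    filter_upwards [
      eventually_coord_mem (v := v) 0 (a := -3) (b := 1) (by simp [hv]) (by simp [hv]),
      eventually_coord_mem (v := v) 1 (a := -2 - c.a_u) (b := 2 - c.a_u) (by simp [hv]; linarith)
        (by simp [hv]),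
      eventually_coord_mem (v := v) 0 (a := -1 - δ) (b := -1 + δ) (by simp [hv, hδ])
        (by simp [hv, hδ]),
      eventually_coord_mem (v := v) 1 (a := -c.a_u - δ) (b := -c.a_u + δ) (by simp [hv, hδ])
        (by simp [hv, hδ])]
      with u u0 u1 u2 u3
    rw [hleaf u u0 u1, hm.on_tangencyBox]
    · ext k
      fin_cases k <;> simp [coordPlane_apply, q]
    · refine ⟨?_, ?_, ?_, ?_⟩
      · simp [coordPlane_apply, q]
        constructor <;> linarith [u2.1, u2.2]
      · simp [coordPlane_apply, q]
        constructor <;> linarith [u3.1, u3.2]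
      · simp [coordPlane_apply, q]
        constructor <;> linarith
      · simp [coordPlane_apply, q]; norm_num
  -- Along the leaf the first two components of the image are purely quadratic with critical point
  -- `v`. Both unstable directions are thus sent into the stable plane, which gives codimension two.
  have hd : HasFDerivAt (fun u => F (ι u)) (coordPlane 2 3 ∘L diagMap ![a₂, 1]) v := by
    refine HasFDerivAt.congr_of_eventuallyEq ?_ hev
    have hp : ∀ k, HasFDerivAt (fun u : EuclideanSpace ℝ (Fin 2) => u k)
        (EuclideanSpace.proj k : EuclideanSpace ℝ (Fin 2) →L[ℝ] ℝ) v := fun k =>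
      (EuclideanSpace.proj k : EuclideanSpace ℝ (Fin 2) →L[ℝ] ℝ).hasFDerivAt
    rw [← hasFDerivWithinAt_univ, hasFDerivWithinAt_euclidean]
    intro k
    rw [hasFDerivWithinAt_univ]
    fin_cases k
    · refine ((((hp 0).const_add 1).pow 2).neg.add_const 1).congr_fderiv ?_
      ext w; simp [hv, coordPlane_apply]
    · refine (((((hp 1).const_add c.a_u).pow 2).const_mul (-a₁)).add_const c.a_u).congr_fderiv ?_
      ext w; simp [hv, coordPlane_apply]
    · refine (((hp 0).const_add 1).const_mul a₂).congr_fderiv ?_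
      ext w; simp [coordPlane_apply]
    · refine ((hp 1).const_add c.a_u).congr_fderiv ?_
      ext w; simp [coordPlane_apply]
  -- The unstable set is invariant, so it is also parametrised by `F ∘ ι`, whose derivative at `v`
  -- has just been found.
  refine ⟨2, F ∘ ι, F.contDiff.comp h1, F.injective.comp h2, fun w => ?_, ?_, v, ?_, ?_⟩
  · have hdF : DifferentiableAt ℝ F (ι w) := (F.contDiff.differentiable hr') _
    rw [fderiv_comp w hdF ((h1.differentiable hr') w)]
    have hdS : DifferentiableAt ℝ F.symm (F (ι w)) := (F.symm.contDiff.differentiable hr') _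
    have h7 := hdS.hasFDerivAt.comp (ι w) hdF.hasFDerivAt
    have h8 : F.symm ∘ F = id := funext fun x => F.symm_apply_apply x
    rw [h8] at h7
    have h9 := h7.unique (hasFDerivAt_id _)
    rw [ContinuousLinearMap.coe_comp]
    refine Function.Injective.comp (g := fderiv ℝ F (ι w)) ?_ (h3 w)
    refine Function.Injective.of_comp (f := fderiv ℝ F.symm (F (ι w))) ?_
    rw [← ContinuousLinearMap.coe_comp, h9]
    exact Function.injective_id
  · rw [range_comp, h4, image_stableSet_symm F (hF.apply_q hc)]
  · change F (ι v) = _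
    rw [hev.self_of_nhds]
    ext k
    fin_cases k <;> simp [hv]
  · rw [show fderiv ℝ (F ∘ ι) v = _ from hd.fderiv]
    refine le_antisymm ?_ ?_
    · rintro _ ⟨w, rfl⟩
      refine ⟨!₂[a₂⁻¹ * w 0, w 1], ?_⟩
      change coordPlane 2 3 (diagMap ![a₂, 1] _) = coordPlane 2 3 w
      congr 1
      ext k
      fin_cases k <;> simp [ha₂]
    · rintro _ ⟨w, rfl⟩
      exact ⟨diagMap ![a₂, 1] w, rfl⟩

theorem isHomoclinicOfCodim_q {lst mst δ a₁ a₂ : ℝ} (hc : c.Admissible) (hr : 1 ≤ r)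
    (hF : c.IsAffineOn F) (hm : IsModelMap c lst mst δ a₁ a₂ F) (hδ : 0 < δ) (ha₂ : a₂ ≠ 0) :
    IsHomoclinicOfCodim F c.q (!₂[1, c.a_u, 0, 0]) 2 := by
  have hs := hF.isTangentSpaceAt_stable hc hr
  have hu := isTangentSpaceAt_unstable hc hr hF hm hδ ha₂
  have hmem : ∀ {W : Set E4} {y : E4} {T : Submodule ℝ E4}, IsTangentSpaceAt r W y T → y ∈ W := by
    rintro W y T ⟨d, ι, -, -, -, hr, u, rfl, -⟩
    exact hr ▸ mem_range_self u
  refine ⟨⟨hmem hs, hmem hu⟩, fun h => ?_, _, _, hs, hu, ?_⟩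
  · have h1 := congrArg (fun x : E4 => x 2) h
    have h2 := hc.past.one_lt_sign_end
    simp [q, a_s] at h1
    rw [one_div, ← h1] at h2
    linarith
  · rw [sup_idem, LinearMap.finrank_range_of_inj (coordPlane_injective (by decide))]
    simp

end Rates

/-! ### The main theorem -/

lemma IsModelMap.isAffineOn {c : Rates} {lst mst δ a₁ a₂ : ℝ} {F : E4 → E4}
    (h : IsModelMap c lst mst δ a₁ a₂ F) : c.IsAffineOn F :=
  ⟨h.on_box0, h.on_box1⟩

namespace Rates

variable {c : Rates}

/-- Diffeomorphisms with routes with long runs approximate the model map. -/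
theorem Admissible.exists_approximations (hc : c.Admissible) :
    ∃ L : ℝ, 0 < L ∧ ∀ lst mst δ a₁ a₂ : ℝ, L ≤ lst → L ≤ mst → 0 < δ → δ < 1 - 2 * c.u⁻¹ →
      0 ≤ a₁ → 0 ≤ a₂ → ∀ r : ℕ, 1 ≤ r → ∀ F : CrDiffeo r, IsModelMap c lst mst δ a₁ a₂ F →
      ∀ b : Bool, ∃ G : ℕ → CrDiffeo r, ConvergesCr r (fun n => G n) F ∧
        ∀ n, ∃ (w : ℕ → List Bool) (ε η : ℕ → ℝ),
          c.IsRoute (G n) lst⁻¹ mst a₁ a₂ δ w ε η ∧ HasLongRuns w b := by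
  obtain ⟨L, hL, h⟩ := hc.exists_perturbed_route
  refine ⟨L, hL, fun lst mst δ a₁ a₂ hlst hmst hδ hδu ha₁ ha₂ r hr F hF b => ?_⟩
  obtain ⟨ε₀, hε₀, hadd⟩ := CrDiffeo.exists_add hr F (isCompact_tangencyBox δ)
  have hξ : ∀ n : ℕ, 0 < min ε₀ (1 / ((n : ℝ) + 1)) := fun n => lt_min hε₀ (by positivity)
  choose g hgc hg0 hgb hroute using
    fun n : ℕ => h lst mst δ a₁ a₂ hlst hmst hδ hδu ha₁ ha₂ r hr F hF _ (hξ n) b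
  have hfd : ∀ n x, ‖fderiv ℝ (g n) x‖ ≤ ε₀ := fun n x => by
    rw [← norm_iteratedFDeriv_one]
    exact (hgb n 1 hr x).trans (min_le_left _ _)
  choose G hG using fun n => hadd (g n) (hgc n) (hg0 n) (hfd n)
  refine ⟨G, convergesCr_of_add (isCompact_tangencyBox δ) G g hgc hG hg0
    fun n i hi x => (hgb n i hi x).trans (min_le_right _ _), fun n => ?_⟩
  rw [show (G n : E4 → E4) = fun x => F x + g n x from funext (hG n)]
  exact hroute n

end Rates

end

theorem theorem1p1 (c : Rates) (hc : c.Admissible) :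
    -- `λ_*` and `μ_*` sufficiently large, depending only on the rates
    ∃ L : ℝ, 0 < L ∧ ∀ lst mst δ a₁ a₂ : ℝ, L ≤ lst → L ≤ mst →
      0 < δ → δ < 1 - 2 * c.u⁻¹ →
      1 / (2 * (1 - 2 * c.u⁻¹)) < a₁ → 0 < a₂ → a₂ < 2 * c.s / δ →
      -- every finite order of differentiability and every extension to a diffeomorphism of `ℝ⁴`
      ∀ r : ℕ, 1 ≤ r → ∀ F : CrDiffeo r, IsModelMap c lst mst δ a₁ a₂ F →
        -- the hyperbolic horseshoe, its blender property and the homoclinic tangency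
        (IsHyperbolicSet F (horseshoe c F) ∧
          IsConjugateToFullShift F (horseshoe c F) ∧
          (fun x : E4 => x 0) '' horseshoe c F = Icc (-c.a_cu) 1 ∧
          (fun x : E4 => x 3) '' horseshoe c F = Icc (-c.a_cs) 1 ∧
          c.q ∈ horseshoe c F ∧ IsSaddleFixedPoint F c.q ∧
          IsHomoclinicOfCodim F c.q (!₂[1, c.a_u, 0, 0]) 2) ∧
        -- the two approximating sequences
        ∃ Fn Gn : ℕ → CrDiffeo r,
          ConvergesCr r (fun n => Fn n) F ∧ ConvergesCr r (fun n => Gn n) F ∧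
          (∀ n : ℕ, ∃ D : Set E4, IsContractingWanderingDomain (Fn n) D ∧
            Bornology.IsBounded (⋃ i : ℕ, (Fn n)^[i] '' D) ∧
            ∀ x ∈ D, HasHistoricBehavior (Fn n) x) ∧
          (∀ n : ℕ, ∃ D : Set E4, IsContractingWanderingDomain (Gn n) D ∧
            Bornology.IsBounded (⋃ i : ℕ, (Gn n)^[i] '' D) ∧
            ∃ p : E4, IsSaddleFixedPoint (Gn n) p ∧
              ∀ x ∈ D, Tendsto (empirical (Gn n) x) atTop
                (𝓝 (⟨Measure.dirac p, inferInstance⟩ : ProbabilityMeasure E4))) := by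
  obtain ⟨L, hL, h⟩ := hc.exists_approximations
  refine ⟨L, hL, fun lst mst δ a₁ a₂ hlst hmst hδ hδu ha₁ ha₂ _ r hr F hF => ?_⟩
  have hA := hF.isAffineOn
  refine ⟨⟨hA.isHyperbolicSet hc hr, hA.isConjugateToFullShift hc, hA.image_zero hc,
    hA.image_three hc, ?_, ?_, Rates.isHomoclinicOfCodim_q hc hr hA hF hδ ha₂.ne'⟩, ?_⟩
  · rw [← hA.range_point hc, ← hc.point_true]
    exact mem_range_self _
  · rw [← hc.point_true]
    exact hA.isSaddleFixedPoint hc true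
  have ha₁' : 0 ≤ a₁ := by
    refine le_trans ?_ ha₁.le
    have : 0 < 1 - 2 * c.u⁻¹ := hδ.trans hδu
    positivity
  have happ := h lst mst δ a₁ a₂ hlst hmst hδ hδu ha₁' ha₂.le r hr F hF
  -- The digit of the first run decides the statistics: `true` gives ones followed by zeros, while
  -- `false` merges both runs into zeros of length `a k + a k`.
  obtain ⟨Fn, hFn, hFr⟩ := happ true
  obtain ⟨Gn, hGn, hGr⟩ := happ false
  refine ⟨Fn, Gn, hFn, hGn, fun n => ?_, fun n => ?_⟩
  · obtain ⟨w, ε, η, hr, φ, ψ, a, C, hC, ha, -, hw, hT, -, -⟩ := hFr n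
    exact ⟨_, hr.isContractingWanderingDomain hc hδu (Fn n).continuous (Fn n).injective,
      hr.isBounded_orbit hc, fun x hx => hr.hasHistoricBehavior hc hC ha hw hT hx⟩
  · obtain ⟨w, ε, η, hr, φ, ψ, a, C, hC, -, ha, hw, -, hT, hrat⟩ := hGr n
    refine ⟨_, hr.isContractingWanderingDomain hc hδu (Gn n).continuous (Gn n).injective,
      hr.isBounded_orbit hc, c.p₀, ?_, fun x hx => ?_⟩
    · rw [← hc.point_false]
      exact hr.affine.isSaddleFixedPoint hc false
    · refine hr.tendsto_empirical hc (φ := φ) (ψ := ψ) (a := fun k => a k + a k)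
        (tendsto_atTop_mono (fun k => Nat.le_add_right _ _) ha) (fun k => ?_) hT (fun e he => ?_) hx
      · rw [hw, List.replicate_add, List.append_assoc (φ k)]
      · filter_upwards [hrat e he] with k hk
        refine hk.trans (mul_le_mul_of_nonneg_left ?_ he.le)
        exact_mod_cast Nat.le_add_right _ _
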